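/- Let $q$ be a prime power with $q\equiv 5$ or $9 \pmod{12}$. A hyperbolic quadric $\mathcal Q^+(5,q)$ is the set of points of $\mathrm{PG}(V)$, $\dim_{\mathbb F_q}V=6$, on which a nondegenerate quadratic form $Q$ of Witt index $3$ vanishes. Two of its points are collinear if their representatives are orthogonal for the polar form of $Q$. Write $p^\perp$ for the set of points of the quadric collinear with $p$ (including $p$). A generator is a plane contained in the quadric, and a set $\mathcal T$ of points of the quadric is $x$-tight if $|p^\perp\cap\mathcal T| = x(q+1)+q^2 c_{\mathcal T}(p)$ for every point $p$ of the quadric, where $c_{\mathcal T}$ is the characteristic function of $\mathcal T$. Let $\alpha$ be a primitive element of $\mathbb F_{q^3}$, $\mu=\alpha^{q-1}$, $\omega=\alpha^{q^2+q+1}$, and let $\mathrm T$ be the trace from $\mathbb F_{q^3}$ to $\mathbb F_q$. Then every form $Q$ as above is isometric to the form $(u,v)\mapsto \mathrm T(uv)$ on $\mathbb F_{q^3}^2$. Under any such isometric identification $V=\mathbb F_{q^3}^2$ let $\pi_1=\{(x,0)\}$, $\pi_2=\{(0,y)\}$ and $G=\langle c,z\rangle$, where $$c:(u,v)\mapsto(\mu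 u,\mu^{-1}v),\qquad z:(u,v)\mapsto(u,\omega^4v).$$ Then $G$ is an abelian group of similarities of $Q$, $\pi_1$ and $\pi_2$ are generators and are $1$-tight, and there are sets $\mathcal T_1,\mathcal T_2$ of points such that: 1. $\pi_1,\pi_2,\mathcal T_1,\mathcal T_2$ are pairwise disjoint and their union is the quadric; 2. $\mathcal T_1$ and $\mathcal T_2$ are $\frac{q^2-1}{2}$-tight, and some similarity of $Q$ maps $\mathcal T_1$ onto $\mathcal T_2$; 3. $\mathcal T_1$ and $\mathcal T_2$ are unions of $G$-orbits; 4. under every Klein correspondence between the lines of $\mathrm{PG}(3,q)$ and the points of the quadric (Plücker coordinates followed by a linear similarity onto $(V,Q)$), $\mathcal T_1$ and $\mathcal T_2$ correspond to Cameron–Liebler line classes $\mathcal L_1,\mathcal L_2$ with parameter $\frac{q^2-1}{2}$, and some collineation of $\mathrm{PG}(3,q)$ induced by a linear map takes $\mathcal L_1$ to $\mathcal L_2$. Here a set $\mathcal L$ of lines is a Cameron–Liebler line class if its characteristic vector lies in the (rational) row space of the point-line incidence matrix, and its parameter is $x$ if every spread contains exactly $x$ lines of $\mathcal L$. Moreover,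 there is a Klein correspondence under which $\pi_1$ corresponds to the set of all lines through a point $p$ and $\pi_2$ to the set of all lines in a plane not containing $p$. -/

import Mathlib

open scoped LinearAlgebra.Projectivization

noncomputable section

namespace TightSets

section Quadrics

variable {F V : Type*} [Field F] [AddCommGroup V] [Module F V]

/-- A subspace on which the quadratic form vanishes identically. -/
def IsTotallySingular (Q : QuadraticForm F V) (W : Submodule F V) : Prop :=
  ∀ w ∈ W, Q w = 0

/-- `Q` defines a hyperbolic quadric `Q⁺(5,q)`: it is a nondegenerate quadratic form
on a `6`-dimensional space, of Witt index `3`. -/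
structure IsHyperbolicQuadric (Q : QuadraticForm F V) : Prop where
  finrank_eq : Module.finrank F V = 6
  nondegenerate : ∀ v : V, (∀ w : V, QuadraticMap.polar Q v w = 0) → v = 0
  exists_singular : ∃ W : Submodule F V, IsTotallySingular Q W ∧ Module.finrank F W = 3
  finrank_le : ∀ W : Submodule F V, IsTotallySingular Q W → Module.finrank F W ≤ 3

/-- The projective points contained in a subspace. -/
def pointsOf (W : Submodule F V) : Set (ℙ F V) := {p | p.submodule ≤ W}

/-- The points of the quadric defined by `Q`. -/
def quadric (Q : QuadraticForm F V) : Set (ℙ F V) := {p | Q p.rep = 0}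

/-- `p^⊥`: the points of the quadric collinear with `p` (including `p` when it is on the
quadric). -/
def perp (Q : QuadraticForm F V) (p : ℙ F V) : Set (ℙ F V) :=
  {r | r ∈ quadric Q ∧ QuadraticMap.polar Q p.rep r.rep = 0}

/-- The generators of the quadric: the projective subspaces of maximal dimension
contained in it, as sets of points. -/
def IsGenerator (Q : QuadraticForm F V) (P : Set (ℙ F V)) : Prop :=
  ∃ W : Submodule F V, IsTotallySingular Q W ∧
    (∀ W' : Submodule F V, IsTotallySingular Q W' → Module.finrank F W' ≤ Module.finrank F W) ∧
    P = pointsOf W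

open Classical in
/-- `T` is an `x`-tight set of the quadric of `Q` over the field with `q` elements:
`|p^⊥ ∩ T| = x (q + 1) + q² c_T(p)` for every point `p` of the quadric. -/
def IsTight (Q : QuadraticForm F V) (x : ℕ) (T : Set (ℙ F V)) : Prop :=
  T ⊆ quadric Q ∧ ∀ p ∈ quadric Q,
    (perp Q p ∩ T).ncard = x * (Nat.card F + 1) + (Nat.card F) ^ 2 * (if p ∈ T then 1 else 0)

/-- A linear automorphism that multiplies the form by a nonzero scalar. -/
def IsSimilarity (Q : QuadraticForm F V) (f : V ≃ₗ[F] V) : Prop :=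
  ∃ k : F, k ≠ 0 ∧ ∀ v, Q (f v) = k * Q v

end Quadrics

section Model

variable (F : Type*) {E : Type*} [Field F] [Field E] [Algebra F E]

variable (E) in
/-- The quadratic form `(u, v) ↦ T(uv)` on `E × E`, with `T` the trace from `E` to `F`. -/
def traceQuadric : QuadraticForm F (E × E) :=
  LinearMap.BilinMap.toQuadraticMap
    ((Algebra.traceForm F E).compl₁₂ (LinearMap.fst F E E) (LinearMap.snd F E E))

theorem traceQuadric_apply (w : E × E) :
    traceQuadric F E w = Algebra.trace F E (w.1 * w.2) := rfl

/-- The map `(u, v) ↦ (s u, t v)` for units `s`, `t` of `E`. -/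
def diagMap (s t : Eˣ) : (E × E) ≃ₗ[F] (E × E) where
  toFun w := (s * w.1, t * w.2)
  invFun w := ((s⁻¹ : Eˣ) * w.1, (t⁻¹ : Eˣ) * w.2)
  map_add' a b := by simp [mul_add]
  map_smul' k a := by simp
  left_inv a := by simp
  right_inv a := by simp

/-- `μ = α^(q-1)`. -/
def mu (α : Eˣ) : Eˣ := α ^ (Nat.card F - 1)

/-- `ω = α^(q²+q+1)`. -/
def omega (α : Eˣ) : Eˣ := α ^ ((Nat.card F) ^ 2 + Nat.card F + 1)

/-- `c : (u, v) ↦ (μ u, μ⁻¹ v)`. -/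
def cMap (α : Eˣ) : (E × E) ≃ₗ[F] (E × E) := diagMap F (mu F α) (mu F α)⁻¹

/-- `z : (u, v) ↦ (u, ω⁴ v)`. -/
def zMap (α : Eˣ) : (E × E) ≃ₗ[F] (E × E) := diagMap F 1 (omega F α ^ 4)

variable {F} {V : Type*} [AddCommGroup V] [Module F V]

/-- The group `G = ⟨c, z⟩`, acting on `V` through an identification `e` of `E × E` with `V`. -/
def groupG (e : (E × E) ≃ₗ[F] V) (α : Eˣ) : Subgroup (V ≃ₗ[F] V) :=
  Subgroup.closure
    {e.symm.trans ((cMap F α).trans e), e.symm.trans ((zMap F α).trans e)}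

/-- `π₁ = {(x, 0)}`, as a set of points of `PG(V)`. -/
def pi1 (e : (E × E) ≃ₗ[F] V) : Set (ℙ F V) :=
  pointsOf ((Submodule.prod ⊤ ⊥ : Submodule F (E × E)).map (e : (E × E) →ₗ[F] V))

/-- `π₂ = {(0, y)}`, as a set of points of `PG(V)`. -/
def pi2 (e : (E × E) ≃ₗ[F] V) : Set (ℙ F V) :=
  pointsOf ((Submodule.prod ⊥ ⊤ : Submodule F (E × E)).map (e : (E × E) →ₗ[F] V))

end Model

section Lines

variable (F : Type*) [Field F]

/-- The points of `PG(3,q)`. -/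
abbrev PG3Point := ℙ F (Fin 4 → F)

/-- The lines of `PG(3,q)`. -/
abbrev PG3Line := {l : Submodule F (Fin 4 → F) // Module.finrank F l = 2}

open Classical in
/-- The point-line incidence matrix of `PG(3,q)`. -/
def incMatrix : Matrix (PG3Point F) (PG3Line F) ℚ :=
  fun p l => if p.submodule ≤ l.1 then 1 else 0

variable {F}

/-- A spread: a set of lines such that every point is on exactly one of them. -/
def IsSpread (S : Set (PG3Line F)) : Prop :=
  ∀ p : PG3Point F, ∃! l : PG3Line F, l ∈ S ∧ p.submodule ≤ l.1

/-- `L` is a Cameron–Liebler line class (its characteristic vector is in the row space of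
the incidence matrix) with parameter `x` (every spread has exactly `x` lines in `L`). -/
def IsCameronLiebler (L : Set (PG3Line F)) (x : ℕ) : Prop :=
  Set.indicator L (fun _ => (1 : ℚ)) ∈ Submodule.span ℚ (Set.range fun p => incMatrix F p) ∧
    ∀ S : Set (PG3Line F), IsSpread S → (S ∩ L).ncard = x

/-- The lines through a point. -/
def star (p : PG3Point F) : Set (PG3Line F) := {l | p.submodule ≤ l.1}

/-- The lines contained in a plane. -/
def linesIn (H : Submodule F (Fin 4 → F)) : Set (PG3Line F) := {l | l.1 ≤ H}

/-- The image of a line under a linear collineation of `PG(3,q)`. -/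
def mapLine (g : (Fin 4 → F) ≃ₗ[F] (Fin 4 → F)) (l : PG3Line F) : PG3Line F :=
  ⟨l.1.map (g : (Fin 4 → F) →ₗ[F] (Fin 4 → F)), by
    rw [LinearEquiv.finrank_map_eq]; exact l.2⟩

/-- The Plücker coordinates `(p₀₁, p₀₂, p₀₃, p₂₃, p₃₁, p₁₂)` of the line through `x`, `y`. -/
def plucker (x y : Fin 4 → F) : Fin 6 → F :=
  ![x 0 * y 1 - x 1 * y 0, x 0 * y 2 - x 2 * y 0, x 0 * y 3 - x 3 * y 0,
    x 2 * y 3 - x 3 * y 2, x 3 * y 1 - x 1 * y 3, x 1 * y 2 - x 2 * y 1]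

variable {V : Type*} [AddCommGroup V] [Module F V]

/-- A coordinatization `φ` of `V` in which, up to a nonzero scalar, `Q` is the form
`w₀w₃ + w₁w₄ + w₂w₅` that vanishes on all Plücker coordinate vectors. The Klein
correspondence it gives takes the line `⟨x, y⟩` to the point `⟨φ (plucker x y)⟩`. -/
def IsKlein (Q : QuadraticForm F V) (φ : (Fin 6 → F) ≃ₗ[F] V) : Prop :=
  ∃ k : F, k ≠ 0 ∧ ∀ w : Fin 6 → F, Q (φ w) = k * (w 0 * w 3 + w 1 * w 4 + w 2 * w 5)

/-- The lines of `PG(3,q)` that correspond to the points of `T` under the Klein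
correspondence given by `φ`. -/
def kleinLines (φ : (Fin 6 → F) ≃ₗ[F] V) (T : Set (ℙ F V)) : Set (PG3Line F) :=
  {l | ∃ x y : Fin 4 → F, l.1 = Submodule.span F {x, y} ∧
    ∃ h : φ (plucker x y) ≠ 0, Projectivization.mk F (φ (plucker x y)) h ∈ T}

end Lines

end TightSets

end

set_option linter.unusedSectionVars false

noncomputable section

namespace TightSets

/-! ### Quadratic character sums over a finite field of odd order -/

section QuadraticCharSums

variable {K : Type*} [Field K] [Fintype K] [DecidableEq K]

/-! Write F for the field of order q, E for its cubic extension, T for the trace and χ for the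
quadratic characters, which agree on F because the degree is odd. In the model T(uv), the singular
points outside π₁ and π₂ are split by a sign ψ(u,v) = χ(u) ε(uv) (`pairSign`), and 𝒯₁, 𝒯₂ are the
points with ψ = 1 and ψ = -1. Tightness of both sets amounts to elementary counts together with one
eigenvalue equation: for singular a, the sum of ψ(w) over the vectors w orthogonal to a is (q-1)q²
ψ(a) (`sum_pairSign_perp`).

The sign ε lives on the nonzero elements of trace zero. Every d in E is c s² with c in F and s in E,
and T(d) = 0 with d nonzero means that s is a nonzero isotropic vector of the ternary form T(x²).
Put ε(c s²) = η(c) θ(s). Here η extends the quartic residue symbol, η(c y²) = η(c) χ(y), which is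
consistent because -1 is a square (q ≡ 1 mod 4). The sign θ on the cone over the conic T(x²) = 0
satisfies θ(s) θ(t) = χ(2T(st)) for non-orthogonal s, t; it exists because the Gram determinant of
three vectors for the trace form is a square.

For the eigenvalue equation, substitute d = c s² and d₀ = c₀ s₀² (`sum_traceSign`). The sum over u
becomes a Salié-type sum with argument a(u + c'/u), where a = s s₀ and c' = c/c₀. It vanishes for
nonsquare c', and for c' = y² it equals 2q χ(y) χ(2T(a)) (`salieSum_sq`). Weighting by η absorbs
χ(y), and weighting by θ absorbs χ(2T(s s₀)), so every surviving term has the same sign and only a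
count of isotropic vectors remains.

Elements of G multiply u by a square and uv by a fourth power of F, so they preserve ψ. The isometry
(u,v) ↦ (k⁻¹u, kv), with k a nonsquare of F, reverses ψ and exchanges the two sets. On the Klein
quadric it is a product of three scalings of hyperbolic pairs, each a product of two reflections,
and hence comes from a linear collineation. Tightness gives the Cameron–Liebler property by applying
NᵀN, with N the incidence matrix, to the characteristic vector. -/

theorem ringChar_ne_two_of_two_ne_zero {K : Type*} [Field K] (h2 : (2 : K) ≠ 0) :
    ringChar K ≠ 2 := by
  intro h
  have := ringChar.Nat.cast_ringChar (R := K)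
  rw [h] at this
  exact h2 (by exact_mod_cast this)

/-- Summing a function of `x ^ 2`. -/
theorem sum_comp_sq (h2 : (2 : K) ≠ 0) (g : K → ℤ) :
    ∑ x : K, g (x ^ 2) = ∑ w : K, (1 + quadraticChar K w) * g w := by
  rw [← Finset.sum_fiberwise Finset.univ (fun x : K => x ^ 2)]
  refine Finset.sum_congr rfl fun w _ => ?_
  rw [Finset.sum_congr rfl (g := fun _ => g w) (by
    intro x hx; rw [(Finset.mem_filter.1 hx).2])]
  rw [Finset.sum_const, nsmul_eq_mul]
  congr 1
  have := quadraticChar_card_sqrts (ringChar_ne_two_of_two_ne_zero h2) w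
  rw [add_comm, ← this]
  congr 2
  ext x; simp

theorem quadraticChar_inv (u : K) : quadraticChar K u⁻¹ = quadraticChar K u := by
  rcases eq_or_ne u 0 with rfl | hu
  · simp
  have h : quadraticChar K u⁻¹ * quadraticChar K u = 1 := by
    rw [← map_mul, inv_mul_cancel₀ hu, map_one]
  rcases quadraticChar_dichotomy hu with h' | h' <;> rw [h'] at h ⊢ <;> omega

theorem quadraticChar_mul_self {u : K} (hu : u ≠ 0) :
    quadraticChar K u * quadraticChar K u = 1 := by
  rw [← pow_two, quadraticChar_sq_one hu]

theorem quadraticChar_of_isSquare {u : K} (hu : u ≠ 0) (h : IsSquare u) :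
    quadraticChar K u = 1 := (quadraticChar_one_iff_isSquare hu).2 h

/-- The Salié-type sum over `u` of `χ(u) g(u + c/u)` vanishes if `c` is not a square. -/
theorem sum_quadraticChar_add_div_of_not_isSquare {c : K} (hc : ¬ IsSquare c) (g : K → ℤ) :
    ∑ u : K, quadraticChar K u * g (u + c / u) = 0 := by
  have hc0 : c ≠ 0 := by rintro rfl; exact hc (IsSquare.zero)
  -- The involution u ↦ c/u fixes u + c/u and changes χ(u) into χ(c)χ(u) = -χ(u). With division by
  -- zero equal to zero it also fixes u = 0.
  have key : ∑ u : K, quadraticChar K u * g (u + c / u) =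
      ∑ u : K, quadraticChar K (c / u) * g (c / u + c / (c / u)) := by
    refine Finset.sum_bij_ne_zero (fun u _ _ => c / u) (by simp) ?_ ?_ ?_
    · intro a _ _ b _ _ h
      rw [← div_div_cancel₀ (a := c) (b := a) hc0, h, div_div_cancel₀ hc0]
    · intro b _ hb
      refine ⟨c / b, Finset.mem_univ _, ?_, by rw [div_div_cancel₀ hc0]⟩
      exact hb
    · intro a _ _
      rw [div_div_cancel₀ hc0]
  have key2 : ∑ u : K, quadraticChar K (c / u) * g (c / u + c / (c / u)) =
      - ∑ u : K, quadraticChar K u * g (u + c / u) := by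
    rw [← Finset.sum_neg_distrib]
    refine Finset.sum_congr rfl fun u _ => ?_
    rw [div_div_cancel₀ hc0, div_eq_mul_inv, map_mul, quadraticChar_inv,
      quadraticChar_neg_one_iff_not_isSquare.2 hc, add_comm u]
    ring_nf
  omega

/-- The roots u satisfy u(w + 2y) = (u + y)², so χ(u) = χ(w + 2y) at each of them unless w = -2y.
The discriminant w² - 4y² gives 1 + χ(w + 2y)χ(w - 2y) roots, and multiplying out yields the two
characters. For w = -2y the only root is -y, and w - 2y is then 4 times -y. -/
theorem sum_quadraticChar_fiber_add_div (h2 : (2 : K) ≠ 0) {y : K} (hy : y ≠ 0) (w : K) :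
    ∑ u : K with u + y ^ 2 / u = w, quadraticChar K u =
      quadraticChar K (w + 2 * y) + quadraticChar K (w - 2 * y) := by
  have h4 : (4 : K) ≠ 0 := by
    have : (4 : K) = 2 * 2 := by norm_num
    rw [this]; exact mul_ne_zero h2 h2
  have heq : ∀ u : K, u ≠ 0 → (u + y ^ 2 / u = w ↔ (2 * u - w) ^ 2 = w ^ 2 - 4 * y ^ 2) := by
    intro u hu
    rw [← sub_eq_zero, ← sub_eq_zero (b := w ^ 2 - 4 * y ^ 2)]
    have : (2 * u - w) ^ 2 - (w ^ 2 - 4 * y ^ 2) = 4 * u * (u + y ^ 2 / u - w) := by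
      field_simp; ring
    rw [this]
    simp [h4, hu]
  have hne : ∀ u : K, (2 * u - w) ^ 2 = w ^ 2 - 4 * y ^ 2 → u ≠ 0 := by
    rintro u h rfl
    have : 4 * y ^ 2 = 0 := by linear_combination h
    simp [h4, hy] at this
  have hsum : ∑ u : K with u + y ^ 2 / u = w, quadraticChar K u =
      ∑ u : K with (2 * u - w) ^ 2 = w ^ 2 - 4 * y ^ 2, quadraticChar K u := by
    simp_rw [Finset.sum_filter]
    refine Finset.sum_congr rfl fun u _ => ?_
    rcases eq_or_ne u 0 with rfl | hu
    · simp
    · simp only [heq u hu]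
  rw [hsum]
  rcases eq_or_ne (w + 2 * y) 0 with hv | hv
  · have hw : w = -(2 * y) := by linear_combination hv
    subst hw
    have : Finset.filter (fun u : K => (2 * u - -(2 * y)) ^ 2 = (-(2 * y)) ^ 2 - 4 * y ^ 2)
        Finset.univ = {-y} := by
      ext u
      simp only [Finset.mem_filter, Finset.mem_univ, true_and, Finset.mem_singleton]
      constructor
      · intro h
        have h' : (2 * (u + y)) ^ 2 = 0 := by linear_combination h
        have h'' : u + y = 0 := by simpa [h2] using h'
        linear_combination h''
      · rintro rfl; ring
    rw [this, Finset.sum_singleton]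
    have e1 : -(2 * y) + 2 * y = 0 := by ring
    have e2 : -(2 * y) - 2 * y = 2 ^ 2 * (-y) := by ring
    rw [e1, e2, map_mul, quadraticChar_sq_one' h2]
    simp
  · have hchi : ∀ u : K, (2 * u - w) ^ 2 = w ^ 2 - 4 * y ^ 2 →
        quadraticChar K u = quadraticChar K (w + 2 * y) := by
      intro u hu
      have h0 := hne u hu
      have h' := (heq u h0).2 hu
      have h1 : u * (w + 2 * y) = (u + y) ^ 2 := by rw [← h']; field_simp; ring
      have huy : u + y ≠ 0 := by
        intro h; rw [h] at h1; simp [h0, hv] at h1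
      have h3 : quadraticChar K u * quadraticChar K (w + 2 * y) = 1 := by
        rw [← map_mul, h1, quadraticChar_sq_one' huy]
      rcases quadraticChar_dichotomy hv with h | h <;> rw [h] at h3 ⊢ <;> omega
    rw [Finset.sum_congr rfl (g := fun _ => quadraticChar K (w + 2 * y))
      (fun u hu => hchi u (Finset.mem_filter.1 hu).2), Finset.sum_const, nsmul_eq_mul]
    have hcard : (Finset.card {u : K | (2 * u - w) ^ 2 = w ^ 2 - 4 * y ^ 2} : ℤ) =
        quadraticChar K (w ^ 2 - 4 * y ^ 2) + 1 := by
      rw [← quadraticChar_card_sqrts (ringChar_ne_two_of_two_ne_zero h2)]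
      congr 1
      refine Finset.card_bij (fun u _ => 2 * u - w) (by simp) ?_ ?_
      · intro a _ b _ h
        have : 2 * a = 2 * b := by linear_combination h
        exact mul_left_cancel₀ h2 this
      · intro b hb
        have hb : b ^ 2 = w ^ 2 - 4 * y ^ 2 := by simpa using hb
        have e : 2 * ((b + w) / 2) - w = b := by field_simp; ring
        refine ⟨(b + w) / 2, ?_, e⟩
        simp only [Finset.mem_filter, Finset.mem_univ, true_and]
        rw [e, hb]
    have hf : w ^ 2 - 4 * y ^ 2 = (w + 2 * y) * (w - 2 * y) := by ring
    rw [hcard, hf, map_mul]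
    have := quadraticChar_mul_self hv
    linear_combination quadraticChar K (w - 2 * y) * this

theorem sum_quadraticChar_add_div_sq (h2 : (2 : K) ≠ 0) {y : K} (hy : y ≠ 0) (g : K → ℤ) :
    ∑ u : K, quadraticChar K u * g (u + y ^ 2 / u) =
      ∑ w : K, (quadraticChar K (w + 2 * y) + quadraticChar K (w - 2 * y)) * g w := by
  rw [← Finset.sum_fiberwise Finset.univ (fun u : K => u + y ^ 2 / u)]
  refine Finset.sum_congr rfl fun w _ => ?_
  rw [← sum_quadraticChar_fiber_add_div h2 hy, Finset.sum_mul]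
  refine Finset.sum_congr rfl fun x hx => ?_
  rw [(Finset.mem_filter.1 hx).2]

end QuadraticCharSums

/-- If `Q (w + λ p) = Q w + λ ℓ w` and `ℓ (w + λ p) = ℓ w`, then on `ℓ ≠ 0` all values of `Q`
are equally frequent. -/
theorem sum_of_affine_on_lines {F V : Type*} [Field F] [Fintype F] [DecidableEq F]
    [AddCommGroup V] [Module F V] [Fintype V] (Q ℓ : V → F) (p : V)
    (hQ : ∀ w (k : F), Q (w + k • p) = Q w + k * ℓ w)
    (hl : ∀ w (k : F), ℓ (w + k • p) = ℓ w) (g : F → ℤ) :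
    (Fintype.card F : ℤ) * ∑ w : V with ℓ w ≠ 0, g (Q w) =
      (Finset.card {w : V | ℓ w ≠ 0}) * ∑ t : F, g t := by
  -- Translating by k p leaves the sum unchanged, so it may be averaged over k. Along each line Q
  -- then runs once through F, since its slope ℓ w is nonzero.
  have h1 : ∀ k : F, ∑ w : V with ℓ w ≠ 0, g (Q w) = ∑ w : V with ℓ w ≠ 0, g (Q w + k * ℓ w) := by
    intro k
    simp_rw [Finset.sum_filter]
    rw [← Equiv.sum_comp (Equiv.addRight (k • p))]
    simp [hQ, hl]
  calc _ = ∑ k : F, ∑ w : V with ℓ w ≠ 0, g (Q w + k * ℓ w) := by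
        rw [← Finset.sum_congr rfl (fun k _ => h1 k)]; simp
    _ = ∑ w : V with ℓ w ≠ 0, ∑ k : F, g (Q w + k * ℓ w) := Finset.sum_comm
    _ = ∑ w : V with ℓ w ≠ 0, ∑ t : F, g t := by
        refine Finset.sum_congr rfl fun w hw => ?_
        have hw := (Finset.mem_filter.1 hw).2
        exact Fintype.sum_bijective (fun k => Q w + k * ℓ w)
          ((Equiv.addLeft (Q w)).bijective.comp (mulRight_bijective₀ _ hw)) _ _ (fun _ => rfl)
    _ = _ := by simp

/-- The fibres of a nonzero linear functional have equal size. -/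
theorem card_fiber_linear {F V : Type*} [Field F] [Fintype F] [DecidableEq F]
    [AddCommGroup V] [Module F V] [Fintype V] (ℓ : V →ₗ[F] F) (hl : ℓ ≠ 0) (t : F) :
    Fintype.card F * Finset.card {w : V | ℓ w = t} = Fintype.card V := by
  have hs : Function.Surjective ℓ := LinearMap.surjective hl
  have h1 : ∀ a : F, Finset.card {w : V | ℓ w = a} = Finset.card {w : V | ℓ w = t} := fun a =>
    AddMonoidHom.card_fiber_eq_of_mem_range ℓ (hs a) (hs t)
  have h := Finset.card_eq_sum_card_fiberwise (f := ℓ) (s := (Finset.univ : Finset V))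
    (t := Finset.univ) (fun _ _ => Finset.mem_coe.2 (Finset.mem_univ _))
  rw [Finset.sum_congr rfl fun a _ => h1 a] at h
  simpa using h.symm

theorem card_linear_ne_zero {F V : Type*} [Field F] [Fintype F] [DecidableEq F]
    [AddCommGroup V] [Module F V] [Fintype V] (ℓ : V →ₗ[F] F) (hl : ℓ ≠ 0) :
    (Fintype.card F : ℤ) * Finset.card {w : V | ℓ w ≠ 0} =
      (Fintype.card F - 1) * Fintype.card V := by
  have h := card_fiber_linear ℓ hl 0
  have h' := Finset.card_filter_add_card_filter_not (s := (Finset.univ : Finset V))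
    (fun w => ℓ w = 0)
  rw [Finset.card_univ] at h'
  zify at h h'
  linear_combination (Fintype.card F : ℤ) * h' - h

end TightSets
end

noncomputable section

namespace TightSets

/-! ### Squares and traces in a cubic extension -/

section CubicExtension

variable {F E : Type*} [Field F] [Field E] [Algebra F E]

/-- Taking norms in k = x² gives k³ = N(x)², so k is the square of N(x)/k. Oddness of the degree is
what matters. -/
theorem isSquare_of_isSquare_algebraMap (hE : Module.finrank F E = 3) {k : F}
    (h : IsSquare (algebraMap F E k)) : IsSquare k := by
  have := Module.finite_of_finrank_pos (R := F) (M := E) (by omega)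
  obtain ⟨x, hx⟩ := h
  rcases eq_or_ne k 0 with rfl | hk
  · exact IsSquare.zero
  have h1 := congrArg (Algebra.norm F) hx
  rw [Algebra.norm_algebraMap, hE, map_mul] at h1
  refine ⟨Algebra.norm F x / k, ?_⟩
  field_simp
  linear_combination h1

theorem two_ne_zero_of_algebra (E : Type*) [Field E] [Algebra F E] (h2 : (2 : F) ≠ 0) :
    (2 : E) ≠ 0 := by
  rw [← map_ofNat (algebraMap F E) 2]
  simpa using h2

theorem quadraticChar_algebraMap [Fintype F] [DecidableEq F] [Fintype E] [DecidableEq E]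
    (hE : Module.finrank F E = 3) (k : F) :
    quadraticChar E (algebraMap F E k) = quadraticChar F k := by
  rcases eq_or_ne k 0 with rfl | hk
  · simp
  have hk' : algebraMap F E k ≠ 0 := by simpa using hk
  by_cases h : IsSquare k
  · rw [quadraticChar_of_isSquare hk h, quadraticChar_of_isSquare hk' (h.map _)]
  · rw [quadraticChar_neg_one_iff_not_isSquare.2 h, quadraticChar_neg_one_iff_not_isSquare.2]
    exact fun h' => h (isSquare_of_isSquare_algebraMap hE h')

theorem algebraMap_trace_cubic [Finite E] (hE : Module.finrank F E = 3) (x : E) :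
    algebraMap F E (Algebra.trace F E x) =
      x + x ^ Nat.card F + x ^ (Nat.card F ^ 2) := by
  rw [FiniteField.algebraMap_trace_eq_sum_pow, hE]
  simp [Finset.sum_range_succ]

/-- The Gram determinant of three vectors for the trace form is a square. -/
theorem isSquare_gram_trace [Finite E] (hE : Module.finrank F E = 3) (x y z : E) :
    IsSquare (Algebra.trace F E (x * x) * (Algebra.trace F E (y * y) * Algebra.trace F E (z * z)
        - Algebra.trace F E (y * z) * Algebra.trace F E (y * z))
      - Algebra.trace F E (x * y) * (Algebra.trace F E (x * y) * Algebra.trace F E (z * z)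
        - Algebra.trace F E (y * z) * Algebra.trace F E (x * z))
      + Algebra.trace F E (x * z) * (Algebra.trace F E (x * y) * Algebra.trace F E (y * z)
        - Algebra.trace F E (y * y) * Algebra.trace F E (x * z))) := by
  apply isSquare_of_isSquare_algebraMap hE
  simp only [map_add, map_sub, map_mul, algebraMap_trace_cubic hE, mul_pow]
  generalize x ^ Nat.card F = x1
  generalize y ^ Nat.card F = y1
  generalize z ^ Nat.card F = z1
  generalize x ^ (Nat.card F) ^ 2 = x2
  generalize y ^ (Nat.card F) ^ 2 = y2
  generalize z ^ (Nat.card F) ^ 2 = z2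
  -- The Gram matrix is M Mᵀ, with the conjugates of x, y, z as the rows of M, and the witness is
  -- det M. Only membership of det M in E is needed, because squares of E lying in F are squares in
  -- F.
  exact ⟨x * (y1 * z2 - y2 * z1) - x1 * (y * z2 - y2 * z) + x2 * (y * z1 - y1 * z), by ring⟩

theorem trace_algebraMap_mul (k : F) (x : E) :
    Algebra.trace F E (algebraMap F E k * x) = k * Algebra.trace F E x := by
  rw [← Algebra.smul_def, map_smul, smul_eq_mul]

end CubicExtension

/-! ### Counting with the ternary form T(x²) -/

section FiniteCubicExtension

variable {F E : Type*} [Field F] [Fintype F] [DecidableEq F] [Field E] [Fintype E] [DecidableEq E]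
  [Algebra F E]

theorem card_cubic (hE : Module.finrank F E = 3) : Fintype.card E = Fintype.card F ^ 3 := by
  rw [← hE]; exact Module.card_eq_pow_finrank

theorem finiteDimensional_of_fintype : FiniteDimensional F E := Module.Finite.of_finite

/-- The functional `x ↦ T(x a)`. -/
def traceMulRight (F : Type*) {E : Type*} [Field F] [Field E] [Algebra F E] (a : E) : E →ₗ[F] F :=
  Algebra.trace F E ∘ₗ LinearMap.mulRight F a

@[simp] theorem traceMulRight_apply (a x : E) :
    traceMulRight F a x = Algebra.trace F E (x * a) := rfl

theorem traceMulRight_ne_zero {a : E} (ha : a ≠ 0) : traceMulRight F a ≠ 0 := by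
  have := finiteDimensional_of_fintype (F := F) (E := E)
  obtain ⟨x, hx⟩ := Algebra.trace_surjective F E 1
  intro h
  have := LinearMap.congr_fun h (x / a)
  rw [traceMulRight_apply, div_mul_cancel₀ _ ha, hx] at this
  simp at this

theorem card_trace_mul_eq (hE : Module.finrank F E = 3) {a : E} (ha : a ≠ 0) (t : F) :
    Finset.card {x : E | Algebra.trace F E (x * a) = t} = Fintype.card F ^ 2 := by
  have h : Fintype.card F * Finset.card {x : E | Algebra.trace F E (x * a) = t} = Fintype.card E :=
    card_fiber_linear (traceMulRight F a) (traceMulRight_ne_zero ha) t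
  rw [card_cubic hE] at h
  have hq : 0 < Fintype.card F := Fintype.card_pos
  apply Nat.eq_of_mul_eq_mul_left hq
  rw [h]; ring

theorem card_trace_mul_ne_zero (hE : Module.finrank F E = 3) {a : E} (ha : a ≠ 0) :
    (Finset.card {x : E | Algebra.trace F E (x * a) ≠ 0} : ℤ) =
      Fintype.card F ^ 3 - Fintype.card F ^ 2 := by
  have h : (Fintype.card F : ℤ) * Finset.card {x : E | Algebra.trace F E (x * a) ≠ 0} =
      (Fintype.card F - 1) * Fintype.card E :=
    card_linear_ne_zero (traceMulRight F a) (traceMulRight_ne_zero ha)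
  rw [card_cubic hE] at h
  have hq : (Fintype.card F : ℤ) ≠ 0 := by exact_mod_cast Fintype.card_ne_zero
  apply mul_left_cancel₀ hq
  rw [h]; push_cast; ring

/-- `∑ χ(w)` over the `w` with `T(w) = t`. -/
def traceCharSum (F E : Type*) [Field F] [DecidableEq F] [Field E] [Fintype E] [DecidableEq E]
    [Algebra F E] (t : F) : ℤ :=
  ∑ w : E with Algebra.trace F E w = t, quadraticChar E w

theorem traceCharSum_mul (hE : Module.finrank F E = 3) (k : F) (hk : k ≠ 0) (t : F) :
    traceCharSum F E (k * t) = quadraticChar F k * traceCharSum F E t := by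
  have hk' : algebraMap F E k ≠ 0 := by simpa using hk
  simp only [traceCharSum, Finset.sum_filter]
  rw [← Equiv.sum_comp (Equiv.mulLeft₀ _ hk'), Finset.mul_sum]
  refine Finset.sum_congr rfl fun w _ => ?_
  simp only [Equiv.mulLeft₀_apply, trace_algebraMap_mul, map_mul, quadraticChar_algebraMap hE]
  simp [hk]

/-- Scaling w by k in F multiplies χ(w) by χ(k). At t = 0 a nonsquare k makes the sum equal to its
negative. -/
theorem traceCharSum_eq (hE : Module.finrank F E = 3) (h2 : (2 : F) ≠ 0) (t : F) :
    traceCharSum F E t = quadraticChar F t * traceCharSum F E 1 := by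
  rcases eq_or_ne t 0 with rfl | ht
  · obtain ⟨k, hk⟩ := quadraticChar_exists_neg_one (ringChar_ne_two_of_two_ne_zero h2)
    have hk0 : k ≠ 0 := by rintro rfl; simp at hk
    have := traceCharSum_mul (E := E) hE k hk0 0
    rw [mul_zero, hk] at this
    simp; omega
  · rw [← traceCharSum_mul hE t ht, mul_one]

/-- Summing a function of `T(x²)`. -/
theorem sum_trace_sq (hE : Module.finrank F E = 3) (h2 : (2 : F) ≠ 0) (g : F → ℤ) :
    ∑ x : E, g (Algebra.trace F E (x ^ 2)) =
      Fintype.card F ^ 2 * ∑ t : F, g t + traceCharSum F E 1 * ∑ t : F, quadraticChar F t * g t := by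
  -- Squaring reaches w with multiplicity 1 + χ(w). On the fibre T(w) = t the multiplicities add up
  -- to q² plus `traceCharSum F E t`.
  rw [sum_comp_sq (two_ne_zero_of_algebra E h2) (fun w => g (Algebra.trace F E w)),
    ← Finset.sum_fiberwise Finset.univ (fun x : E => Algebra.trace F E x), Finset.mul_sum,
    Finset.mul_sum, ← Finset.sum_add_distrib]
  refine Finset.sum_congr rfl fun t _ => ?_
  rw [Finset.sum_congr rfl (g := fun w => (1 + quadraticChar E w) * g t) (fun w hw => by
    rw [(Finset.mem_filter.1 hw).2]), ← Finset.sum_mul, Finset.sum_add_distrib]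
  have h1 := card_trace_mul_eq (F := F) (E := E) hE one_ne_zero t
  simp only [mul_one] at h1
  have h3 := traceCharSum_eq (E := E) hE h2 t
  rw [traceCharSum] at h3
  rw [h3]
  simp only [Finset.sum_const, h1]
  simp only [nsmul_eq_mul]; push_cast; ring

/-- Taking g to be the indicator of 0 makes the term with the yet unknown constant `traceCharSum F E
1` disappear, because χ(0) = 0. -/
theorem card_trace_sq_eq_zero (hE : Module.finrank F E = 3) (h2 : (2 : F) ≠ 0) :
    Finset.card {x : E | Algebra.trace F E (x ^ 2) = 0} = Fintype.card F ^ 2 := by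
  have h := sum_trace_sq (E := E) hE h2 (fun t => if t = 0 then 1 else 0)
  rw [Finset.sum_boole] at h
  simp at h
  exact_mod_cast h

theorem trace_sq_add_smul {s : E} (hs : Algebra.trace F E (s ^ 2) = 0) (x : E) (k : F) :
    Algebra.trace F E ((x + k • s) ^ 2) =
      Algebra.trace F E (x ^ 2) + k * (2 * Algebra.trace F E (x * s)) := by
  have : (x + k • s) ^ 2 = x ^ 2 + (2 * k) • (x * s) + (k * k) • s ^ 2 := by
    simp only [Algebra.smul_def, map_mul, map_ofNat]; ring
  rw [this, map_add, map_add, map_smul, map_smul, hs]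
  simp only [smul_eq_mul]; ring

/-- Since s is isotropic, T(x²) is affine along x + ks with slope 2T(xs), so off the hyperplane
orthogonal to s all values are equally frequent. -/
theorem sum_trace_sq_of_trace_mul_ne_zero (hE : Module.finrank F E = 3) (h2 : (2 : F) ≠ 0) {s : E}
    (hs0 : s ≠ 0) (hs : Algebra.trace F E (s ^ 2) = 0) (g : F → ℤ) :
    ∑ x : E with Algebra.trace F E (x * s) ≠ 0, g (Algebra.trace F E (x ^ 2)) =
      (Fintype.card F ^ 2 - Fintype.card F) * ∑ t : F, g t := by
  have hQ : ∀ (w : E) (k : F), Algebra.trace F E ((w + k • s) ^ 2) =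
      Algebra.trace F E (w ^ 2) + k * (2 * Algebra.trace F E (w * s)) := fun w k =>
    trace_sq_add_smul hs w k
  have hl : ∀ (w : E) (k : F), 2 * Algebra.trace F E ((w + k • s) * s) =
      2 * Algebra.trace F E (w * s) := by
    intro w k
    rw [add_mul, smul_mul_assoc, map_add, map_smul, ← pow_two, hs, smul_zero, add_zero]
  have h := @sum_of_affine_on_lines F E _ _ _ _ _ _ (fun x : E => Algebra.trace F E (x ^ 2))
    (fun x : E => 2 * Algebra.trace F E (x * s)) s ?_ ?_ g
  rotate_left
  · exact hQ
  · exact hl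
  have e : ∀ x : E, 2 * Algebra.trace F E (x * s) ≠ 0 ↔ Algebra.trace F E (x * s) ≠ 0 := by
    intro x; simp [h2]
  simp only [e] at h
  have hq : (Fintype.card F : ℤ) ≠ 0 := by exact_mod_cast Fintype.card_ne_zero
  rw [card_trace_mul_ne_zero (F := F) hE hs0] at h
  apply mul_left_cancel₀ hq
  rw [h]; ring

theorem card_isotropic_trace_mul_ne_zero (hE : Module.finrank F E = 3) (h2 : (2 : F) ≠ 0) {s : E}
    (hs0 : s ≠ 0) (hs : Algebra.trace F E (s ^ 2) = 0) :
    (Finset.card {x : E | Algebra.trace F E (x ^ 2) = 0 ∧ Algebra.trace F E (x * s) ≠ 0} : ℤ) =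
      Fintype.card F ^ 2 - Fintype.card F := by
  have h := sum_trace_sq_of_trace_mul_ne_zero hE h2 hs0 hs (fun t => if t = 0 then 1 else 0)
  rw [Finset.sum_boole, Finset.filter_filter] at h
  simp only [Finset.sum_ite_eq', Finset.mem_univ, if_true, mul_one] at h
  rw [← h]
  simp only [and_comm]

/-- There are q² isotropic vectors, of which q² - q are not orthogonal to s. The q that remain must
be the multiples of s. -/
theorem exists_smul_of_isotropic_of_trace_mul_eq_zero (hE : Module.finrank F E = 3)
    (h2 : (2 : F) ≠ 0) {s : E} (hs0 : s ≠ 0) (hs : Algebra.trace F E (s ^ 2) = 0) {x : E}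
    (hx : Algebra.trace F E (x ^ 2) = 0) (hxs : Algebra.trace F E (x * s) = 0) :
    ∃ k : F, x = k • s := by
  have h1 := card_isotropic_trace_mul_ne_zero hE h2 hs0 hs
  have h3 := card_trace_sq_eq_zero (F := F) (E := E) hE h2
  have h4 := Finset.card_filter_add_card_filter_not
    (s := ({x : E | Algebra.trace F E (x ^ 2) = 0} : Finset E))
    (fun x => Algebra.trace F E (x * s) = 0)
  rw [Finset.filter_filter, Finset.filter_filter] at h4
  have h5 : Finset.card {x : E | Algebra.trace F E (x ^ 2) = 0 ∧ Algebra.trace F E (x * s) = 0} =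
      Fintype.card F := by
    rw [h3] at h4
    zify at h4 ⊢
    simp only [ne_eq] at h1
    linear_combination h4 - h1
  have h6 : (Finset.univ.image fun k : F => k • s) =
      ({x : E | Algebra.trace F E (x ^ 2) = 0 ∧ Algebra.trace F E (x * s) = 0} : Finset E) := by
    apply Finset.eq_of_subset_of_card_le
    · intro y hy
      obtain ⟨k, -, rfl⟩ := Finset.mem_image.1 hy
      simp only [Finset.mem_filter, Finset.mem_univ, true_and]
      constructor
      · rw [smul_pow, map_smul, hs, smul_zero]
      · rw [smul_mul_assoc, ← pow_two, map_smul, hs, smul_zero]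
    · rw [h5, Finset.card_image_of_injective _ (smul_left_injective F hs0), Finset.card_univ]
  have h7 : x ∈ (Finset.univ.image fun k : F => k • s) := by
    rw [h6]; simp [hx, hxs]
  obtain ⟨k, -, hk⟩ := Finset.mem_image.1 h7
  exact ⟨k, hk.symm⟩

theorem exists_isotropic (hE : Module.finrank F E = 3) (h2 : (2 : F) ≠ 0) :
    ∃ s : E, s ≠ 0 ∧ Algebra.trace F E (s ^ 2) = 0 := by
  have h3 := card_trace_sq_eq_zero (F := F) (E := E) hE h2
  have : 1 < Finset.card {x : E | Algebra.trace F E (x ^ 2) = 0} := by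
    rw [h3]; exact Nat.one_lt_pow (by norm_num) Fintype.one_lt_card
  obtain ⟨s, hs, hs0⟩ := Finset.exists_mem_ne this 0
  exact ⟨s, hs0, by simpa using hs⟩

/-- Evaluate ∑ χ(T(x²)) in two ways. Squaring gives q - 1 times the constant. Splitting at the
hyperplane orthogonal to an isotropic s, the outside contributes 0 by equidistribution, while inside
every nonzero T(x²) is a square, so the sum counts the q² - q anisotropic vectors there. -/
theorem traceCharSum_one (hE : Module.finrank F E = 3) (h2 : (2 : F) ≠ 0)
    (hsq : IsSquare (-1 : F)) : traceCharSum F E 1 = Fintype.card F := by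
  obtain ⟨s, hs0, hs⟩ := exists_isotropic (F := F) (E := E) hE h2
  have hz := quadraticChar_sum_zero (F := F) (ringChar_ne_two_of_two_ne_zero h2)
  have h1 := sum_trace_sq (E := E) hE h2 (quadraticChar F)
  have h3 := sum_trace_sq_of_trace_mul_ne_zero hE h2 hs0 hs (quadraticChar F)
  rw [hz, mul_zero] at h1 h3
  have hsqsum : ∑ t : F, quadraticChar F t * quadraticChar F t = Fintype.card F - 1 := by
    have : ∀ t : F, quadraticChar F t * quadraticChar F t = 1 - if t = 0 then 1 else 0 := by
      intro t
      split_ifs with h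
      · simp [h]
      · rw [quadraticChar_mul_self h]; simp
    rw [Finset.sum_congr rfl fun t _ => this t]
    simp
  rw [hsqsum] at h1
  have hm : ∃ z : E, Algebra.trace F E (z * s) ≠ 0 := by
    by_contra! h
    exact traceMulRight_ne_zero (F := F) hs0 (LinearMap.ext fun z => by simpa using h z)
  obtain ⟨z, hz⟩ := hm
  have hchi : ∀ x : E, Algebra.trace F E (x * s) = 0 →
      quadraticChar F (Algebra.trace F E (x ^ 2)) =
        if Algebra.trace F E (x ^ 2) = 0 then 0 else 1 := by
    intro x hx
    split_ifs with h0
    · simp [h0]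
    · apply quadraticChar_of_isSquare h0
      -- With T(s²) = T(xs) = 0 the Gram determinant collapses to -T(x²)T(zs)², and -1 is a square.
      have hg := isSquare_gram_trace hE x s z
      rw [← pow_two s, hs, hx, mul_comm s z, ← pow_two x] at hg
      have : Algebra.trace F E (x ^ 2) =
          (Algebra.trace F E (x ^ 2) * (0 * Algebra.trace F E (z * z) -
            Algebra.trace F E (z * s) * Algebra.trace F E (z * s))
          - 0 * (0 * Algebra.trace F E (z * z) - Algebra.trace F E (z * s) *
              Algebra.trace F E (x * z)) +
            Algebra.trace F E (x * z) * (0 * Algebra.trace F E (z * s) -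
              0 * Algebra.trace F E (x * z))) * (-1 / (Algebra.trace F E (z * s)) ^ 2) := by
        field_simp; ring
      rw [this]
      exact hg.mul (hsq.div (IsSquare.sq _))
  have h4 : ∑ x : E with Algebra.trace F E (x * s) = 0,
      quadraticChar F (Algebra.trace F E (x ^ 2)) = Fintype.card F ^ 2 - Fintype.card F := by
    rw [Finset.sum_congr rfl (fun x hx => hchi x (Finset.mem_filter.1 hx).2)]
    have e1 : ∀ x : E, (if Algebra.trace F E (x ^ 2) = 0 then (0 : ℤ) else 1) =
        1 - if Algebra.trace F E (x ^ 2) = 0 then (1 : ℤ) else 0 := by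
      intro x; split_ifs <;> simp
    simp only [e1, Finset.sum_sub_distrib, Finset.sum_const, Finset.sum_boole,
      card_trace_mul_eq (F := F) hE hs0, Finset.filter_filter]
    have h5 := card_isotropic_trace_mul_ne_zero hE h2 hs0 hs
    have h6 := card_trace_sq_eq_zero (F := F) (E := E) hE h2
    have h7 := Finset.card_filter_add_card_filter_not
      (s := ({x : E | Algebra.trace F E (x ^ 2) = 0} : Finset E))
      (fun x => Algebra.trace F E (x * s) = 0)
    rw [Finset.filter_filter, Finset.filter_filter, h6] at h7
    simp only [and_comm (b := Algebra.trace F E (_ ^ 2) = 0)]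
    simp only [nsmul_eq_mul, mul_one]
    zify at h7
    simp only [ne_eq] at h5
    push_cast
    linear_combination h5 - h7
  have h8 := Finset.sum_filter_add_sum_filter_not (s := (Finset.univ : Finset E))
    (fun x => Algebra.trace F E (x * s) = 0)
    (fun x => quadraticChar F (Algebra.trace F E (x ^ 2)))
  rw [h4, h1] at h8
  simp only [ne_eq] at h3
  rw [h3] at h8
  have hq : (Fintype.card F : ℤ) - 1 ≠ 0 := by
    have : 1 < Fintype.card F := Fintype.one_lt_card
    omega
  apply mul_right_cancel₀ hq
  linear_combination -h8

end FiniteCubicExtension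

end TightSets
end

noncomputable section

namespace TightSets

/-! ### Construction of the signs η and θ -/

section EigenFunction

variable {F E : Type*} [Field F] [Fintype F] [DecidableEq F] [Field E] [Fintype E] [DecidableEq E]
  [Algebra F E]

/-- A `±1`-valued function on `Fˣ`, twisted by the quadratic character along squares. -/
structure IsQuarticSign (η : F → ℤ) : Prop where
  zero : η 0 = 0
  sq : ∀ c, c ≠ 0 → η c * η c = 1
  mul_sq : ∀ c y, η (c * y ^ 2) = η c * quadraticChar F y

/-- A `±1`-valued function on the nonzero isotropic vectors of `T(x²)`, compatible with the
quadratic character of the bilinear form. -/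
structure IsConicSign (F : Type*) {E : Type*} [Field F] [Fintype F] [DecidableEq F] [Field E]
    [Algebra F E] (θ : E → ℤ) : Prop where
  zero : θ 0 = 0
  anisotropic : ∀ s, Algebra.trace F E (s ^ 2) ≠ 0 → θ s = 0
  sq : ∀ s, s ≠ 0 → Algebra.trace F E (s ^ 2) = 0 → θ s * θ s = 1
  smul : ∀ (k : F) s, θ (k • s) = quadraticChar F k * θ s
  mul : ∀ s t, θ s ≠ 0 → θ t ≠ 0 → Algebra.trace F E (s * t) ≠ 0 →
    quadraticChar F (2 * Algebra.trace F E (s * t)) = θ s * θ t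

theorem quadraticChar_neg (hsq : IsSquare (-1 : F)) (x : F) :
    quadraticChar F (-x) = quadraticChar F x := by
  rw [← neg_one_mul, map_mul, quadraticChar_of_isSquare (by simp) hsq, one_mul]

/-- With n a fixed nonsquare, each c is y² or n y², and η(c) = χ(y). The root y is determined up to
sign, which χ does not see because χ(-1) = 1. -/
theorem exists_isQuarticSign (h2 : (2 : F) ≠ 0) (hsq : IsSquare (-1 : F)) :
    ∃ η : F → ℤ, IsQuarticSign η := by
  classical
  obtain ⟨n, hn⟩ := quadraticChar_exists_neg_one (ringChar_ne_two_of_two_ne_zero h2)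
  have hn0 : n ≠ 0 := by rintro rfl; simp at hn
  have hns := quadraticChar_neg_one_iff_not_isSquare.1 hn
  have hroot : ∀ x y : F, x ^ 2 = y ^ 2 → quadraticChar F x = quadraticChar F y := by
    intro x y h
    rcases sq_eq_sq_iff_eq_or_eq_neg.1 h with rfl | rfl
    · rfl
    · exact quadraticChar_neg hsq y
  have hex : ∀ c : F, ∃ y : F, c = y ^ 2 ∨ c = n * y ^ 2 := by
    intro c
    by_cases hc : IsSquare c
    · obtain ⟨y, hy⟩ := hc; exact ⟨y, Or.inl (by rw [hy, pow_two])⟩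
    · have : IsSquare (c / n) := by
        by_contra h
        have h1 := quadraticChar_neg_one_iff_not_isSquare.2 h
        rw [div_eq_mul_inv, map_mul, quadraticChar_inv, hn,
          quadraticChar_neg_one_iff_not_isSquare.2 hc] at h1
        norm_num at h1
      obtain ⟨y, hy⟩ := this
      exact ⟨y, Or.inr (by rw [pow_two, ← hy, mul_div_cancel₀ _ hn0])⟩
  choose r hr using hex
  have hval : ∀ c y, c = y ^ 2 ∨ c = n * y ^ 2 → quadraticChar F (r c) = quadraticChar F y := by
    intro c y h
    have hmix : ∀ a b : F, a ^ 2 = n * b ^ 2 → a = 0 ∧ b = 0 := by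
      intro a b h
      have hb : b = 0 := by
        by_contra hb
        exact hns ⟨a / b, by field_simp; exact h.symm⟩
      subst hb
      exact ⟨by simpa using h, rfl⟩
    rcases h with h | h <;> rcases hr c with h' | h'
    · exact hroot _ _ (h'.symm.trans h)
    · obtain ⟨h1, h3⟩ := hmix _ _ (h.symm.trans h'); rw [h1, h3]
    · obtain ⟨h1, h3⟩ := hmix _ _ (h'.symm.trans h); rw [h1, h3]
    · exact hroot _ _ (mul_left_cancel₀ hn0 (h'.symm.trans h))
  refine ⟨fun c => quadraticChar F (r c), ?_, ?_, ?_⟩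
  · rw [hval 0 0 (by simp)]; simp
  · intro c hc
    apply quadraticChar_mul_self
    intro h0
    have := hr c
    rw [h0] at this
    simp at this
    exact hc this
  · intro c y
    rw [← map_mul]
    apply hval
    rcases hr c with h | h
    · left; rw [mul_pow, ← h]
    · right; rw [mul_pow, ← mul_assoc, ← h]

/-- Fix an isotropic s₀ and let θ(s) = χ(T(s s₀)). For isotropic s₀, s, t the Gram determinant is
2T(s s₀)T(t s₀)T(st), and its being a square is the required multiplicativity. -/
theorem exists_isConicSign (hE : Module.finrank F E = 3) (h2 : (2 : F) ≠ 0) :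
    ∃ θ : E → ℤ, IsConicSign F θ := by
  classical
  obtain ⟨s0, hs00, hs0⟩ := exists_isotropic (F := F) (E := E) hE h2
  have hpar := fun x : E => exists_smul_of_isotropic_of_trace_mul_eq_zero (x := x) hE h2 hs00 hs0
  -- a functional equal to one on `s0` reads off the coefficient of multiples of `s0`
  obtain ⟨ℓ, hℓ⟩ := Module.Projective.exists_dual_eq_one F hs00
  have hℓs : ∀ x : E, Algebra.trace F E (x ^ 2) = 0 → Algebra.trace F E (x * s0) = 0 →
      x = ℓ x • s0 := by
    intro x h1 h3
    obtain ⟨k, rfl⟩ := hpar x h1 h3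
    simp [hℓ]
  -- On multiples of s₀ the pairing with s₀ vanishes. The value 2k at k s₀ is the one forced by
  -- χ(2T(st)) = θ(s)θ(t) for t not orthogonal to s₀.
  let d : E → F := fun s => if Algebra.trace F E (s ^ 2) ≠ 0 then 0 else
    if Algebra.trace F E (s * s0) ≠ 0 then Algebra.trace F E (s * s0) else 2 * ℓ s
  have hd1 : ∀ s, Algebra.trace F E (s ^ 2) ≠ 0 → d s = 0 := fun s h => by simp [d, h]
  have hd2 : ∀ s, Algebra.trace F E (s ^ 2) = 0 → Algebra.trace F E (s * s0) ≠ 0 →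
      d s = Algebra.trace F E (s * s0) := fun s h h' => by simp [d, h, h']
  have hd3 : ∀ s, Algebra.trace F E (s ^ 2) = 0 → Algebra.trace F E (s * s0) = 0 →
      d s = 2 * ℓ s := fun s h h' => by simp [d, h, h']
  refine ⟨fun s => quadraticChar F (d s), ?_, ?_, ?_, ?_, ?_⟩
  · rw [hd3 0 (by simp) (by simp)]; simp
  · intro s hs; rw [hd1 s hs]; simp
  · intro s hs hs1
    apply quadraticChar_mul_self
    by_cases h : Algebra.trace F E (s * s0) = 0
    · rw [hd3 s hs1 h]
      refine mul_ne_zero h2 fun h0 => hs ?_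
      rw [hℓs s hs1 h, h0, zero_smul]
    · rwa [hd2 s hs1 h]
  · intro k s
    rw [← map_mul]
    congr 1
    rcases eq_or_ne k 0 with rfl | hk
    · rw [zero_smul, zero_mul, hd3 0 (by simp) (by simp)]; simp
    · have e1 : Algebra.trace F E ((k • s) ^ 2) = k ^ 2 * Algebra.trace F E (s ^ 2) := by
        rw [smul_pow, map_smul, smul_eq_mul]
      have e2 : Algebra.trace F E ((k • s) * s0) = k * Algebra.trace F E (s * s0) := by
        rw [smul_mul_assoc, map_smul, smul_eq_mul]
      by_cases h1 : Algebra.trace F E (s ^ 2) = 0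
      · by_cases h3 : Algebra.trace F E (s * s0) = 0
        · rw [hd3 _ (by rw [e1, h1, mul_zero]) (by rw [e2, h3, mul_zero]), hd3 s h1 h3, map_smul,
            smul_eq_mul]
          ring
        · rw [hd2 _ (by rw [e1, h1, mul_zero]) (by rw [e2]; exact mul_ne_zero hk h3), hd2 s h1 h3,
            e2]
      · rw [hd1 s h1, hd1 _ (by rw [e1]; exact mul_ne_zero (pow_ne_zero 2 hk) h1), mul_zero]
  · have hiso : ∀ s, quadraticChar F (d s) ≠ 0 → Algebra.trace F E (s ^ 2) = 0 := by
      intro s hs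
      by_contra h
      rw [hd1 s h] at hs
      simp at hs
    intro s t hs ht hst
    have hs1 := hiso s hs
    have ht1 := hiso t ht
    rw [← map_mul]
    have h4 : ∀ (k : F) x, Algebra.trace F E (x * k • s0) = k * Algebra.trace F E (x * s0) := by
      intro k x; rw [mul_smul_comm, map_smul, smul_eq_mul]
    by_cases h1 : Algebra.trace F E (s * s0) = 0 <;> by_cases h3 : Algebra.trace F E (t * s0) = 0
    · exfalso
      apply hst
      rw [hℓs t ht1 h3, h4, h1, mul_zero]
    · rw [hd3 s hs1 h1, hd2 t ht1 h3, mul_comm s t]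
      conv_lhs => rw [hℓs s hs1 h1]
      rw [h4]
      congr 1; ring
    · rw [hd2 s hs1 h1, hd3 t ht1 h3]
      conv_lhs => rw [hℓs t ht1 h3]
      rw [h4]
      congr 1; ring
    · rw [hd2 s hs1 h1, hd2 t ht1 h3]
      have hg := isSquare_gram_trace hE s0 s t
      simp only [← pow_two] at hg
      rw [hs0, hs1, ht1, mul_comm s0 s, mul_comm s0 t] at hg
      have hg' : IsSquare ((2 * Algebra.trace F E (s * t)) *
          (Algebra.trace F E (s * s0) * Algebra.trace F E (t * s0))) := by
        convert hg using 1; ring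
      have h5 := quadraticChar_of_isSquare
        (mul_ne_zero (mul_ne_zero h2 hst) (mul_ne_zero h1 h3)) hg'
      rw [map_mul] at h5
      rcases quadraticChar_dichotomy (mul_ne_zero h1 h3) with h | h <;> rw [h] at h5 ⊢ <;> omega

end EigenFunction
end TightSets
end

noncomputable section

namespace TightSets

/-! ### Salié sums and the eigenvalue equation -/

section EigenFunction

variable {F E : Type*} [Field F] [Fintype F] [DecidableEq F] [Field E] [Fintype E] [DecidableEq E]
  [Algebra F E]

/-- The sum of `χ(u a)` over the `u` with `T(a (u + c/u)) = 0`. -/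
def salieSum (a : E) (c : F) : ℤ :=
  ∑ u : E, quadraticChar E (u * a) *
    if Algebra.trace F E (a * (u + algebraMap F E c / u)) = 0 then 1 else 0

theorem salieSum_of_not_isSquare (hE : Module.finrank F E = 3) (a : E) {c : F}
    (hc : ¬ IsSquare c) : salieSum a c = 0 := by
  have hc' : ¬ IsSquare (algebraMap F E c) := fun h => hc (isSquare_of_isSquare_algebraMap hE h)
  have h := sum_quadraticChar_add_div_of_not_isSquare hc'
    (fun w => quadraticChar E a * if Algebra.trace F E (a * w) = 0 then 1 else 0)
  refine Eq.trans (Finset.sum_congr rfl fun u _ => ?_) h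
  rw [map_mul, mul_assoc]

/-- The fibre formula for u + y²/u, followed by w ↦ aw, leaves the sums of χ(w + 2ay) and χ(w - 2ay)
over T(w) = 0. These are character sums over the trace fibres at ±2yT(a). Each equals q χ(2yT(a)),
the sign being immaterial since χ(-1) = 1. -/
theorem salieSum_sq (hE : Module.finrank F E = 3) (h2 : (2 : F) ≠ 0)
    (hsq : IsSquare (-1 : F)) {a : E} (ha : a ≠ 0) {y : F} (hy : y ≠ 0) :
    salieSum a (y ^ 2) =
      2 * Fintype.card F * (quadraticChar F y * quadraticChar F (2 * Algebra.trace F E a)) := by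
  have hy' : algebraMap F E y ≠ 0 := by simpa using hy
  have h := sum_quadraticChar_add_div_sq (two_ne_zero_of_algebra E h2) hy'
    (fun w => quadraticChar E a * if Algebra.trace F E (a * w) = 0 then 1 else 0)
  have h1 : salieSum a (y ^ 2) = ∑ w : E, (quadraticChar E (w + a * (2 * algebraMap F E y)) +
      quadraticChar E (w - a * (2 * algebraMap F E y))) *
        if Algebra.trace F E w = 0 then 1 else 0 := by
    rw [← Equiv.sum_comp (Equiv.mulLeft₀ a ha)]
    refine Eq.trans (Finset.sum_congr rfl fun u _ => ?_) (h.trans ?_)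
    · rw [map_mul, mul_assoc, map_pow]
    refine Finset.sum_congr rfl fun w _ => ?_
    simp only [Equiv.mulLeft₀_apply]
    rw [← mul_add, ← mul_sub, map_mul (quadraticChar E), map_mul (quadraticChar E)]
    ring
  have hs : ∀ b : E, ∑ w : E, quadraticChar E (w + b) *
      (if Algebra.trace F E w = 0 then 1 else 0) = traceCharSum F E (Algebra.trace F E b) := by
    intro b
    rw [traceCharSum, Finset.sum_filter]
    symm
    rw [← Equiv.sum_comp (Equiv.addRight b)]
    refine Finset.sum_congr rfl fun w _ => ?_
    simp
  have e2 : Algebra.trace F E (a * (2 * algebraMap F E y)) = y * (2 * Algebra.trace F E a) := by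
    have : a * (2 * algebraMap F E y) = algebraMap F E (y * 2) * a := by
      rw [map_mul, map_ofNat]; ring
    rw [this, trace_algebraMap_mul]; ring
  rw [h1]
  simp only [add_mul, Finset.sum_add_distrib]
  rw [hs, Finset.sum_congr rfl fun w _ => by rw [sub_eq_add_neg], hs, traceCharSum_eq hE h2,
    traceCharSum_eq hE h2 (Algebra.trace F E (-_)), map_neg, quadraticChar_neg hsq, e2, map_mul,
    traceCharSum_one hE h2 hsq]
  ring

/-- Only square c = y² contribute, and the factor χ(y) in the Salié sum cancels the one in η(c₀y²) =
η(c₀)χ(y). The property `mul_sq` of η is chosen for this cancellation. -/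
theorem sum_sign_mul_salieSum (hE : Module.finrank F E = 3) (h2 : (2 : F) ≠ 0)
    (hsq : IsSquare (-1 : F)) {η : F → ℤ} (hη : IsQuarticSign η) {a : E} (ha : a ≠ 0) (c₀ : F) :
    ∑ c : F, η (c₀ * c) * salieSum a c =
      η c₀ * ((Fintype.card F - 1) * Fintype.card F) *
        quadraticChar F (2 * Algebra.trace F E a) := by
  have h1 := sum_comp_sq h2 (fun c : F => η (c₀ * c) * salieSum a c)
  -- Passing from c to y² counts squares twice and nonsquares not at all; the nonsquares contributed
  -- nothing anyway.
  have h3 : ∑ w : F, (1 + quadraticChar F w) * (η (c₀ * w) * salieSum a w) =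
      2 * ∑ c : F, η (c₀ * c) * salieSum a c := by
    rw [Finset.mul_sum]
    refine Finset.sum_congr rfl fun c _ => ?_
    rcases eq_or_ne c 0 with rfl | hc
    · simp [hη.zero]
    by_cases hs : IsSquare c
    · rw [quadraticChar_of_isSquare hc hs]; ring
    · rw [salieSum_of_not_isSquare hE a hs]; ring
  have h4 : ∑ y : F, η (c₀ * y ^ 2) * salieSum a (y ^ 2) =
      ∑ y : F, (1 - if y = 0 then 1 else 0) * (2 * (η c₀ * Fintype.card F *
        quadraticChar F (2 * Algebra.trace F E a))) := by
    refine Finset.sum_congr rfl fun y _ => ?_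
    split_ifs with hy
    · subst hy; simp [hη.zero]
    · rw [salieSum_sq hE h2 hsq ha hy, hη.mul_sq]
      linear_combination (2 * η c₀ * Fintype.card F *
        quadraticChar F (2 * Algebra.trace F E a)) * quadraticChar_mul_self hy
  rw [h3, h4, ← Finset.sum_mul, Finset.sum_sub_distrib] at h1
  simp only [Finset.sum_const, Finset.card_univ, nsmul_eq_mul, mul_one, Finset.sum_ite_eq',
    Finset.mem_univ, if_true] at h1
  linarith

/-- Every element of `E` is `c s²` for exactly `q - 1` pairs `(c, s)`, apart from `0`. -/
theorem sum_smul_sq (hE : Module.finrank F E = 3) (h2 : (2 : F) ≠ 0) (G : E → ℤ) (hG : G 0 = 0) :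
    ∑ c : F, ∑ s : E, G (c • s ^ 2) = (Fintype.card F - 1) * ∑ d : E, G d := by
  -- For c ≠ 0 the equation c s² = d has 1 + χ(c)χ(d) solutions s. Summed over c the character part
  -- cancels, leaving q - 1.
  have h : ∀ c : F, ∑ s : E, G (c • s ^ 2) =
      ∑ d : E, ((1 - if c = 0 then 1 else 0) + quadraticChar F c * quadraticChar E d) * G d := by
    intro c
    rcases eq_or_ne c 0 with rfl | hc
    · simp [hG]
    · have hc' : algebraMap F E c ≠ 0 := by simpa using hc
      rw [sum_comp_sq (two_ne_zero_of_algebra E h2) (fun d => G (c • d))]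
      symm
      rw [← Equiv.sum_comp (Equiv.mulLeft₀ _ hc')]
      refine Finset.sum_congr rfl fun d _ => ?_
      rw [Equiv.mulLeft₀_apply, map_mul, quadraticChar_algebraMap hE, Algebra.smul_def,
        ← mul_assoc (quadraticChar F c), quadraticChar_mul_self hc]
      simp [hc]
  simp only [h]
  rw [Finset.sum_comm, Finset.mul_sum]
  refine Finset.sum_congr rfl fun d _ => ?_
  rw [← Finset.sum_mul, Finset.sum_add_distrib, ← Finset.sum_mul,
    quadraticChar_sum_zero (ringChar_ne_two_of_two_ne_zero h2), Finset.sum_sub_distrib]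
  simp

/-- The combined sign on `E`, supported on the nonzero elements of trace zero. -/
def IsTraceSign (η : F → ℤ) (θ ε : E → ℤ) : Prop := ∀ (c : F) (s : E), ε (c • s ^ 2) = η c * θ s

/-- A nonsquare of F stays a nonsquare in the cubic extension, so 1 and n represent both square
classes of E. -/
theorem exists_smul_sq (hE : Module.finrank F E = 3) (h2 : (2 : F) ≠ 0) (d : E) :
    ∃ (c : F) (s : E), d = c • s ^ 2 := by
  obtain ⟨n, hn⟩ := quadraticChar_exists_neg_one (ringChar_ne_two_of_two_ne_zero h2)
  have hn0 : n ≠ 0 := by rintro rfl; simp at hn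
  by_cases hd : IsSquare d
  · obtain ⟨s, rfl⟩ := hd; exact ⟨1, s, by rw [one_smul, pow_two]⟩
  · have : IsSquare (algebraMap F E n⁻¹ * d) := by
      by_contra h
      have h1 := quadraticChar_neg_one_iff_not_isSquare.2 h
      rw [map_mul, quadraticChar_algebraMap hE, quadraticChar_inv, hn,
        quadraticChar_neg_one_iff_not_isSquare.2 hd] at h1
      norm_num at h1
    obtain ⟨s, hs⟩ := this
    refine ⟨n, s, ?_⟩
    rw [pow_two, ← hs, ← Algebra.smul_def, smul_smul, mul_inv_cancel₀ hn0, one_smul]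

/-- Two representations c's'² = c₁s₁² have c' = c₁k² and s₁ = ±ks' with k in F. The factor χ(k) that
leaves η enters θ, so the product η θ is well defined. -/
theorem exists_isTraceSign (hE : Module.finrank F E = 3) (h2 : (2 : F) ≠ 0)
    (hsq : IsSquare (-1 : F)) {η : F → ℤ} (hη : IsQuarticSign η) {θ : E → ℤ}
    (hθ : IsConicSign F θ) : ∃ ε : E → ℤ, IsTraceSign η θ ε := by
  choose c s hcs using exists_smul_sq (F := F) (E := E) hE h2
  refine ⟨fun d => η (c d) * θ (s d), fun c' s' => ?_⟩
  have h := hcs (c' • s' ^ 2)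
  beta_reduce
  generalize c (c' • s' ^ 2) = c₁ at h ⊢
  generalize s (c' • s' ^ 2) = s₁ at h ⊢
  have hz : ∀ (c : F) (s : E), c • s ^ 2 = 0 → η c * θ s = 0 := by
    intro c s h
    rcases smul_eq_zero.1 h with h | h
    · rw [h, hη.zero, zero_mul]
    · rw [(pow_eq_zero_iff two_ne_zero).1 h, hθ.zero, mul_zero]
  rcases eq_or_ne (c' • s' ^ 2) 0 with h0 | h0
  · rw [hz c' s' h0, hz c₁ s₁ (h ▸ h0)]
  have h1 := h ▸ h0
  have hc' : c' ≠ 0 := by rintro rfl; simp at h0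
  have hs' : s' ≠ 0 := by rintro rfl; simp at h0
  have hc₁ : c₁ ≠ 0 := by rintro rfl; simp at h1
  have hs₁ : s₁ ≠ 0 := by rintro rfl; simp at h1
  have hc₁' : algebraMap F E c₁ ≠ 0 := by simpa using hc₁
  have hr : algebraMap F E (c' / c₁) = (s₁ / s') ^ 2 := by
    rw [Algebra.smul_def, Algebra.smul_def] at h
    rw [map_div₀]
    field_simp
    linear_combination h
  obtain ⟨k, hk⟩ := isSquare_of_isSquare_algebraMap hE ⟨s₁ / s', by rw [hr, pow_two]⟩
  have hk2 : c' = c₁ * k ^ 2 := by rw [pow_two, ← hk]; field_simp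
  have hθs : θ s₁ = quadraticChar F k * θ s' := by
    have : (s₁ / s') ^ 2 = (algebraMap F E k) ^ 2 := by rw [← hr, hk, map_mul, pow_two]
    rcases sq_eq_sq_iff_eq_or_eq_neg.1 this with h | h
    · have : s₁ = k • s' := by rw [Algebra.smul_def, ← h]; field_simp
      rw [this, hθ.smul]
    · have : s₁ = (-k) • s' := by rw [Algebra.smul_def, map_neg, ← h]; field_simp
      rw [this, hθ.smul, quadraticChar_neg hsq]
  rw [hθs, hk2, hη.mul_sq]; ring

variable {η : F → ℤ} {θ ε : E → ℤ}

theorem IsTraceSign.zero (hη : IsQuarticSign η) (hε : IsTraceSign η θ ε) : ε 0 = 0 := by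
  have := hε 0 0
  rwa [zero_smul, hη.zero, zero_mul] at this

theorem IsTraceSign.mul_sq (hE : Module.finrank F E = 3) (h2 : (2 : F) ≠ 0)
    (hη : IsQuarticSign η) (hε : IsTraceSign η θ ε) (k : F) (d : E) :
    ε (k ^ 2 • d) = quadraticChar F k * ε d := by
  obtain ⟨c, s, rfl⟩ := exists_smul_sq (F := F) hE h2 d
  rw [smul_smul, hε, hε, mul_comm (k ^ 2), hη.mul_sq]; ring

theorem IsTraceSign.trace_eq_zero (hE : Module.finrank F E = 3) (h2 : (2 : F) ≠ 0)
    (hθ : IsConicSign F θ) (hε : IsTraceSign η θ ε) {d : E} (hd : ε d ≠ 0) :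
    Algebra.trace F E d = 0 := by
  obtain ⟨c, s, rfl⟩ := exists_smul_sq (F := F) hE h2 d
  rw [hε] at hd
  by_contra h
  rw [map_smul] at h
  exact hd (by rw [hθ.anisotropic s (right_ne_zero_of_smul h), mul_zero])

theorem IsTraceSign.sq (hE : Module.finrank F E = 3) (h2 : (2 : F) ≠ 0)
    (hη : IsQuarticSign η) (hθ : IsConicSign F θ) (hε : IsTraceSign η θ ε) {d : E} (hd : d ≠ 0)
    (hdt : Algebra.trace F E d = 0) : ε d * ε d = 1 := by
  obtain ⟨c, s, rfl⟩ := exists_smul_sq (F := F) hE h2 d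
  have hc : c ≠ 0 := left_ne_zero_of_smul hd
  have hs : s ≠ 0 := by rintro rfl; simp at hd
  rw [map_smul] at hdt
  have h1 := hη.sq c hc
  have h3 := hθ.sq s hs ((smul_eq_zero.1 hdt).resolve_left hc)
  rw [hε]
  linear_combination θ s * θ s * h1 + h3

/-- Each isotropic s not orthogonal to s₀ contributes θ(s)·θ(s)θ(s₀) = θ(s₀), and all other s
contribute 0. -/
theorem sum_conicSign (hE : Module.finrank F E = 3) (h2 : (2 : F) ≠ 0)
    (hθ : IsConicSign F θ) {s₀ : E} (hs₀ : θ s₀ ≠ 0) :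
    ∑ s : E, θ s * quadraticChar F (2 * Algebra.trace F E (s * s₀)) =
      (Fintype.card F ^ 2 - Fintype.card F) * θ s₀ := by
  have hs00 : s₀ ≠ 0 := by rintro rfl; exact hs₀ hθ.zero
  have hs0 : Algebra.trace F E (s₀ ^ 2) = 0 := by
    by_contra h; exact hs₀ (hθ.anisotropic _ h)
  rw [← card_isotropic_trace_mul_ne_zero hE h2 hs00 hs0, ← Finset.sum_boole, Finset.sum_mul]
  refine Finset.sum_congr rfl fun s _ => ?_
  split_ifs with h
  · obtain ⟨h1, h3⟩ := h
    have hs : s ≠ 0 := by rintro rfl; simp at h3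
    have h4 := hθ.sq s hs h1
    rw [hθ.mul s s₀ (by intro h; simp [h] at h4) hs₀ h3]
    linear_combination θ s₀ * h4
  · by_cases h1 : Algebra.trace F E (s ^ 2) = 0
    · have h3 : Algebra.trace F E (s * s₀) = 0 := by by_contra h3; exact h ⟨h1, h3⟩
      rw [h3]; simp
    · rw [hθ.anisotropic s h1]; simp

/-- The sign `ε`, twisted by `χ`, is an eigenfunction of the collinearity relation. -/
theorem sum_traceSign (hE : Module.finrank F E = 3) (h2 : (2 : F) ≠ 0)
    (hsq : IsSquare (-1 : F)) (hη : IsQuarticSign η) (hθ : IsConicSign F θ)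
    (hε : IsTraceSign η θ ε) {d₀ : E} (hd₀ : d₀ ≠ 0) (hdt : Algebra.trace F E d₀ = 0) :
    ∑ d : E, ∑ u : E, quadraticChar E u * ε d *
      (if Algebra.trace F E (u * d₀ + d / u) = 0 then 1 else 0) =
      (Fintype.card F - 1) * Fintype.card F ^ 2 * ε d₀ := by
  obtain ⟨c₀, s₀, rfl⟩ := exists_smul_sq (F := F) hE h2 d₀
  have hc₀ : c₀ ≠ 0 := left_ne_zero_of_smul hd₀
  have hs₀ : s₀ ≠ 0 := by rintro rfl; simp at hd₀
  rw [map_smul] at hdt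
  have hst := (smul_eq_zero.1 hdt).resolve_left hc₀
  have hθ₀ : θ s₀ ≠ 0 := by intro h; have := hθ.sq s₀ hs₀ hst; simp [h] at this
  have hc₀' : algebraMap F E c₀ ≠ 0 := by simpa using hc₀
  have hq : (Fintype.card F : ℤ) - 1 ≠ 0 := by
    have : 1 < Fintype.card F := Fintype.one_lt_card
    omega
  apply mul_left_cancel₀ hq
  -- The factor q - 1 just introduced pays for parametrizing d as c s², since each nonzero d arises
  -- from q - 1 pairs.
  rw [← sum_smul_sq hE h2 _ (by simp [hε.zero hη]), Finset.sum_comm]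
  have hin : ∀ (c : F) (s : E), ∑ u : E, quadraticChar E u * ε (c • s ^ 2) *
      (if Algebra.trace F E (u * c₀ • s₀ ^ 2 + c • s ^ 2 / u) = 0 then 1 else 0) =
      θ s * (η c * salieSum (s * s₀) (c / c₀)) := by
    intro c s
    rw [hε]
    by_cases hs : s = 0
    · simp [hs, hθ.zero]
    have hr : s / s₀ ≠ 0 := div_ne_zero hs hs₀
    -- Replacing u by u s/s₀ balances the two terms: the argument of the trace becomes c₀·s s₀(u +
    -- (c/c₀)/u), and χ(u s/s₀) = χ(u s s₀).
    rw [← Equiv.sum_comp (Equiv.mulRight₀ _ hr), salieSum, Finset.mul_sum, Finset.mul_sum]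
    refine Finset.sum_congr rfl fun u _ => ?_
    rw [Equiv.mulRight₀_apply, div_eq_mul_inv, map_mul, map_mul, quadraticChar_inv, map_mul,
      map_mul]
    have e : u * (s * s₀⁻¹) * c₀ • s₀ ^ 2 + c • s ^ 2 / (u * (s * s₀⁻¹)) =
        algebraMap F E c₀ * (s * s₀ * (u + algebraMap F E (c / c₀) / u)) := by
      rw [Algebra.smul_def, Algebra.smul_def, map_div₀]
      field_simp
    rw [e, trace_algebraMap_mul]
    simp only [mul_eq_zero, hc₀, false_or]
    ring
  simp only [hin]
  have hsum : ∀ s : E, ∑ c : F, θ s * (η c * salieSum (s * s₀) (c / c₀)) =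
      η c₀ * ((Fintype.card F - 1) * Fintype.card F) *
        (θ s * quadraticChar F (2 * Algebra.trace F E (s * s₀))) := by
    intro s
    by_cases hs : s = 0
    · simp [hs, hθ.zero]
    have h := sum_sign_mul_salieSum hE h2 hsq hη (mul_ne_zero hs hs₀) c₀
    rw [← Finset.mul_sum, ← Equiv.sum_comp (Equiv.mulLeft₀ _ hc₀)]
    simp only [Equiv.mulLeft₀_apply, mul_div_cancel_left₀ _ hc₀, h]
    ring
  rw [Finset.sum_congr rfl fun s _ => hsum s, ← Finset.mul_sum, sum_conicSign hE h2 hθ hθ₀, hε]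
  ring

end EigenFunction
end TightSets
end

noncomputable section

namespace TightSets

/-! ### Singular vectors and the sign of a vector -/

section Counting

variable {F E : Type*} [Field F] [Fintype F] [DecidableEq F] [Field E] [Fintype E] [DecidableEq E]
  [Algebra F E]

/-- The polar form of `(u, v) ↦ T(uv)`, as a linear functional in the second argument. -/
def tracePolar (F : Type*) {E : Type*} [Field F] [Field E] [Algebra F E] (a : E × E) :
    E × E →ₗ[F] F :=
  traceMulRight F a.2 ∘ₗ LinearMap.fst F E E + traceMulRight F a.1 ∘ₗ LinearMap.snd F E E

theorem tracePolar_apply (a w : E × E) :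
    tracePolar F a w = Algebra.trace F E (w.1 * a.2) + Algebra.trace F E (w.2 * a.1) := rfl

theorem tracePolar_ne_zero {a : E × E} (ha : a ≠ 0) : tracePolar F a ≠ 0 := by
  intro h
  apply ha
  ext
  · by_contra h1
    refine traceMulRight_ne_zero (F := F) h1 (LinearMap.ext fun x => ?_)
    have := LinearMap.congr_fun h (0, x)
    simpa [tracePolar_apply] using this
  · by_contra h1
    refine traceMulRight_ne_zero (F := F) h1 (LinearMap.ext fun x => ?_)
    have := LinearMap.congr_fun h (x, 0)
    simpa [tracePolar_apply] using this

theorem card_trace_mul_eq_zero (hE : Module.finrank F E = 3) (a : E) :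
    (Finset.card {x : E | Algebra.trace F E (x * a) = 0} : ℤ) =
      if a = 0 then (Fintype.card F : ℤ) ^ 3 else Fintype.card F ^ 2 := by
  split_ifs with h
  · simp [h, card_cubic hE]
  · rw [card_trace_mul_eq hE h]; push_cast; rfl

theorem card_singular (hE : Module.finrank F E = 3) :
    (Finset.card {w : E × E | Algebra.trace F E (w.1 * w.2) = 0} : ℤ) =
      Fintype.card F ^ 5 + Fintype.card F ^ 3 - Fintype.card F ^ 2 := by
  rw [← Finset.sum_boole, Fintype.sum_prod_type_right]
  have h : ∀ v : E, ∑ u : E, (if Algebra.trace F E (u * v) = 0 then (1 : ℤ) else 0) =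
      Fintype.card F ^ 2 + if v = 0 then (Fintype.card F : ℤ) ^ 3 - Fintype.card F ^ 2 else 0 := by
    intro v
    rw [Finset.sum_boole, card_trace_mul_eq_zero hE]
    split_ifs with h
    · linarith
    · simp
  simp only [h, Finset.sum_add_distrib]
  simp [card_cubic hE]
  ring

/-- Off the hyperplane orthogonal to a, the form takes all values equally often along lines of
direction a. This counts the singular vectors not orthogonal to a, to be subtracted from all
singular vectors. -/
theorem card_singular_perp (hE : Module.finrank F E = 3) {a : E × E} (ha : a ≠ 0)
    (hQ : Algebra.trace F E (a.1 * a.2) = 0) :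
    (Finset.card {w : E × E | Algebra.trace F E (w.1 * w.2) = 0 ∧ tracePolar F a w = 0} : ℤ) =
      Fintype.card F ^ 4 + Fintype.card F ^ 3 - Fintype.card F ^ 2 := by
  have hQ1 : ∀ (w : E × E) (k : F), Algebra.trace F E ((w + k • a).1 * (w + k • a).2) =
      Algebra.trace F E (w.1 * w.2) + k * tracePolar F a w := by
    intro w k
    rw [tracePolar_apply]
    have : (w + k • a).1 * (w + k • a).2 =
        w.1 * w.2 + k • (w.1 * a.2 + w.2 * a.1) + (k * k) • (a.1 * a.2) := by
      simp only [Prod.fst_add, Prod.snd_add, Prod.smul_fst, Prod.smul_snd]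
      simp only [Algebra.smul_def, map_mul]
      ring
    rw [this, map_add, map_add, map_smul, map_smul, hQ, map_add]
    simp
  have hl : ∀ (w : E × E) (k : F), tracePolar F a (w + k • a) = tracePolar F a w := by
    intro w k
    rw [map_add, map_smul, tracePolar_apply a a, mul_comm a.2, hQ]
    simp
  have h := @sum_of_affine_on_lines F (E × E) _ _ _ _ _ _
    (fun w => Algebra.trace F E (w.1 * w.2)) (tracePolar F a) a ?_ ?_
    (fun t => if t = 0 then 1 else 0)
  rotate_left
  · exact hQ1
  · exact hl
  have h1 := card_linear_ne_zero (tracePolar F a) (tracePolar_ne_zero ha)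
  rw [Fintype.card_prod, card_cubic hE] at h1
  rw [Finset.sum_boole, Finset.filter_filter] at h
  simp only [Finset.sum_ite_eq', Finset.mem_univ, if_true, mul_one] at h
  have h3 := Finset.card_filter_add_card_filter_not
    (s := ({w : E × E | Algebra.trace F E (w.1 * w.2) = 0} : Finset (E × E)))
    (fun w => tracePolar F a w = 0)
  rw [Finset.filter_filter, Finset.filter_filter] at h3
  have h4 := card_singular (E := E) hE
  have hq : (Fintype.card F : ℤ) ≠ 0 := by exact_mod_cast Fintype.card_ne_zero
  simp only [and_comm (a := tracePolar F a _ ≠ 0)] at h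
  simp only [ne_eq] at h h1
  zify at h3
  rw [h4] at h3
  apply mul_left_cancel₀ (pow_ne_zero 2 hq)
  push_cast at h1
  linear_combination (Fintype.card F : ℤ) ^ 2 * h3 - (Fintype.card F : ℤ) * h - h1

/-- Inclusion-exclusion: discarding the vectors with a zero component. -/
theorem card_singular_perp_ne_zero (hE : Module.finrank F E = 3) (a : E × E) :
    (Finset.card {w : E × E | (w.1 ≠ 0 ∧ w.2 ≠ 0) ∧
      Algebra.trace F E (w.1 * w.2) = 0 ∧ tracePolar F a w = 0} : ℤ) =
    Finset.card {w : E × E | Algebra.trace F E (w.1 * w.2) = 0 ∧ tracePolar F a w = 0} -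
      (if a.2 = 0 then (Fintype.card F : ℤ) ^ 3 else Fintype.card F ^ 2) -
      (if a.1 = 0 then (Fintype.card F : ℤ) ^ 3 else Fintype.card F ^ 2) + 1 := by
  rw [← card_trace_mul_eq_zero hE, ← card_trace_mul_eq_zero hE]
  simp only [← Finset.sum_boole]
  have h1 : ∀ w : E × E, (if (w.1 ≠ 0 ∧ w.2 ≠ 0) ∧
      Algebra.trace F E (w.1 * w.2) = 0 ∧ tracePolar F a w = 0 then (1 : ℤ) else 0) =
      (if Algebra.trace F E (w.1 * w.2) = 0 ∧ tracePolar F a w = 0 then 1 else 0) -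
      (if w.2 = 0 then (if Algebra.trace F E (w.1 * a.2) = 0 then 1 else 0) else 0) -
      (if w.1 = 0 then (if Algebra.trace F E (w.2 * a.1) = 0 then 1 else 0) else 0) +
      (if w.1 = 0 then (if w.2 = 0 then 1 else 0) else 0) := by
    rintro ⟨u, v⟩
    rw [tracePolar_apply]
    by_cases hu : u = 0 <;> by_cases hv : v = 0 <;> simp [hu, hv]
  simp only [h1, Finset.sum_add_distrib, Finset.sum_sub_distrib]
  congr 1
  · congr 1
    · congr 1
      rw [Fintype.sum_prod_type]
      simp
    · rw [Fintype.sum_prod_type_right]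
      simp
  · rw [Fintype.sum_prod_type]
    simp

variable {η : F → ℤ} {θ ε : E → ℤ}

/-- The sign `χ(u) ε(uv)` of a vector `(u, v)`. -/
def pairSign (ε : E → ℤ) (w : E × E) : ℤ := quadraticChar E w.1 * ε (w.1 * w.2)

theorem pairSign_smul_fst (hE : Module.finrank F E = 3) (h2 : (2 : F) ≠ 0)
    (hη : IsQuarticSign η) (hε : IsTraceSign η θ ε) {k : F} (hk : k ≠ 0) (u v : E) :
    pairSign ε (k ^ 2 • u, v) = quadraticChar F k * pairSign ε (u, v) := by
  simp only [pairSign]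
  rw [smul_mul_assoc, hε.mul_sq hE h2 hη, Algebra.smul_def, map_mul, quadraticChar_algebraMap hE,
    quadraticChar_sq_one' hk]
  ring

theorem pairSign_smul_snd (hE : Module.finrank F E = 3) (h2 : (2 : F) ≠ 0)
    (hη : IsQuarticSign η) (hε : IsTraceSign η θ ε) (k : F) (u v : E) :
    pairSign ε (u, k ^ 2 • v) = quadraticChar F k * pairSign ε (u, v) := by
  simp only [pairSign]
  rw [mul_smul_comm, hε.mul_sq hE h2 hη]
  ring

/-- The first coordinate contributes χ(k), and so does the product uv, which is scaled by k². They
cancel, so the sign descends to projective points. -/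
theorem pairSign_smul (hE : Module.finrank F E = 3) (h2 : (2 : F) ≠ 0)
    (hη : IsQuarticSign η) (hε : IsTraceSign η θ ε) {k : F} (hk : k ≠ 0) (w : E × E) :
    pairSign ε (k • w) = pairSign ε w := by
  simp only [pairSign, Prod.smul_fst, Prod.smul_snd]
  rw [smul_mul_smul_comm, ← pow_two, hε.mul_sq hE h2 hη, Algebra.smul_def, map_mul,
    quadraticChar_algebraMap hE]
  linear_combination (quadraticChar E w.1 * ε (w.1 * w.2)) * quadraticChar_mul_self hk

theorem pairSign_sq (hE : Module.finrank F E = 3) (h2 : (2 : F) ≠ 0)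
    (hη : IsQuarticSign η) (hθ : IsConicSign F θ) (hε : IsTraceSign η θ ε) (w : E × E) :
    pairSign ε w ^ 2 = if (w.1 ≠ 0 ∧ w.2 ≠ 0) ∧ Algebra.trace F E (w.1 * w.2) = 0 then 1 else 0 := by
  rw [pairSign]
  split_ifs with h
  · have h1 := quadraticChar_mul_self h.1.1
    have h3 := hε.sq hE h2 hη hθ (mul_ne_zero h.1.1 h.1.2) h.2
    linear_combination ε (w.1 * w.2) ^ 2 * h1 + h3
  · by_cases h1 : w.1 * w.2 = 0
    · rw [h1, hε.zero hη]; simp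
    · rw [mul_eq_zero, not_or] at h1
      by_cases h3 : ε (w.1 * w.2) = 0
      · rw [h3]; simp
      · exact absurd ⟨h1, hε.trace_eq_zero hE h2 hθ h3⟩ h

/-- Multiplying v by k² with k a nonsquare of F reverses the sign and keeps u, so the sum is its own
negative. -/
theorem sum_pairSign_mul_fst (hE : Module.finrank F E = 3) (h2 : (2 : F) ≠ 0)
    (hη : IsQuarticSign η) (hε : IsTraceSign η θ ε) (g : E → ℤ) :
    ∑ w : E × E, pairSign ε w * g w.1 = 0 := by
  obtain ⟨k, hk⟩ := quadraticChar_exists_neg_one (ringChar_ne_two_of_two_ne_zero h2)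
  have hk0 : k ≠ 0 := by rintro rfl; simp at hk
  rw [Fintype.sum_prod_type]
  refine Finset.sum_eq_zero fun u _ => ?_
  have h : ∑ v : E, pairSign ε (u, v) * g u = -∑ v : E, pairSign ε (u, v) * g u := by
    conv_lhs => rw [← Equiv.sum_comp (MulAction.toPerm (Units.mk0 (k ^ 2) (pow_ne_zero 2 hk0)))]
    rw [← Finset.sum_neg_distrib]
    refine Finset.sum_congr rfl fun v _ => ?_
    have := pairSign_smul_snd hE h2 hη hε k u v
    rw [hk] at this
    simp only [MulAction.toPerm_apply, Units.smul_mk0, this]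
    ring
  simp only
  omega

theorem sum_pairSign_mul_snd (hE : Module.finrank F E = 3) (h2 : (2 : F) ≠ 0)
    (hη : IsQuarticSign η) (hε : IsTraceSign η θ ε) (g : E → ℤ) :
    ∑ w : E × E, pairSign ε w * g w.2 = 0 := by
  obtain ⟨k, hk⟩ := quadraticChar_exists_neg_one (ringChar_ne_two_of_two_ne_zero h2)
  have hk0 : k ≠ 0 := by rintro rfl; simp at hk
  rw [Fintype.sum_prod_type_right]
  refine Finset.sum_eq_zero fun v _ => ?_
  have h : ∑ u : E, pairSign ε (u, v) * g v = -∑ u : E, pairSign ε (u, v) * g v := by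
    conv_lhs => rw [← Equiv.sum_comp (MulAction.toPerm (Units.mk0 (k ^ 2) (pow_ne_zero 2 hk0)))]
    rw [← Finset.sum_neg_distrib]
    refine Finset.sum_congr rfl fun u _ => ?_
    have := pairSign_smul_fst hE h2 hη hε hk0 u v
    rw [hk] at this
    simp only [MulAction.toPerm_apply, Units.smul_mk0, this]
    ring
  simp only
  omega

/-- The eigenvalue equation that gives tightness. If a component of a vanishes, orthogonality
involves one coordinate only and both sides are 0; otherwise it is `sum_traceSign` in the
coordinates u = w₁/u₀ and d = w₁w₂. -/
theorem sum_pairSign_perp (hE : Module.finrank F E = 3) (h2 : (2 : F) ≠ 0)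
    (hsq : IsSquare (-1 : F)) (hη : IsQuarticSign η) (hθ : IsConicSign F θ)
    (hε : IsTraceSign η θ ε) {a : E × E} (hQ : Algebra.trace F E (a.1 * a.2) = 0) :
    ∑ w : E × E, pairSign ε w * (if tracePolar F a w = 0 then 1 else 0) =
      (Fintype.card F - 1) * Fintype.card F ^ 2 * pairSign ε a := by
  obtain ⟨u₀, v₀⟩ := a
  simp only at hQ
  by_cases hu₀ : u₀ = 0
  · subst hu₀
    have := sum_pairSign_mul_fst hE h2 hη hε
      (fun u => if Algebra.trace F E (u * v₀) = 0 then 1 else 0)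
    simpa [tracePolar_apply, pairSign] using this
  by_cases hv₀ : v₀ = 0
  · subst hv₀
    have := sum_pairSign_mul_snd hE h2 hη hε
      (fun v => if Algebra.trace F E (v * u₀) = 0 then 1 else 0)
    simpa [tracePolar_apply, pairSign, hε.zero hη] using this
  have h := sum_traceSign hE h2 hsq hη hθ hε (mul_ne_zero hu₀ hv₀) hQ
  rw [Finset.sum_comm] at h
  have hu1 := quadraticChar_mul_self hu₀
  have h1 : ∑ w : E × E, pairSign ε w * (if tracePolar F (u₀, v₀) w = 0 then 1 else 0) =
      quadraticChar E u₀ * ∑ u : E, ∑ d : E, quadraticChar E u * ε d *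
        (if Algebra.trace F E (u * (u₀ * v₀) + d / u) = 0 then 1 else 0) := by
    rw [Fintype.sum_prod_type, ← Equiv.sum_comp (Equiv.mulRight₀ _ hu₀), Finset.mul_sum]
    refine Finset.sum_congr rfl fun u _ => ?_
    simp only [Equiv.mulRight₀_apply]
    by_cases hu : u = 0
    · simp [hu, pairSign]
    have hu' : u * u₀ ≠ 0 := mul_ne_zero hu hu₀
    symm
    rw [← Equiv.sum_comp (Equiv.mulLeft₀ _ hu'), Finset.mul_sum]
    refine Finset.sum_congr rfl fun v _ => ?_
    simp only [Equiv.mulLeft₀_apply, pairSign, tracePolar_apply, map_mul (quadraticChar E)]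
    have e : u * (u₀ * v₀) + u * u₀ * v / u = u * u₀ * v₀ + v * u₀ := by
      field_simp
    rw [e, map_add]
    ring_nf
  rw [h1, h, pairSign]
  ring

/-- The number of vectors of a given sign orthogonal to a singular vector. -/
theorem card_pairSign_perp (hE : Module.finrank F E = 3) (h2 : (2 : F) ≠ 0)
    (hη : IsQuarticSign η) (hθ : IsConicSign F θ) (hε : IsTraceSign η θ ε) {σ : ℤ}
    (hσ : σ ^ 2 = 1) (a : E × E) :
    (2 * Finset.card {w : E × E | pairSign ε w = σ ∧ tracePolar F a w = 0} : ℤ) =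
      Finset.card {w : E × E | (w.1 ≠ 0 ∧ w.2 ≠ 0) ∧
        Algebra.trace F E (w.1 * w.2) = 0 ∧ tracePolar F a w = 0} +
      σ * ∑ w : E × E, pairSign ε w * (if tracePolar F a w = 0 then 1 else 0) := by
  -- A sign ψ in {0, 1, -1} satisfies 2·[ψ = σ] = ψ² + σψ, and ψ² is the indicator of the singular
  -- vectors with both components nonzero.
  simp only [← Finset.sum_boole, Finset.mul_sum, ← Finset.sum_add_distrib]
  refine Finset.sum_congr rfl fun w _ => ?_
  by_cases hw : tracePolar F a w = 0
  · have h1 := pairSign_sq hE h2 hη hθ hε w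
    simp only [hw, and_true, if_true, mul_one]
    rw [← h1]
    have h3 : pairSign ε w = 0 ∨ pairSign ε w = σ ∨ pairSign ε w = -σ := by
      have h4 : pairSign ε w = 0 ∨ pairSign ε w ^ 2 = σ ^ 2 := by
        rw [h1, hσ]
        split_ifs with h5
        · simp
        · left
          rw [if_neg h5] at h1
          exact pow_eq_zero_iff two_ne_zero |>.1 h1
      rcases h4 with h4 | h4
      · exact Or.inl h4
      · exact Or.inr (sq_eq_sq_iff_eq_or_eq_neg.1 h4)
    have hσ0 : σ ≠ 0 := by rintro rfl; simp at hσ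
    rcases h3 with h3 | h3 | h3
    · rw [h3, if_neg (Ne.symm hσ0)]; ring
    · rw [h3, if_pos rfl]; linear_combination -2 * hσ
    · rw [h3, if_neg (by omega)]; ring
  · simp [hw]

end Counting
end TightSets
end

noncomputable section

namespace TightSets

/-! ### From vectors to projective points -/

section Points

variable {F V : Type*} [Field F] [AddCommGroup V] [Module F V]

/-- Each projective point consists of `q - 1` nonzero vectors. -/
theorem ncard_points_mul [Finite F] (P : V → Prop) (h0 : ¬ P 0)
    (hP : ∀ (k : F) w, k ≠ 0 → P w → P (k • w)) :
    {r : ℙ F V | P r.rep}.ncard * (Nat.card F - 1) = Nat.card {w // P w} := by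
  have hmem : ∀ (r : ℙ F V) (k : Fˣ), P r.rep → P ((k : F) • r.rep) := fun r k h =>
    hP k _ k.ne_zero h
  let f : {r : ℙ F V // P r.rep} × Fˣ → {w // P w} := fun x =>
    ⟨(x.2 : F) • x.1.1.rep, hmem x.1.1 x.2 x.1.2⟩
  have hf : Function.Bijective f := by
    constructor
    · rintro ⟨⟨r, hr⟩, k⟩ ⟨⟨r', hr'⟩, k'⟩ h
      have h : (k : F) • r.rep = (k' : F) • r'.rep := congrArg Subtype.val h
      have hrr : r = r' := by
        rw [← r.mk_rep, ← r'.mk_rep, Projectivization.mk_eq_mk_iff']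
        refine ⟨(k : F)⁻¹ * k', ?_⟩
        rw [mul_smul, ← h, smul_smul, inv_mul_cancel₀ k.ne_zero, one_smul]
      subst hrr
      have := smul_left_injective F r.rep_nonzero h
      simp only [Prod.mk.injEq, true_and]
      exact Units.ext this
    · rintro ⟨w, hw⟩
      have hw0 : w ≠ 0 := by rintro rfl; exact h0 hw
      obtain ⟨a, ha⟩ := Projectivization.exists_smul_eq_mk_rep F w hw0
      refine ⟨⟨⟨Projectivization.mk F w hw0, ?_⟩, a⁻¹⟩, ?_⟩
      · rw [← ha]; exact hP a w a.ne_zero hw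
      · apply Subtype.ext
        simp only [f]
        rw [← ha]
        exact inv_smul_smul a w
  rw [← Nat.card_congr (Equiv.ofBijective f hf), Nat.card_prod, Nat.card_units]
  rfl

theorem mem_pointsOf {W : Submodule F V} {p : ℙ F V} : p ∈ pointsOf W ↔ p.rep ∈ W := by
  rw [pointsOf, Set.mem_ofPred_eq, Projectivization.submodule_eq, Submodule.span_singleton_le_iff_mem]

end Points

/-! ### Tightness of the generators and of the sign classes -/

section Tight

variable {F E V : Type*} [Field F] [Fintype F] [DecidableEq F] [Field E] [Fintype E]
  [DecidableEq E] [Algebra F E] [AddCommGroup V] [Module F V]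

theorem mem_pi1 {e : (E × E) ≃ₗ[F] V} {p : ℙ F V} : p ∈ pi1 e ↔ (e.symm p.rep).2 = 0 := by
  rw [pi1, mem_pointsOf, Submodule.mem_map_equiv, Submodule.mem_prod]
  simp

theorem mem_pi2 {e : (E × E) ≃ₗ[F] V} {p : ℙ F V} : p ∈ pi2 e ↔ (e.symm p.rep).1 = 0 := by
  rw [pi2, mem_pointsOf, Submodule.mem_map_equiv, Submodule.mem_prod]
  simp

/-- The points of sign `σ`. -/
def signPoints (e : (E × E) ≃ₗ[F] V) (ε : E → ℤ) (σ : ℤ) : Set (ℙ F V) :=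
  {p | pairSign ε (e.symm p.rep) = σ}

variable {Q : QuadraticForm F V} {e : (E × E) ≃ₗ[F] V}

theorem form_eq (he : ∀ w, Q (e w) = traceQuadric F E w) (v : V) :
    Q v = Algebra.trace F E ((e.symm v).1 * (e.symm v).2) := by
  rw [← traceQuadric_apply, ← he, e.apply_symm_apply]

theorem polar_eq (he : ∀ w, Q (e w) = traceQuadric F E w) (v w : V) :
    QuadraticMap.polar Q v w = tracePolar F (e.symm v) (e.symm w) := by
  rw [QuadraticMap.polar, form_eq he, form_eq he, form_eq he, tracePolar_apply, map_add,
    Prod.fst_add, Prod.snd_add, mul_add, add_mul, add_mul, map_add, map_add, map_add,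
    mul_comm (e.symm w).2]
  ring

theorem ncard_points_mul_eq (e : (E × E) ≃ₗ[F] V) (P : E × E → Prop) [DecidablePred P] (h0 : ¬ P 0)
    (hP : ∀ (k : F) w, k ≠ 0 → P w → P (k • w)) :
    ({r : ℙ F V | P (e.symm r.rep)}.ncard : ℤ) * (Fintype.card F - 1) =
      Finset.card {w : E × E | P w} := by
  have h := ncard_points_mul (F := F) (fun v : V => P (e.symm v)) (by simpa using h0)
    (by intro k w hk hw; rw [map_smul]; exact hP k _ hk hw)
  have hc : Nat.card {v : V // P (e.symm v)} = Nat.card {w : E × E // P w} :=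
    Nat.card_congr (e.symm.toEquiv.subtypeEquiv fun _ => Iff.rfl)
  rw [hc, Nat.card_eq_fintype_card, Nat.card_eq_fintype_card, Fintype.card_subtype] at h
  have h1 : 1 ≤ Fintype.card F := Fintype.card_pos
  rw [← h]
  push_cast [h1]
  rfl

theorem card_sub_one_ne_zero : (Fintype.card F : ℤ) - 1 ≠ 0 := by
  have : 1 < Fintype.card F := Fintype.one_lt_card
  omega

theorem card_ne_zero_trace_mul_eq_zero (hE : Module.finrank F E = 3) (a : E) :
    (Finset.card {x : E | x ≠ 0 ∧ Algebra.trace F E (x * a) = 0} : ℤ) =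
      (if a = 0 then (Fintype.card F : ℤ) ^ 3 else Fintype.card F ^ 2) - 1 := by
  rw [← card_trace_mul_eq_zero hE]
  have : ({x : E | x ≠ 0 ∧ Algebra.trace F E (x * a) = 0} : Finset E) =
      ({x : E | Algebra.trace F E (x * a) = 0} : Finset E).erase 0 := by
    ext x; simp
  rw [this, Finset.card_erase_of_mem (by simp), Nat.cast_sub]
  · simp
  · exact Finset.card_pos.2 ⟨0, by simp⟩

theorem rep_ne_zero_pair (e : (E × E) ≃ₗ[F] V) (p : ℙ F V) : e.symm p.rep ≠ 0 := by
  simpa using p.rep_nonzero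

theorem isTight_pi1 (hE : Module.finrank F E = 3) (he : ∀ w, Q (e w) = traceQuadric F E w) :
    IsTight Q 1 (pi1 e) := by
  classical
  refine ⟨fun p hp => ?_, fun p hp => ?_⟩
  · rw [quadric, Set.mem_ofPred_eq, form_eq he, mem_pi1.1 hp]; simp
  · have hset : perp Q p ∩ pi1 e = {r : ℙ F V | (fun w : E × E => w.2 = 0 ∧ w.1 ≠ 0 ∧
        Algebra.trace F E (w.1 * (e.symm p.rep).2) = 0) (e.symm r.rep)} := by
      ext r
      have hr := rep_ne_zero_pair e r
      rw [Set.mem_inter_iff, mem_pi1, perp, Set.mem_ofPred_eq, Set.mem_ofPred_eq, quadric,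
        Set.mem_ofPred_eq, form_eq he, polar_eq he, tracePolar_apply]
      constructor
      · rintro ⟨⟨-, h1⟩, h3⟩
        refine ⟨h3, fun h4 => hr (Prod.ext h4 h3), ?_⟩
        simpa [h3] using h1
      · rintro ⟨h1, -, h3⟩
        simp [h1, h3]
    have h := ncard_points_mul_eq e (fun w : E × E => w.2 = 0 ∧ w.1 ≠ 0 ∧
        Algebra.trace F E (w.1 * (e.symm p.rep).2) = 0) (by simp) (by
      rintro k w hk ⟨h1, h3, h4⟩
      simp only [Prod.smul_fst, Prod.smul_snd, h1, smul_zero, smul_mul_assoc, map_smul, h4]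
      simp [hk, h3])
    rw [← hset] at h
    have hc : Finset.card {w : E × E | w.2 = 0 ∧ w.1 ≠ 0 ∧
        Algebra.trace F E (w.1 * (e.symm p.rep).2) = 0} =
        Finset.card {x : E | x ≠ 0 ∧ Algebra.trace F E (x * (e.symm p.rep).2) = 0} := by
      refine Finset.card_bij (fun w _ => w.1) ?_ ?_ ?_
      · intro w hw
        simp only [Finset.mem_filter, Finset.mem_univ, true_and] at hw ⊢
        exact hw.2
      · intro w hw w' hw' h
        simp only [Finset.mem_filter, Finset.mem_univ, true_and] at hw hw'
        exact Prod.ext h (hw.1.trans hw'.1.symm)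
      · intro x hx
        simp only [Finset.mem_filter, Finset.mem_univ, true_and] at hx
        exact ⟨(x, 0), by simpa using hx, rfl⟩
    rw [hc, card_ne_zero_trace_mul_eq_zero hE] at h
    zify
    apply mul_right_cancel₀ (card_sub_one_ne_zero (F := F))
    rw [h, Nat.card_eq_fintype_card]
    by_cases h0 : (e.symm p.rep).2 = 0
    · rw [if_pos h0, if_pos (mem_pi1.2 h0)]; ring
    · rw [if_neg h0, if_neg (fun h' => h0 (mem_pi1.1 h'))]; ring

/-- Exchanging the two factors. -/
theorem isTight_pi2 (hE : Module.finrank F E = 3) (he : ∀ w, Q (e w) = traceQuadric F E w) :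
    IsTight Q 1 (pi2 e) := by
  have h := isTight_pi1 (Q := Q) (e := (LinearEquiv.prodComm F E E).trans e) hE (by
    intro w
    rw [LinearEquiv.trans_apply, he, traceQuadric_apply, traceQuadric_apply]
    simp [mul_comm])
  have h1 : pi1 ((LinearEquiv.prodComm F E E).trans e) = pi2 e := by
    ext p
    rw [mem_pi1, mem_pi2]
    rfl
  rwa [h1] at h

variable {η : F → ℤ} {θ ε : E → ℤ} {σ : ℤ}

theorem pairSign_ne_of_not (hE : Module.finrank F E = 3) (h2 : (2 : F) ≠ 0)
    (hη : IsQuarticSign η) (hθ : IsConicSign F θ) (hε : IsTraceSign η θ ε) (hσ : σ ^ 2 = 1)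
    {w : E × E} (hw : pairSign ε w = σ) :
    (w.1 ≠ 0 ∧ w.2 ≠ 0) ∧ Algebra.trace F E (w.1 * w.2) = 0 := by
  by_contra h
  have := pairSign_sq hE h2 hη hθ hε w
  rw [if_neg h, hw, hσ] at this
  norm_num at this

theorem ncard_perp_signPoints (hE : Module.finrank F E = 3) (h2 : (2 : F) ≠ 0)
    (hη : IsQuarticSign η) (hθ : IsConicSign F θ) (hε : IsTraceSign η θ ε) (hσ : σ ^ 2 = 1)
    (a : E × E) :
    ({r : ℙ F V | pairSign ε (e.symm r.rep) = σ ∧ tracePolar F a (e.symm r.rep) = 0}.ncard : ℤ) *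
      (Fintype.card F - 1) =
      Finset.card {w : E × E | pairSign ε w = σ ∧ tracePolar F a w = 0} := by
  refine ncard_points_mul_eq e (fun w => pairSign ε w = σ ∧ tracePolar F a w = 0) ?_ ?_
  · rintro ⟨h, -⟩
    exact (pairSign_ne_of_not hE h2 hη hθ hε hσ h).1.1 rfl
  · rintro k w hk ⟨h1, h3⟩
    rw [pairSign_smul hE h2 hη hε hk, map_smul, h3]
    exact ⟨h1, smul_zero k⟩

theorem signPoints_subset_quadric (hE : Module.finrank F E = 3) (h2 : (2 : F) ≠ 0)
    (he : ∀ w, Q (e w) = traceQuadric F E w)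
    (hη : IsQuarticSign η) (hθ : IsConicSign F θ) (hε : IsTraceSign η θ ε) (hσ : σ ^ 2 = 1) :
    signPoints e ε σ ⊆ quadric Q := by
  intro p hp
  rw [quadric, Set.mem_ofPred_eq, form_eq he]
  exact (pairSign_ne_of_not hE h2 hη hθ hε hσ hp).2

theorem two_mul_half_card (hF : Fintype.card F % 4 = 1) :
    (2 * ((Nat.card F ^ 2 - 1) / 2 : ℕ) : ℤ) = (Fintype.card F : ℤ) ^ 2 - 1 := by
  rw [Nat.card_eq_fintype_card]
  obtain ⟨m, hm⟩ : ∃ m, Fintype.card F = 2 * m + 1 := ⟨Fintype.card F / 2, by omega⟩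
  have : Fintype.card F ^ 2 - 1 = 2 * (2 * m ^ 2 + 2 * m) := by
    rw [hm]; ring_nf; omega
  rw [this, Nat.mul_div_cancel_left _ (by norm_num), hm]
  push_cast; ring

theorem isSquare_neg_one_of_card (hF : Fintype.card F % 4 = 1) : IsSquare (-1 : F) :=
  FiniteField.isSquare_neg_one_iff.2 (by omega)

theorem two_ne_zero_of_card (hF : Fintype.card F % 4 = 1) : (2 : F) ≠ 0 := by
  apply Ring.two_ne_zero
  intro h
  have := FiniteField.even_card_iff_char_two.1 h
  omega

/-- Twice the number of orthogonal vectors of sign σ is the count of admissible orthogonal vectors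
plus σ(q-1)q²ψ(a). The three cases ψ(a) = σ, -σ, 0 are the points of the set, of the opposite set,
and of the two planes. In the last case the correction in inclusion-exclusion replaces the
eigenvalue term. -/
theorem isTight_signPoints (hE : Module.finrank F E = 3) (hF : Fintype.card F % 4 = 1)
    (he : ∀ w, Q (e w) = traceQuadric F E w)
    (hη : IsQuarticSign η) (hθ : IsConicSign F θ) (hε : IsTraceSign η θ ε) (hσ : σ ^ 2 = 1) :
    IsTight Q ((Nat.card F ^ 2 - 1) / 2) (signPoints e ε σ) := by
  classical
  have h2 := two_ne_zero_of_card hF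
  have hsq := isSquare_neg_one_of_card hF
  have hsub := signPoints_subset_quadric hE h2 he hη hθ hε hσ
  refine ⟨hsub, fun p hp => ?_⟩
  set a := e.symm p.rep with ha
  have ha0 : a ≠ 0 := rep_ne_zero_pair e p
  have hQa : Algebra.trace F E (a.1 * a.2) = 0 := by rw [ha, ← form_eq he]; exact hp
  have hset : perp Q p ∩ signPoints e ε σ =
      {r : ℙ F V | pairSign ε (e.symm r.rep) = σ ∧ tracePolar F a (e.symm r.rep) = 0} := by
    ext r
    rw [Set.mem_inter_iff, perp, Set.mem_ofPred_eq, Set.mem_ofPred_eq, polar_eq he]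
    constructor
    · rintro ⟨⟨-, h1⟩, h3⟩; exact ⟨h3, h1⟩
    · rintro ⟨h1, h3⟩; exact ⟨⟨hsub h1, h3⟩, h1⟩
  have h1 := ncard_perp_signPoints (e := e) hE h2 hη hθ hε hσ a
  have h3 := card_pairSign_perp hE h2 hη hθ hε hσ a
  rw [card_singular_perp_ne_zero hE, card_singular_perp hE ha0 hQa,
    sum_pairSign_perp hE h2 hsq hη hθ hε hQa] at h3
  have hsg := pairSign_sq hE h2 hη hθ hε a
  have hx := two_mul_half_card hF
  rw [hset]
  generalize (Nat.card F ^ 2 - 1) / 2 = x at hx ⊢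
  zify
  apply mul_right_cancel₀ (card_sub_one_ne_zero (F := F))
  apply mul_left_cancel₀ (two_ne_zero (α := ℤ))
  rw [h1, h3]
  rw [Nat.card_eq_fintype_card]
  have hmem : p ∈ signPoints e ε σ ↔ pairSign ε a = σ := Iff.rfl
  rw [hmem]
  by_cases h : a.1 ≠ 0 ∧ a.2 ≠ 0
  · rw [if_pos ⟨h, hQa⟩, ← hσ] at hsg
    rw [if_neg h.1, if_neg h.2]
    have hσ0 : σ ≠ 0 := by rintro rfl; simp at hσ
    rcases sq_eq_sq_iff_eq_or_eq_neg.1 hsg with h' | h'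
    · rw [if_pos h', h']
      linear_combination ((Fintype.card F : ℤ) - 1) * Fintype.card F ^ 2 * hσ -
        (Fintype.card F + 1) * (Fintype.card F - 1 : ℤ) * hx
    · rw [if_neg (by omega), h']
      linear_combination -((Fintype.card F : ℤ) - 1) * Fintype.card F ^ 2 * hσ -
        (Fintype.card F + 1) * (Fintype.card F - 1 : ℤ) * hx
  · rw [if_neg (fun h' => h h'.1)] at hsg
    have hz : pairSign ε a = 0 := pow_eq_zero_iff two_ne_zero |>.1 hsg
    have hσ0 : (0 : ℤ) ≠ σ := by rintro rfl; simp at hσ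
    rw [hz, if_neg hσ0]
    have h01 : (a.1 = 0 ∧ a.2 ≠ 0) ∨ (a.1 ≠ 0 ∧ a.2 = 0) := by
      by_cases h4 : a.1 = 0
      · exact Or.inl ⟨h4, fun h5 => ha0 (Prod.ext h4 h5)⟩
      · exact Or.inr ⟨h4, by by_contra h5; exact h ⟨h4, h5⟩⟩
    rcases h01 with ⟨h4, h5⟩ | ⟨h4, h5⟩
    · rw [if_pos h4, if_neg h5]
      linear_combination -(Fintype.card F + 1) * (Fintype.card F - 1 : ℤ) * hx
    · rw [if_pos h5, if_neg h4]
      linear_combination -(Fintype.card F + 1) * (Fintype.card F - 1 : ℤ) * hx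

/-- The count of orthogonal vectors is used at a = 0, where orthogonality is no condition and the
signed sum vanishes. -/
theorem ncard_signPoints (hE : Module.finrank F E = 3) (hF : Fintype.card F % 4 = 1)
    (hη : IsQuarticSign η) (hθ : IsConicSign F θ) (hε : IsTraceSign η θ ε) (hσ : σ ^ 2 = 1) :
    (signPoints e ε σ).ncard =
      (Nat.card F ^ 2 - 1) / 2 * (Nat.card F ^ 2 + Nat.card F + 1) := by
  have h2 := two_ne_zero_of_card hF
  have hx := two_mul_half_card hF
  have h1 := ncard_perp_signPoints (e := e) hE h2 hη hθ hε hσ 0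
  have h3 := card_pairSign_perp hE h2 hη hθ hε hσ 0
  have h4 := sum_pairSign_mul_fst hE h2 hη hε (fun _ => 1)
  rw [card_singular_perp_ne_zero hE] at h3
  have h5 := card_singular (E := E) hE
  simp only [tracePolar_apply, Prod.fst_zero, Prod.snd_zero, mul_zero, map_zero, add_zero, and_true,
    if_true, h4, h5] at h1 h3
  have hset : signPoints e ε σ = {r : ℙ F V | pairSign ε (e.symm r.rep) = σ} := rfl
  rw [← hset] at h1
  generalize (Nat.card F ^ 2 - 1) / 2 = x at hx ⊢
  zify
  apply mul_right_cancel₀ (card_sub_one_ne_zero (F := F))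
  apply mul_left_cancel₀ (two_ne_zero (α := ℤ))
  rw [h1, h3]
  rw [Nat.card_eq_fintype_card]
  linear_combination -(Fintype.card F ^ 2 + Fintype.card F + 1) * (Fintype.card F - 1 : ℤ) * hx

end Tight
end TightSets
end

noncomputable section

namespace TightSets

/-! ### Plücker coordinates -/

section Plucker

variable {F : Type*} [Field F]

/-- The Klein quadratic form. -/
def kleinForm (w : Fin 6 → F) : F := w 0 * w 3 + w 1 * w 4 + w 2 * w 5

/-- The polar form of the Klein quadratic form. -/
def kleinPolar (w z : Fin 6 → F) : F :=
  w 0 * z 3 + w 3 * z 0 + (w 1 * z 4 + w 4 * z 1) + (w 2 * z 5 + w 5 * z 2)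

/-- The alternating matrix with the given Plücker coordinates. -/
def pluckerMatrix (w : Fin 6 → F) : Matrix (Fin 4) (Fin 4) F :=
  !![0, w 0, w 1, w 2; -w 0, 0, w 5, -w 4; -w 1, -w 5, 0, w 3; -w 2, w 4, -w 3, 0]

theorem pluckerMatrix_plucker (x y : Fin 4 → F) (i j : Fin 4) :
    pluckerMatrix (plucker x y) i j = x i * y j - x j * y i := by
  fin_cases i <;> fin_cases j <;> simp [pluckerMatrix, plucker]

theorem pluckerMatrix_smul (c : F) (w : Fin 6 → F) (i j : Fin 4) :
    pluckerMatrix (c • w) i j = c * pluckerMatrix w i j := by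
  fin_cases i <;> fin_cases j <;> simp [pluckerMatrix]

theorem eq_zero_of_pluckerMatrix {w : Fin 6 → F} (h : ∀ i j, pluckerMatrix w i j = 0) : w = 0 := by
  have h0 := h 0 1
  have h1 := h 0 2
  have h2 := h 0 3
  have h3 := h 2 3
  have h4 := h 3 1
  have h5 := h 1 2
  simp only [pluckerMatrix, Matrix.of_apply, Matrix.cons_val] at h0 h1 h2 h3 h4 h5
  ext i
  fin_cases i <;> assumption

theorem plucker_combination (x y : Fin 4 → F) (a b c d : F) :
    plucker (a • x + b • y) (c • x + d • y) = (a * d - b * c) • plucker x y := by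
  ext i
  fin_cases i <;> simp [plucker] <;> ring

theorem kleinForm_plucker (x y : Fin 4 → F) : kleinForm (plucker x y) = 0 := by
  simp [kleinForm, plucker]; ring

theorem plucker_self (x : Fin 4 → F) : plucker x x = 0 := by
  ext i; fin_cases i <;> simp [plucker] <;> ring

theorem plucker_smul_left (x : Fin 4 → F) (c : F) (y : Fin 4 → F) :
    plucker (c • x) y = c • plucker x y := by
  have := plucker_combination x y c 0 0 1
  simpa using this

theorem plucker_ne_zero {x y : Fin 4 → F} (h : LinearIndependent F ![x, y]) :
    plucker x y ≠ 0 := by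
  intro h0
  have hij : ∀ i j, x i * y j - x j * y i = 0 := by
    intro i j
    rw [← pluckerMatrix_plucker, h0]
    fin_cases i <;> fin_cases j <;> simp [pluckerMatrix]
  rw [LinearIndependent.pair_iff] at h
  have hx : ∀ i, x i = 0 := by
    intro i
    have := h (y i) (-x i) (by
      ext j
      simp only [Pi.add_apply, Pi.smul_apply, smul_eq_mul, Pi.zero_apply]
      linear_combination hij j i)
    simpa using this.2
  have := h 1 0 (by ext j; simp [hx])
  exact one_ne_zero this.1

theorem linearIndependent_of_plucker {x y : Fin 4 → F} (h : plucker x y ≠ 0) :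
    LinearIndependent F ![x, y] := by
  rw [LinearIndependent.pair_iff]
  intro s t hst
  by_contra hc
  apply h
  by_cases hs : s = 0
  · have ht : t ≠ 0 := fun ht => hc ⟨hs, ht⟩
    have hy : y = 0 := by simpa [hs, ht] using hst
    have := plucker_combination x y 1 0 0 0
    simpa [hy] using this
  · have hx : x = (-(t / s)) • y := by
      have : s • x = -(t • y) := eq_neg_of_add_eq_zero_left hst
      rw [neg_smul, div_eq_inv_mul, mul_smul, ← smul_neg, ← this, smul_smul, inv_mul_cancel₀ hs,
        one_smul]
    rw [hx, plucker_smul_left, plucker_self, smul_zero]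

theorem finrank_span_pair {x y : Fin 4 → F} (h : plucker x y ≠ 0) :
    Module.finrank F (Submodule.span F {x, y}) = 2 := by
  have := finrank_span_eq_card (linearIndependent_of_plucker h)
  rw [Fintype.card_fin] at this
  rwa [Matrix.range_cons, Matrix.range_cons, Matrix.range_empty, Set.union_empty,
    Set.singleton_union] at this

theorem plucker_ne_zero_of_finrank {x y : Fin 4 → F}
    (h : Module.finrank F (Submodule.span F {x, y}) = 2) : plucker x y ≠ 0 := by
  apply plucker_ne_zero
  rw [linearIndependent_iff_card_eq_finrank_span, Set.finrank, Matrix.range_cons,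
    Matrix.range_cons, Matrix.range_empty, Set.union_empty, Set.singleton_union, h,
    Fintype.card_fin]

/-- A vector is on the line with given Plücker coordinates iff all the wedge products vanish. -/
theorem mem_span_pair_iff_plucker {x y z : Fin 4 → F} (h : plucker x y ≠ 0) :
    z ∈ Submodule.span F {x, y} ↔ ∀ i j k, z i * pluckerMatrix (plucker x y) j k -
      z j * pluckerMatrix (plucker x y) i k + z k * pluckerMatrix (plucker x y) i j = 0 := by
  rw [Submodule.mem_span_pair]
  simp only [pluckerMatrix_plucker]
  constructor
  · rintro ⟨a, b, rfl⟩ i j k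
    simp only [Pi.add_apply, Pi.smul_apply, smul_eq_mul]
    ring
  · intro hz
    obtain ⟨i, j, hij⟩ : ∃ i j, x i * y j - x j * y i ≠ 0 := by
      by_contra! hc
      exact h (eq_zero_of_pluckerMatrix fun i j => by rw [pluckerMatrix_plucker, hc])
    -- Cramer's rule for z = a x + b y in the coordinates i, j, where the minor is nonzero.
    refine ⟨(z i * y j - z j * y i) / (x i * y j - x j * y i),
      (x i * z j - x j * z i) / (x i * y j - x j * y i), ?_⟩
    ext k
    simp only [Pi.add_apply, Pi.smul_apply, smul_eq_mul]
    rw [div_mul_eq_mul_div, div_mul_eq_mul_div, ← add_div, div_eq_iff hij]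
    linear_combination -hz i j k

/-- If w = x ∧ y, row i of its alternating matrix is xᵢy - yᵢx. Two rows i, j with wᵢⱼ ≠ 0 therefore
span the line and have Plücker vector wᵢⱼ w. The Klein relation is what makes this identity hold for
a general w. -/
theorem exists_plucker_eq {w : Fin 6 → F} (hw : kleinForm w = 0) (hw0 : w ≠ 0) :
    ∃ (x y : Fin 4 → F) (c : F), c ≠ 0 ∧ plucker x y = c • w := by
  obtain ⟨i, j, hij⟩ : ∃ i j, pluckerMatrix w i j ≠ 0 := by
    by_contra! hc
    exact hw0 (eq_zero_of_pluckerMatrix hc)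
  refine ⟨pluckerMatrix w i, pluckerMatrix w j, pluckerMatrix w i j, hij, ?_⟩
  rw [kleinForm] at hw
  ext k
  fin_cases i <;> fin_cases j <;> fin_cases k <;>
    simp only [plucker, pluckerMatrix, Matrix.of_apply, Matrix.cons_val, Pi.smul_apply,
      smul_eq_mul, Fin.reduceFinMk, Fin.zero_eta, Fin.mk_one, Fin.isValue] <;>
    first
    | ring1
    | linear_combination hw
    | linear_combination -hw

end Plucker
end TightSets
end

noncomputable section

namespace TightSets

/-! ### The Klein correspondence -/

section KleinCorrespondence

variable {F : Type*} [Field F]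

theorem exists_span_pair (l : PG3Line F) :
    ∃ x y : Fin 4 → F, l.1 = Submodule.span F {x, y} := by
  have b := Module.finBasisOfFinrankEq F l.1 l.2
  refine ⟨b 0, b 1, ?_⟩
  have h := congrArg (Submodule.map l.1.subtype) b.span_eq
  rw [Submodule.map_span, Submodule.map_subtype_top, ← Set.range_comp] at h
  refine h.symm.trans (congrArg _ ?_)
  ext z
  simp [Fin.exists_fin_two, eq_comm]

theorem plucker_ne_zero_of_line {l : PG3Line F} {x y : Fin 4 → F}
    (h : l.1 = Submodule.span F {x, y}) : plucker x y ≠ 0 :=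
  plucker_ne_zero_of_finrank (h ▸ l.2)

/-- A Plücker coordinate vector of a line. -/
def linePlucker (l : PG3Line F) : Fin 6 → F :=
  plucker (exists_span_pair l).choose (exists_span_pair l).choose_spec.choose

theorem linePlucker_eq (l : PG3Line F) : ∃ x y : Fin 4 → F, l.1 = Submodule.span F {x, y} ∧
    linePlucker l = plucker x y :=
  ⟨_, _, (exists_span_pair l).choose_spec.choose_spec, rfl⟩

theorem linePlucker_ne_zero (l : PG3Line F) : linePlucker l ≠ 0 := by
  obtain ⟨x, y, h, h'⟩ := linePlucker_eq l
  rw [h']; exact plucker_ne_zero_of_line h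

theorem kleinForm_linePlucker (l : PG3Line F) : kleinForm (linePlucker l) = 0 := by
  obtain ⟨x, y, h, h'⟩ := linePlucker_eq l
  rw [h', kleinForm_plucker]

theorem plucker_eq_smul_linePlucker {l : PG3Line F} {x y : Fin 4 → F}
    (h : l.1 = Submodule.span F {x, y}) : ∃ c : F, c ≠ 0 ∧ plucker x y = c • linePlucker l := by
  obtain ⟨x', y', h1, h2⟩ := linePlucker_eq l
  have hx : x ∈ Submodule.span F {x', y'} := by
    rw [← h1, h]; exact Submodule.subset_span (by simp)
  have hy : y ∈ Submodule.span F {x', y'} := by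
    rw [← h1, h]; exact Submodule.subset_span (by simp)
  obtain ⟨a, b, rfl⟩ := Submodule.mem_span_pair.1 hx
  obtain ⟨c, d, rfl⟩ := Submodule.mem_span_pair.1 hy
  have h3 := plucker_ne_zero_of_line h
  rw [plucker_combination] at h3 ⊢
  rw [h2]
  exact ⟨_, left_ne_zero_of_smul h3, rfl⟩

theorem mem_line_iff {l : PG3Line F} {z : Fin 4 → F} : z ∈ l.1 ↔ ∀ i j k,
    z i * pluckerMatrix (linePlucker l) j k - z j * pluckerMatrix (linePlucker l) i k +
      z k * pluckerMatrix (linePlucker l) i j = 0 := by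
  obtain ⟨x, y, h1, h2⟩ := linePlucker_eq l
  rw [h1, h2]
  exact mem_span_pair_iff_plucker (plucker_ne_zero_of_line h1)

/-- The incidence equations z ∧ w = 0 are homogeneous in the Plücker vector w and recover the line
from it. -/
theorem line_ext_of_linePlucker {l l' : PG3Line F} {c : F} (hc : c ≠ 0)
    (h : linePlucker l' = c • linePlucker l) : l' = l := by
  apply Subtype.ext
  ext z
  rw [mem_line_iff, mem_line_iff, h]
  simp only [pluckerMatrix_smul]
  have : ∀ i j k, z i * (c * pluckerMatrix (linePlucker l) j k) -
      z j * (c * pluckerMatrix (linePlucker l) i k) + z k * (c * pluckerMatrix (linePlucker l) i j)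
      = c * (z i * pluckerMatrix (linePlucker l) j k - z j * pluckerMatrix (linePlucker l) i k +
      z k * pluckerMatrix (linePlucker l) i j) := by intro i j k; ring
  simp only [this, mul_eq_zero, hc, false_or]

theorem exists_line_of_kleinForm {w : Fin 6 → F} (hw : kleinForm w = 0) (hw0 : w ≠ 0) :
    ∃ (l : PG3Line F) (c : F), c ≠ 0 ∧ w = c • linePlucker l := by
  obtain ⟨x, y, c, hc, h⟩ := exists_plucker_eq hw hw0
  have h0 : plucker x y ≠ 0 := by rw [h]; exact smul_ne_zero hc hw0
  let l : PG3Line F := ⟨Submodule.span F {x, y}, finrank_span_pair h0⟩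
  obtain ⟨d, hd, h'⟩ := plucker_eq_smul_linePlucker (l := l) (x := x) (y := y) rfl
  refine ⟨l, c⁻¹ * d, mul_ne_zero (inv_ne_zero hc) hd, ?_⟩
  rw [mul_smul, ← h', h, smul_smul, inv_mul_cancel₀ hc, one_smul]

theorem kleinPolar_smul (a b : F) (w z : Fin 6 → F) :
    kleinPolar (a • w) (b • z) = a * b * kleinPolar w z := by
  simp only [kleinPolar, Pi.smul_apply, smul_eq_mul]; ring

/-- Laplace expansion of the determinant along its first two rows. -/
theorem kleinPolar_plucker (x y z t : Fin 4 → F) :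
    kleinPolar (plucker x y) (plucker z t) = (Matrix.of ![x, y, z, t]).det := by
  rw [Matrix.det_succ_row_zero]
  simp [Fin.sum_univ_succ, Matrix.det_fin_three, kleinPolar, plucker, Fin.succAbove]
  ring

/-- Two lines meet iff their Plücker vectors are orthogonal. -/
theorem kleinPolar_linePlucker_eq_zero_iff (l l' : PG3Line F) :
    kleinPolar (linePlucker l) (linePlucker l') = 0 ↔ l.1 ⊓ l'.1 ≠ ⊥ := by
  obtain ⟨x, y, h1, h2⟩ := linePlucker_eq l
  obtain ⟨z, t, h3, h4⟩ := linePlucker_eq l'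
  rw [h2, h4, kleinPolar_plucker, ← Matrix.exists_vecMul_eq_zero_iff, Submodule.ne_bot_iff]
  have hI := linearIndependent_of_plucker (plucker_ne_zero_of_line h1)
  have hI' := linearIndependent_of_plucker (plucker_ne_zero_of_line h3)
  rw [LinearIndependent.pair_iff] at hI hI'
  have hexp : ∀ v : Fin 4 → F, Matrix.vecMul v (Matrix.of ![x, y, z, t]) =
      (v 0 • x + v 1 • y) + (v 2 • z + v 3 • t) := by
    intro v
    ext j
    simp [Matrix.vecMul, dotProduct, Fin.sum_univ_succ]
    ring
  simp only [hexp]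
  rw [h1, h3]
  constructor
  · rintro ⟨v, hv, h⟩
    refine ⟨v 0 • x + v 1 • y, ⟨Submodule.mem_span_pair.2 ⟨_, _, rfl⟩, ?_⟩, ?_⟩
    · refine Submodule.mem_span_pair.2 ⟨-v 2, -v 3, ?_⟩
      rw [eq_neg_of_add_eq_zero_left h]
      module
    · intro h0
      rw [h0, zero_add] at h
      obtain ⟨e0, e1⟩ := hI _ _ h0
      obtain ⟨e2, e3⟩ := hI' _ _ h
      apply hv
      ext i
      fin_cases i <;> assumption
  · rintro ⟨w, ⟨hw, hw'⟩, hw0⟩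
    obtain ⟨a, b, rfl⟩ := Submodule.mem_span_pair.1 hw
    obtain ⟨c, d, h⟩ := Submodule.mem_span_pair.1 hw'
    refine ⟨![a, b, -c, -d], ?_, ?_⟩
    · intro h0
      have e0 : a = 0 := congrFun h0 0
      have e1 : b = 0 := congrFun h0 1
      exact hw0 (by rw [e0, e1]; simp)
    · simp only [Matrix.cons_val]
      rw [← h]
      module

variable {V : Type*} [AddCommGroup V] [Module F V] {Q : QuadraticForm F V}
  {φ : (Fin 6 → F) ≃ₗ[F] V}

/-- The point of the quadric corresponding to a line. -/
def kleinPoint (φ : (Fin 6 → F) ≃ₗ[F] V) (l : PG3Line F) : ℙ F V :=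
  Projectivization.mk F (φ (linePlucker l)) (by simpa using linePlucker_ne_zero l)

theorem mk_plucker_eq_kleinPoint {l : PG3Line F} {x y : Fin 4 → F}
    (h : l.1 = Submodule.span F {x, y}) (h0 : φ (plucker x y) ≠ 0) :
    Projectivization.mk F (φ (plucker x y)) h0 = kleinPoint φ l := by
  obtain ⟨c, -, hc⟩ := plucker_eq_smul_linePlucker h
  rw [kleinPoint, Projectivization.mk_eq_mk_iff']
  exact ⟨c, by rw [hc, map_smul]⟩

theorem mem_kleinLines {T : Set (ℙ F V)} {l : PG3Line F} :
    l ∈ kleinLines φ T ↔ kleinPoint φ l ∈ T := by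
  constructor
  · rintro ⟨x, y, h, h0, hT⟩
    rwa [mk_plucker_eq_kleinPoint h] at hT
  · intro hT
    obtain ⟨x, y, h, -⟩ := linePlucker_eq l
    have h0 : φ (plucker x y) ≠ 0 := by simpa using plucker_ne_zero_of_line h
    exact ⟨x, y, h, h0, by rwa [mk_plucker_eq_kleinPoint h]⟩

theorem kleinPoint_injective : Function.Injective (kleinPoint φ) := by
  intro l l' h
  rw [kleinPoint, kleinPoint, Projectivization.mk_eq_mk_iff] at h
  obtain ⟨c, hc⟩ := h
  refine line_ext_of_linePlucker (c := c) c.ne_zero (φ.injective ?_)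
  rw [map_smul, ← hc]; rfl

theorem rep_kleinPoint (l : PG3Line F) :
    ∃ c : F, c ≠ 0 ∧ (kleinPoint φ l).rep = φ (c • linePlucker l) := by
  obtain ⟨a, ha⟩ := Projectivization.exists_smul_eq_mk_rep F (φ (linePlucker l))
    (by simpa using linePlucker_ne_zero l)
  exact ⟨a, a.ne_zero, by rw [map_smul]; exact ha.symm⟩

theorem kleinForm_smul (c : F) (w : Fin 6 → F) : kleinForm (c • w) = c ^ 2 * kleinForm w := by
  simp only [kleinForm, Pi.smul_apply, smul_eq_mul]; ring

/-- With injectivity, this allows points of the quadric to be counted as lines. -/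
theorem range_kleinPoint (hφ : IsKlein Q φ) : Set.range (kleinPoint φ) = quadric Q := by
  obtain ⟨k, hk, hQ⟩ := hφ
  ext p
  constructor
  · rintro ⟨l, rfl⟩
    obtain ⟨c, -, hc⟩ := rep_kleinPoint (φ := φ) l
    have : Q (φ (c • linePlucker l)) = k * kleinForm (c • linePlucker l) := hQ _
    rw [quadric, Set.mem_ofPred_eq, hc, this, kleinForm_smul, kleinForm_linePlucker, mul_zero,
      mul_zero]
  · intro hp
    have h1 := hQ (φ.symm p.rep)
    rw [φ.apply_symm_apply, show Q p.rep = 0 from hp] at h1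
    have h2 : kleinForm (φ.symm p.rep) = 0 := by
      rcases mul_eq_zero.1 h1.symm with h | h
      · exact absurd h hk
      · exact h
    obtain ⟨l, c, hc, hl⟩ := exists_line_of_kleinForm h2 (by simpa using p.rep_nonzero)
    refine ⟨l, ?_⟩
    rw [← p.mk_rep, kleinPoint, Projectivization.mk_eq_mk_iff']
    refine ⟨c⁻¹, ?_⟩
    rw [← φ.apply_symm_apply p.rep, hl, ← map_smul, smul_smul, inv_mul_cancel₀ hc, one_smul]

theorem polar_of_isKlein {k : F}
    (hQ : ∀ w, Q (φ w) = k * (w 0 * w 3 + w 1 * w 4 + w 2 * w 5)) (w z : Fin 6 → F) :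
    QuadraticMap.polar Q (φ w) (φ z) = k * kleinPolar w z := by
  rw [QuadraticMap.polar, ← map_add, hQ, hQ, hQ, kleinPolar]
  simp only [Pi.add_apply]; ring

theorem polar_kleinPoint_eq_zero_iff (hφ : IsKlein Q φ) (l l' : PG3Line F) :
    QuadraticMap.polar Q (kleinPoint φ l).rep (kleinPoint φ l').rep = 0 ↔ l.1 ⊓ l'.1 ≠ ⊥ := by
  obtain ⟨k, hk, hQ⟩ := hφ
  obtain ⟨c, hc, h⟩ := rep_kleinPoint (φ := φ) l
  obtain ⟨d, hd, h'⟩ := rep_kleinPoint (φ := φ) l'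
  rw [h, h', polar_of_isKlein hQ, kleinPolar_smul, ← kleinPolar_linePlucker_eq_zero_iff]
  simp [hk, hc, hd]

end KleinCorrespondence
end TightSets
end

noncomputable section

namespace TightSets

/-! ### Tight sets and Cameron–Liebler line classes -/

section CameronLiebler

variable {F : Type*} [Field F] [Finite F]

theorem ncard_pointsOf {V : Type*} [AddCommGroup V] [Module F V] [Finite V] (W : Submodule F V) :
    (pointsOf W).ncard * (Nat.card F - 1) = Nat.card F ^ Module.finrank F W - 1 := by
  have h := ncard_points_mul (F := F) (fun v : V => v ∈ W ∧ v ≠ 0) (by simp)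
    (fun k w hk hw => ⟨W.smul_mem k hw.1, smul_ne_zero hk hw.2⟩)
  have hset : pointsOf W = {r : ℙ F V | r.rep ∈ W ∧ r.rep ≠ 0} := by
    ext r
    rw [mem_pointsOf]
    exact ⟨fun h => ⟨h, r.rep_nonzero⟩, fun h => h.1⟩
  rw [hset, h]
  have : Nat.card {w // w ∈ W ∧ w ≠ 0} = Nat.card {w : W // w ≠ 0} :=
    Nat.card_congr ⟨fun w => ⟨⟨w.1, w.2.1⟩, fun h => w.2.2 (congrArg Subtype.val h)⟩,
      fun w => ⟨w.1.1, w.1.2, fun h => w.2 (Subtype.ext h)⟩, fun _ => rfl, fun _ => rfl⟩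
  have hc : Nat.card {w : W // w ≠ 0} = Nat.card W - 1 := by
    classical
    have := Fintype.ofFinite W
    rw [Nat.card_eq_fintype_card, Nat.card_eq_fintype_card]
    simp
  rw [this, hc, Module.natCard_eq_pow_finrank (K := F)]

/-- These are the entries of NᵀN. The meeting indicator is also 1 for equal lines, so the diagonal
value q + 1 is split as q + 1·1, matching a collinearity that includes the point itself. -/
theorem ncard_pointsOf_inf (l l' : PG3Line F) :
    (pointsOf (l.1 ⊓ l'.1)).ncard = (if l = l' then Nat.card F else 0) +
      @ite ℕ (l.1 ⊓ l'.1 ≠ ⊥) (Classical.dec _) 1 0 := by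
  classical
  have h := ncard_pointsOf (F := F) (l.1 ⊓ l'.1)
  have hq : 1 < Nat.card F := Finite.one_lt_card
  have hq' : 0 < Nat.card F - 1 := by omega
  apply Nat.eq_of_mul_eq_mul_right hq'
  rw [h]
  by_cases hl : l = l'
  · subst hl
    have hne : l.1 ≠ ⊥ := by
      intro h0
      have := l.2
      rw [h0, finrank_bot] at this
      omega
    rw [if_pos rfl, inf_idem, l.2, if_pos hne]
    zify [hq.le, Nat.one_le_pow 2 _ (zero_lt_one.trans hq)]
    ring
  · rw [if_neg hl, zero_add]
    by_cases hb : l.1 ⊓ l'.1 = ⊥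
    · rw [hb]; simp
    · rw [if_pos hb, one_mul]
      have h1 : Module.finrank F (l.1 ⊓ l'.1 : Submodule F (Fin 4 → F)) ≠ 0 := by
        rwa [Ne, Submodule.finrank_eq_zero]
      have h2 : Module.finrank F (l.1 ⊓ l'.1 : Submodule F (Fin 4 → F)) < 2 := by
        by_contra hc
        apply hl
        have e1 := Submodule.eq_of_le_of_finrank_le (inf_le_left : l.1 ⊓ l'.1 ≤ l.1)
          (by rw [l.2]; omega)
        have e2 := Submodule.eq_of_le_of_finrank_le (inf_le_right : l.1 ⊓ l'.1 ≤ l'.1)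
          (by rw [l'.2]; omega)
        exact Subtype.ext (e1.symm.trans e2)
      have h3 : Module.finrank F (l.1 ⊓ l'.1 : Submodule F (Fin 4 → F)) = 1 := by omega
      rw [h3, pow_one]

theorem sum_incMatrix_mul [Fintype (PG3Point F)] (l l' : PG3Line F) :
    ∑ p, incMatrix F p l * incMatrix F p l' = (pointsOf (l.1 ⊓ l'.1)).ncard := by
  classical
  have h : ∀ p, incMatrix F p l * incMatrix F p l' =
      if p ∈ pointsOf (l.1 ⊓ l'.1) then 1 else 0 := by
    intro p
    have : p ∈ pointsOf (l.1 ⊓ l'.1) ↔ p.submodule ≤ l.1 ∧ p.submodule ≤ l'.1 := by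
      rw [pointsOf, Set.mem_ofPred_eq, le_inf_iff]
    simp only [incMatrix, this]
    split_ifs <;> simp_all
  simp only [h, Finset.sum_boole]
  rw [Set.ncard_eq_toFinset_card', Nat.cast_inj]
  congr 1
  ext p; simp

theorem sum_incMatrix [Fintype (PG3Point F)] (l : PG3Line F) :
    ∑ p, incMatrix F p l = Nat.card F + 1 := by
  have h := sum_incMatrix_mul l l
  have h1 : ∀ p, incMatrix F p l * incMatrix F p l = incMatrix F p l := by
    intro p; simp only [incMatrix]; split_ifs <;> simp
  simp only [h1] at h
  have hne : l.1 ≠ ⊥ := by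
    intro h0
    have := l.2
    rw [h0, finrank_bot] at this
    omega
  rw [h, ncard_pointsOf_inf, if_pos rfl, inf_idem, if_pos hne]
  push_cast; rfl

variable {V : Type*} [AddCommGroup V] [Module F V] {Q : QuadraticForm F V}
  {φ : (Fin 6 → F) ≃ₗ[F] V} {T : Set (ℙ F V)} {x : ℕ}

theorem ncard_kleinLines (hφ : IsKlein Q φ) (hT : T ⊆ quadric Q) :
    (kleinLines φ T).ncard = T.ncard := by
  rw [← Set.ncard_image_of_injective _ (kleinPoint_injective (φ := φ))]
  congr 1
  ext p
  constructor
  · rintro ⟨l, hl, rfl⟩; exact mem_kleinLines.1 hl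
  · intro hp
    obtain ⟨l, rfl⟩ : p ∈ Set.range (kleinPoint φ) := by
      rw [range_kleinPoint hφ]; exact hT hp
    exact ⟨l, mem_kleinLines.2 hp, rfl⟩

theorem ncard_meeting (hφ : IsKlein Q φ) (hT : T ⊆ quadric Q) (l : PG3Line F) :
    {l' | l' ∈ kleinLines φ T ∧ l.1 ⊓ l'.1 ≠ ⊥}.ncard = (perp Q (kleinPoint φ l) ∩ T).ncard := by
  have hsub : perp Q (kleinPoint φ l) ∩ T ⊆ quadric Q := fun p hp => hT hp.2
  rw [← ncard_kleinLines hφ hsub]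
  congr 1
  ext l'
  rw [mem_kleinLines, Set.mem_ofPred_eq, mem_kleinLines, Set.mem_inter_iff, perp,
    Set.mem_ofPred_eq, polar_kleinPoint_eq_zero_iff hφ]
  exact ⟨fun h => ⟨⟨hT h.1, h.2⟩, h.1⟩, fun h => ⟨h.2, h.1.2⟩⟩

-- This is NᵀN applied to the characteristic vector. Tightness gives x(q+1) + q²c lines of the class
-- meeting l, and the diagonal adds qc.
open Classical in
theorem sum_lines_mul_incMatrix [Fintype (PG3Point F)] [Fintype (PG3Line F)] (hφ : IsKlein Q φ)
    (hT : IsTight Q x T) (l : PG3Line F) :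
    ∑ p, (∑ l' : PG3Line F with l' ∈ kleinLines φ T, incMatrix F p l') * incMatrix F p l =
      ((Nat.card F : ℚ) ^ 2 + Nat.card F) * (if l ∈ kleinLines φ T then 1 else 0) +
        x * (Nat.card F + 1) := by
  simp only [Finset.sum_mul]
  rw [Finset.sum_comm]
  have h : ∀ l' : PG3Line F, ∑ p, incMatrix F p l' * incMatrix F p l =
      (if l = l' then (Nat.card F : ℚ) else 0) + if l.1 ⊓ l'.1 ≠ ⊥ then 1 else 0 := by
    intro l'
    rw [Finset.sum_congr rfl fun p _ => mul_comm _ _, sum_incMatrix_mul, ncard_pointsOf_inf]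
    push_cast; congr
  simp only [h, Finset.sum_add_distrib, Finset.sum_boole, Finset.filter_filter]
  have hm := ncard_meeting hφ hT.1 l
  have hq : kleinPoint φ l ∈ quadric Q := by rw [← range_kleinPoint hφ]; exact ⟨l, rfl⟩
  rw [hT.2 _ hq, Set.ncard_eq_toFinset_card'] at hm
  have hset : Set.toFinset {l' | l' ∈ kleinLines φ T ∧ l.1 ⊓ l'.1 ≠ ⊥} =
      Finset.filter (fun l' => l' ∈ kleinLines φ T ∧ l.1 ⊓ l'.1 ≠ ⊥) Finset.univ := by
    ext; simp
  rw [hset] at hm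
  rw [hm, Finset.sum_ite_eq]
  simp only [Finset.mem_filter, Finset.mem_univ, true_and, ← mem_kleinLines]
  split_ifs <;> push_cast <;> ring

/-- Tight sets of the Klein quadric correspond to Cameron–Liebler line classes. -/
theorem isCameronLiebler_kleinLines (hφ : IsKlein Q φ) (hT : IsTight Q x T)
    (hcard : T.ncard = x * (Nat.card F ^ 2 + Nat.card F + 1)) :
    IsCameronLiebler (kleinLines φ T) x := by
  classical
  have := Fintype.ofFinite (PG3Point F)
  have := Fintype.ofFinite (PG3Line F)
  have hq0 : (Nat.card F : ℚ) ≠ 0 := by exact_mod_cast Nat.card_pos.ne'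
  have hq1 : (Nat.card F : ℚ) + 1 ≠ 0 := by positivity
  have hM := sum_lines_mul_incMatrix hφ hT
  constructor
  · have hind : Set.indicator (kleinLines φ T) (fun _ => (1 : ℚ)) =
        ∑ p, (((∑ l' : PG3Line F with l' ∈ kleinLines φ T, incMatrix F p l') - x) /
          ((Nat.card F : ℚ) ^ 2 + Nat.card F)) • incMatrix F p := by
      ext l
      rw [Finset.sum_apply]
      simp only [Pi.smul_apply, smul_eq_mul, div_mul_eq_mul_div, sub_mul]
      rw [← Finset.sum_div, Finset.sum_sub_distrib, hM, ← Finset.mul_sum, sum_incMatrix,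
        Set.indicator_apply]
      have : (Nat.card F : ℚ) ^ 2 + Nat.card F ≠ 0 := by
        rw [pow_two, ← mul_add_one]; exact mul_ne_zero hq0 hq1
      field_simp
      ring
    rw [hind]
    exact Submodule.sum_mem _ fun p _ =>
      Submodule.smul_mem _ _ (Submodule.subset_span ⟨p, rfl⟩)
  · intro S hS
    have hS1 : ∀ p, ∑ l : PG3Line F with l ∈ S, incMatrix F p l = 1 := by
      intro p
      obtain ⟨l, ⟨hl, hpl⟩, huniq⟩ := hS p
      rw [Finset.sum_eq_single_of_mem l (by simpa using hl)]
      · simp [incMatrix, hpl]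
      · intro l' hl' hne
        have hl'S : l' ∈ S := by simpa using hl'
        simp only [incMatrix]
        rw [if_neg]
        exact fun h => hne (huniq l' ⟨hl'S, h⟩)
    have hpts : (Fintype.card (PG3Point F) : ℚ) =
        ((Nat.card F : ℚ) ^ 2 + 1) * (Nat.card F + 1) := by
      rw [← Nat.card_eq_fintype_card,
        Projectivization.card_of_finrank F (Fin 4 → F) (Module.finrank_fin_fun F)]
      simp only [Finset.sum_range_succ, Finset.sum_range_zero]
      push_cast; ring
    have hcS : (Finset.card {l : PG3Line F | l ∈ S} : ℚ) * (Nat.card F + 1) =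
        ((Nat.card F : ℚ) ^ 2 + 1) * (Nat.card F + 1) := by
      rw [← hpts, ← nsmul_eq_mul, ← Finset.sum_const,
        ← Finset.sum_congr rfl fun l _ => sum_incMatrix l, Finset.sum_comm]
      simp [hS1]
    have hL : (Finset.card {l : PG3Line F | l ∈ kleinLines φ T} : ℚ) =
        x * ((Nat.card F : ℚ) ^ 2 + Nat.card F + 1) := by
      rw [← ncard_kleinLines hφ hT.1, Set.ncard_eq_toFinset_card'] at hcard
      rw [← Set.toFinset_ofPred]
      simp only [Set.ofPred_mem_eq]
      rw [hcard]; push_cast; rfl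
    -- Summing the identity over a spread turns its left side into (q+1)|L|, since the lines of the
    -- spread cover each point once.
    have hsum := Finset.sum_congr (rfl : ({l : PG3Line F | l ∈ S} : Finset _) = _)
      fun l _ => hM l
    rw [Finset.sum_comm] at hsum
    simp only [← Finset.mul_sum, hS1, mul_one, Finset.sum_add_distrib, Finset.sum_const,
      nsmul_eq_mul, Finset.sum_boole, Finset.filter_filter] at hsum
    have hdc : ∑ p, ∑ l' : PG3Line F with l' ∈ kleinLines φ T, incMatrix F p l' =
        x * ((Nat.card F : ℚ) ^ 2 + Nat.card F + 1) * (Nat.card F + 1) := by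
      refine Finset.sum_comm.trans ?_
      rw [Finset.sum_congr rfl fun l _ => sum_incMatrix l, Finset.sum_const, nsmul_eq_mul, hL]
    rw [hdc] at hsum
    have hSL : (Finset.card {l : PG3Line F | l ∈ S ∧ l ∈ kleinLines φ T}) =
        (S ∩ kleinLines φ T).ncard := by
      rw [Set.ncard_eq_toFinset_card']
      congr 1
      ext; simp
    rw [hSL] at hsum
    have hfin : (((S ∩ kleinLines φ T).ncard : ℕ) : ℚ) = x := by
      apply mul_left_cancel₀ (mul_ne_zero hq0 hq1)
      linear_combination -hsum - (x : ℚ) * hcS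
    exact_mod_cast hfin

end CameronLiebler
end TightSets
end

noncomputable section

namespace TightSets

/-! ### Products of reflections as collineations -/

section Collineations

variable {F : Type*} [Field F]

/-- The reflection in `b` for the Klein form, multiplied by the value of the form at `b`. -/
def kleinReflect (b w : Fin 6 → F) : Fin 6 → F := kleinForm b • w - kleinPolar b w • b

/-- Plücker coordinates of the complementary index pairs. -/
def complPlucker (w : Fin 6 → F) : Fin 6 → F := ![w 3, w 4, w 5, w 0, w 1, w 2]

/-- An alternating matrix defines a correlation of PG(3,q). On Plücker vectors it is a reflection up
to scalar, once a line of the dual space is identified with a line by taking complementary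
coordinates. -/
theorem plucker_pluckerMatrix_mulVec (b : Fin 6 → F) (x y : Fin 4 → F) :
    plucker ((pluckerMatrix b).mulVec x) ((pluckerMatrix b).mulVec y) =
      -kleinReflect b (complPlucker (plucker x y)) := by
  have h : ∀ z : Fin 4 → F, (pluckerMatrix b).mulVec z =
      ![b 0 * z 1 + b 1 * z 2 + b 2 * z 3, -b 0 * z 0 + b 5 * z 2 - b 4 * z 3,
        -b 1 * z 0 - b 5 * z 1 + b 3 * z 3, -b 2 * z 0 + b 4 * z 1 - b 3 * z 2] := by
    intro z
    ext i
    fin_cases i <;> simp [pluckerMatrix, Matrix.mulVec, dotProduct, Fin.sum_univ_succ] <;> ring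
  rw [h, h]
  ext i
  fin_cases i <;>
    simp only [plucker, kleinReflect, complPlucker, kleinForm, kleinPolar, Matrix.cons_val,
      Pi.neg_apply, Pi.sub_apply, Pi.smul_apply, smul_eq_mul, Fin.reduceFinMk, Fin.zero_eta,
      Fin.mk_one, Fin.isValue] <;>
    ring

/-- Complementation is an isometric involution of the Klein form, so it conjugates reflections to
reflections. This lets the two dualities cancel in a product of two correlations. -/
theorem complPlucker_kleinReflect (b w : Fin 6 → F) :
    complPlucker (kleinReflect (complPlucker b) (complPlucker w)) = kleinReflect b w := by
  ext i
  fin_cases i <;>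
    simp only [kleinReflect, complPlucker, kleinForm, kleinPolar, Matrix.cons_val,
      Pi.sub_apply, Pi.smul_apply, smul_eq_mul, Fin.reduceFinMk, Fin.zero_eta,
      Fin.mk_one, Fin.isValue] <;>
    ring

theorem complPlucker_neg (w : Fin 6 → F) : complPlucker (-w) = -complPlucker w := by
  ext i
  fin_cases i <;> rfl

theorem kleinReflect_neg (b w : Fin 6 → F) : kleinReflect b (-w) = -kleinReflect b w := by
  ext i
  simp only [kleinReflect, kleinPolar, Pi.neg_apply, Pi.sub_apply, Pi.smul_apply, smul_eq_mul]
  ring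

/-- The Klein form is the Pfaffian, and the complementary matrix plays the part of an adjugate.
Nonsingular vectors thus give invertible matrices. -/
theorem pluckerMatrix_compl_mul (b : Fin 6 → F) :
    pluckerMatrix (complPlucker b) * pluckerMatrix b = -kleinForm b • (1 : Matrix _ _ F) := by
  ext i j
  fin_cases i <;> fin_cases j <;>
    simp [pluckerMatrix, complPlucker, kleinForm, Matrix.mul_apply, Fin.sum_univ_succ] <;> ring

theorem kleinForm_complPlucker (b : Fin 6 → F) : kleinForm (complPlucker b) = kleinForm b := by
  simp only [kleinForm, complPlucker, Matrix.cons_val]; ring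

theorem pluckerMatrix_mulVec_injective {b : Fin 6 → F} (hb : kleinForm b ≠ 0) :
    Function.Injective (pluckerMatrix b).mulVecLin := by
  intro x y h
  have h1 := congrArg (pluckerMatrix (complPlucker b)).mulVec h
  simp only [Matrix.mulVecLin_apply, Matrix.mulVec_mulVec, pluckerMatrix_compl_mul,
    Matrix.smul_mulVec, Matrix.one_mulVec] at h1
  exact smul_right_injective _ (neg_ne_zero.2 hb) h1

/-- A product of two reflections of the Klein quadric is induced by a collineation. -/
theorem exists_collineation_reflect_reflect {a b : Fin 6 → F} (ha : kleinForm a ≠ 0)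
    (hb : kleinForm b ≠ 0) : ∃ g : (Fin 4 → F) ≃ₗ[F] (Fin 4 → F), ∀ x y,
      plucker (g x) (g y) = kleinReflect a (kleinReflect b (plucker x y)) := by
  have hb' : kleinForm (complPlucker b) ≠ 0 := by rwa [kleinForm_complPlucker]
  refine ⟨(LinearEquiv.ofInjectiveEndo _ (pluckerMatrix_mulVec_injective hb')).trans
    (LinearEquiv.ofInjectiveEndo _ (pluckerMatrix_mulVec_injective ha)), fun x y => ?_⟩
  simp only [LinearEquiv.trans_apply, LinearEquiv.coe_ofInjectiveEndo, Matrix.mulVecLin_apply]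
  rw [plucker_pluckerMatrix_mulVec, plucker_pluckerMatrix_mulVec, complPlucker_neg,
    complPlucker_kleinReflect, kleinReflect_neg, neg_neg]

variable {V : Type*} [AddCommGroup V] [Module F V]

/-- `f` is induced, up to a scalar, by a linear collineation of `PG(3,q)`. -/
def IsInduced (φ : (Fin 6 → F) ≃ₗ[F] V) (f : V → V) : Prop :=
  ∃ (g : (Fin 4 → F) ≃ₗ[F] (Fin 4 → F)) (c : F), c ≠ 0 ∧
    ∀ x y, f (φ (plucker x y)) = c • φ (plucker (g x) (g y))

theorem IsInduced.comp {φ : (Fin 6 → F) ≃ₗ[F] V} {f f' : V →ₗ[F] V} (h : IsInduced φ f)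
    (h' : IsInduced φ f') : IsInduced φ (f ∘ₗ f') := by
  obtain ⟨g, c, hc, hg⟩ := h
  obtain ⟨g', c', hc', hg'⟩ := h'
  refine ⟨g'.trans g, c' * c, mul_ne_zero hc' hc, fun x y => ?_⟩
  rw [LinearMap.comp_apply, hg', map_smul, hg, smul_smul]
  rfl

variable {Q : QuadraticForm F V} {φ : (Fin 6 → F) ≃ₗ[F] V}

theorem reflect_reflect_isInduced (hφ : IsKlein Q φ) {a b : V} (ha : Q a ≠ 0) (hb : Q b ≠ 0) {c : F}
    (hc : c ≠ 0) {f : V → V}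
    (hf : ∀ w, c • f w = Q a • (Q b • w - QuadraticMap.polar Q b w • b) -
      QuadraticMap.polar Q a (Q b • w - QuadraticMap.polar Q b w • b) • a) :
    IsInduced φ f := by
  obtain ⟨k, hk, hQ⟩ := hφ
  have hQ' : ∀ w, Q (φ w) = k * kleinForm w := hQ
  have hr : ∀ u w, Q (φ u) • φ w - QuadraticMap.polar Q (φ u) (φ w) • φ u =
      φ (k • kleinReflect u w) := by
    intro u w
    rw [hQ', polar_of_isKlein hQ, kleinReflect, smul_sub, smul_smul, smul_smul, map_sub, map_smul,
      map_smul]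
  obtain ⟨a, rfl⟩ := φ.surjective a
  obtain ⟨b, rfl⟩ := φ.surjective b
  have ha' : kleinForm a ≠ 0 := by
    intro h; rw [hQ', h, mul_zero] at ha; exact ha rfl
  have hb' : kleinForm b ≠ 0 := by
    intro h; rw [hQ', h, mul_zero] at hb; exact hb rfl
  obtain ⟨g, hg⟩ := exists_collineation_reflect_reflect ha' hb'
  refine ⟨g, c⁻¹ * (k * k), mul_ne_zero (inv_ne_zero hc) (mul_ne_zero hk hk), fun x y => ?_⟩
  have h := hf (φ (plucker x y))
  rw [hr, hr] at h
  have hs : kleinReflect a (k • kleinReflect b (plucker x y)) =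
      k • kleinReflect a (kleinReflect b (plucker x y)) := by
    ext i
    simp only [kleinReflect, kleinPolar, Pi.sub_apply, Pi.smul_apply, smul_eq_mul]
    ring
  rw [hs, smul_smul, ← hg] at h
  rw [mul_smul, ← map_smul φ (k * k), ← h, smul_smul, inv_mul_cancel₀ hc, one_smul]

/-- Scaling a hyperbolic pair `(e, f)` to `(t⁻¹ e, t f)`. -/
def hyperbolicScale (Q : QuadraticForm F V) (e f : V) (t : F) : V →ₗ[F] V :=
  LinearMap.id + (t⁻¹ - 1) • (LinearMap.toSpanSingleton F V e ∘ₗ Q.polarBilin f) +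
    (t - 1) • (LinearMap.toSpanSingleton F V f ∘ₗ Q.polarBilin e)

theorem hyperbolicScale_apply (e f : V) (t : F) (w : V) : hyperbolicScale Q e f t w =
    w + (t⁻¹ - 1) • QuadraticMap.polar Q f w • e + (t - 1) • QuadraticMap.polar Q e w • f := rfl

theorem hyperbolicScale_isInduced (hφ : IsKlein Q φ) {e f : V} (he : Q e = 0) (hf : Q f = 0)
    (hef : QuadraticMap.polar Q e f = 1) {t : F} (ht : t ≠ 0) :
    IsInduced φ (hyperbolicScale Q e f t) := by
  have hfe : QuadraticMap.polar Q f e = 1 := by rw [QuadraticMap.polar_comm, hef]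
  have hQ : ∀ s : F, Q (e - s • f) = -s := by
    intro s
    have : Q (e - s • f) = Q e + Q (-(s • f)) + QuadraticMap.polar Q e (-(s • f)) := by
      rw [sub_eq_add_neg, QuadraticMap.map_add Q]
    rw [this, QuadraticMap.map_neg, QuadraticMap.map_smul, he, hf, QuadraticMap.polar_neg_right,
      QuadraticMap.polar_smul_right, hef]
    simp
  have h1 : Q (e - f) = -1 := by simpa using hQ 1
  have hee : QuadraticMap.polar Q e e = 0 := by rw [QuadraticMap.polar_self, he, smul_zero]
  have hff : QuadraticMap.polar Q f f = 0 := by rw [QuadraticMap.polar_self, hf, smul_zero]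
  -- The reflection in e - f exchanges e and f, and the one in e - tf exchanges e and tf; together
  -- they scale the pair. The scalar t is Q(e - tf)Q(e - f), left over from using reflections
  -- without denominators.
  refine reflect_reflect_isInduced hφ (a := e - t • f) (b := e - f) (c := t) ?_ ?_ ht ?_
  · rw [hQ]; exact neg_ne_zero.2 ht
  · rw [h1]; exact neg_ne_zero.2 one_ne_zero
  · intro w
    rw [hyperbolicScale_apply, hQ, h1]
    simp only [QuadraticMap.polar_sub_left, QuadraticMap.polar_sub_right,
      QuadraticMap.polar_smul_left, QuadraticMap.polar_smul_right, hef, hfe, hee, hff, smul_eq_mul]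
    generalize QuadraticMap.polar Q e w = α
    generalize QuadraticMap.polar Q f w = β
    match_scalars <;> field_simp <;> ring

theorem mapLine_image_kleinLines {f : V ≃ₗ[F] V} (h : IsInduced φ f) (T : Set (ℙ F V)) :
    ∃ g : (Fin 4 → F) ≃ₗ[F] (Fin 4 → F),
      mapLine g '' kleinLines φ T = kleinLines φ ((fun p : ℙ F V => f • p) '' T) := by
  obtain ⟨g, c, hc, hg⟩ := h
  refine ⟨g, ?_⟩
  have hmap : ∀ l : PG3Line F, kleinPoint φ (mapLine g l) = f • kleinPoint φ l := by
    intro l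
    obtain ⟨x, y, h1, h2⟩ := linePlucker_eq l
    have h3 : (mapLine g l).1 = Submodule.span F {g x, g y} := by
      rw [mapLine]
      simp only [h1, Submodule.map_span, Set.image_pair]
      rfl
    have h4 : φ (plucker (g x) (g y)) ≠ 0 := by simpa using plucker_ne_zero_of_line h3
    rw [← mk_plucker_eq_kleinPoint h3 h4, kleinPoint, Projectivization.smul_mk,
      Projectivization.mk_eq_mk_iff']
    refine ⟨c⁻¹, ?_⟩
    rw [h2, LinearEquiv.smul_def, hg, smul_smul, inv_mul_cancel₀ hc, one_smul]
  ext l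
  rw [mem_kleinLines]
  constructor
  · rintro ⟨l, hl, rfl⟩
    exact ⟨_, mem_kleinLines.1 hl, (hmap l).symm⟩
  · rintro ⟨p, hp, hpl⟩
    have hl : mapLine g (mapLine g.symm l) = l := by
      apply Subtype.ext
      simp only [mapLine]
      rw [← Submodule.map_comp]
      simp
    refine ⟨mapLine g.symm l, mem_kleinLines.2 ?_, hl⟩
    have h5 := hmap (mapLine g.symm l)
    rw [hl, ← hpl] at h5
    rwa [← smul_left_cancel _ h5]

end Collineations
end TightSets
end

noncomputable section

namespace TightSets

/-! ### The trace model and its isometries -/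

section Model

variable {F E V : Type*} [Field F] [Fintype F] [DecidableEq F] [Field E] [Fintype E]
  [DecidableEq E] [Algebra F E] [AddCommGroup V] [Module F V]
  {Q : QuadraticForm F V} {e : (E × E) ≃ₗ[F] V}

/-- A basis of `E` together with its dual basis for the trace form. -/
theorem exists_dual_bases (hE : Module.finrank F E = 3) :
    ∃ b d : Module.Basis (Fin 3) F E, ∀ i j,
      Algebra.trace F E (b i * d j) = if i = j then 1 else 0 := by
  have := finiteDimensional_of_fintype (F := F) (E := E)
  let b := Module.finBasisOfFinrankEq F E hE
  have hnd := traceForm_nondegenerate F E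
  refine ⟨b, (Algebra.traceForm F E).dualBasis hnd b, fun i j => ?_⟩
  exact LinearMap.BilinForm.apply_dualBasis_right hnd (Algebra.traceForm_isSymm F) b i j

theorem polar_apply_apply (he : ∀ w, Q (e w) = traceQuadric F E w) (v w : E × E) :
    QuadraticMap.polar Q (e v) (e w) = tracePolar F v w := by
  rw [polar_eq he, e.symm_apply_apply, e.symm_apply_apply]

theorem hyperbolicScale_fst (he : ∀ w, Q (e w) = traceQuadric F E w)
    {b d : Module.Basis (Fin 3) F E}
    (hbd : ∀ i j, Algebra.trace F E (b i * d j) = if i = j then 1 else 0) {t : F} (i j : Fin 3) :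
    hyperbolicScale Q (e (b i, 0)) (e (0, d i)) t (e (b j, 0)) =
      if i = j then t⁻¹ • e (b j, 0) else e (b j, 0) := by
  rw [hyperbolicScale_apply, polar_apply_apply he, polar_apply_apply he, tracePolar_apply,
    tracePolar_apply]
  simp only [hbd, zero_mul, map_zero, mul_zero, add_zero, zero_smul, smul_zero]
  by_cases h : i = j
  · subst h; simp; module
  · rw [if_neg (Ne.symm h), if_neg h]; simp

theorem hyperbolicScale_snd (he : ∀ w, Q (e w) = traceQuadric F E w)
    {b d : Module.Basis (Fin 3) F E}
    (hbd : ∀ i j, Algebra.trace F E (b i * d j) = if i = j then 1 else 0) {t : F} (i j : Fin 3) :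
    hyperbolicScale Q (e (b i, 0)) (e (0, d i)) t (e (0, d j)) =
      if i = j then t • e (0, d j) else e (0, d j) := by
  rw [hyperbolicScale_apply, polar_apply_apply he, polar_apply_apply he, tracePolar_apply,
    tracePolar_apply]
  simp only [mul_comm (d _) (b _), hbd, zero_mul, map_zero, mul_zero, add_zero, zero_add, zero_smul,
    smul_zero]
  by_cases h : i = j
  · subst h; simp; module
  · rw [if_neg h, if_neg h]; simp

/-- The map `(u, v) ↦ (s u, t v)` on `V`. -/
def diagConj (e : (E × E) ≃ₗ[F] V) (s t : Eˣ) : V ≃ₗ[F] V :=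
  e.symm.trans ((diagMap F s t).trans e)

theorem diagConj_apply (s t : Eˣ) (u v : E) :
    diagConj e s t (e (u, v)) = e (s * u, t * v) := by
  simp [diagConj, diagMap]

/-- Trace-dual bases decompose the space into three mutually orthogonal hyperbolic pairs, and the
map scales each of them by the same t. -/
theorem diagConj_isInduced (hE : Module.finrank F E = 3)
    (he : ∀ w, Q (e w) = traceQuadric F E w) {φ : (Fin 6 → F) ≃ₗ[F] V} (hφ : IsKlein Q φ)
    (t : Fˣ) :
    IsInduced φ (diagConj e (Units.map (algebraMap F E) t)⁻¹ (Units.map (algebraMap F E) t)) := by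
  obtain ⟨b, d, hbd⟩ := exists_dual_bases (F := F) (E := E) hE
  let D : Fin 3 → V →ₗ[F] V := fun i => hyperbolicScale Q (e (b i, 0)) (e (0, d i)) t
  have hD : ∀ i, IsInduced φ (D i) := fun i => by
    apply hyperbolicScale_isInduced hφ _ _ _ t.ne_zero
    · rw [he, traceQuadric_apply]; simp
    · rw [he, traceQuadric_apply]; simp
    · rw [polar_apply_apply he, tracePolar_apply]
      simp [mul_comm (d i), hbd]
  have h := ((hD 0).comp (hD 1)).comp (hD 2)
  have heq : (((D 0) ∘ₗ (D 1)) ∘ₗ (D 2)) = (diagConj e (Units.map (algebraMap F E) t)⁻¹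
      (Units.map (algebraMap F E) t) : V →ₗ[F] V) := by
    have h1 : ((((D 0) ∘ₗ (D 1)) ∘ₗ (D 2)) ∘ₗ (e : (E × E) →ₗ[F] V)) =
        (diagConj e (Units.map (algebraMap F E) t)⁻¹
          (Units.map (algebraMap F E) t) : V →ₗ[F] V) ∘ₗ (e : (E × E) →ₗ[F] V) := by
      apply LinearMap.prod_ext
      · apply b.ext
        intro j
        simp only [LinearMap.comp_apply, LinearMap.inl_apply, LinearEquiv.coe_coe, diagConj_apply]
        have hr : ((((Units.map (algebraMap F E : F →* E)) t)⁻¹ : Eˣ) : E) * b j =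
            (t : F)⁻¹ • b j := by
          rw [Algebra.smul_def, ← map_inv, Units.coe_map]; simp
        have hr' : e (((t : F)⁻¹ • b j), 0) = (t : F)⁻¹ • e (b j, 0) := by
          rw [← map_smul e, Prod.smul_mk, smul_zero]
        rw [hr, mul_zero, hr']
        fin_cases j <;> simp [D, hyperbolicScale_fst he hbd]
      · apply d.ext
        intro j
        simp only [LinearMap.comp_apply, LinearMap.inr_apply, LinearEquiv.coe_coe, diagConj_apply]
        have hr : (((Units.map (algebraMap F E : F →* E)) t : Eˣ) : E) * d j = (t : F) • d j := by
          rw [Algebra.smul_def, Units.coe_map]; simp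
        have hr' : e (0, ((t : F) • d j)) = (t : F) • e (0, d j) := by
          rw [← map_smul e, Prod.smul_mk, smul_zero]
        rw [hr, mul_zero, hr']
        fin_cases j <;> simp [D, hyperbolicScale_snd he hbd]
    apply LinearMap.ext
    intro v
    have := LinearMap.congr_fun h1 (e.symm v)
    simpa using this
  rw [heq] at h
  exact h

/-- The coordinates with respect to a pair of bases of `E`. -/
def pairCoordinates (b d : Module.Basis (Fin 3) F E) : (Fin 6 → F) ≃ₗ[F] (E × E) where
  toFun w := (b.equivFun.symm ![w 0, w 1, w 2], d.equivFun.symm ![w 3, w 4, w 5])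
  invFun v := ![b.equivFun v.1 0, b.equivFun v.1 1, b.equivFun v.1 2,
    d.equivFun v.2 0, d.equivFun v.2 1, d.equivFun v.2 2]
  map_add' v w := by
    simp only [Prod.mk_add_mk, ← map_add]
    congr 2 <;> ext i <;> fin_cases i <;> rfl
  map_smul' c w := by
    simp only [RingHom.id_apply, Prod.smul_mk, ← map_smul]
    congr 2 <;> ext i <;> fin_cases i <;> rfl
  left_inv w := by
    simp only [LinearEquiv.apply_symm_apply]
    ext i; fin_cases i <;> rfl
  right_inv v := by
    have h : ∀ f : Fin 3 → F, ![f 0, f 1, f 2] = f := by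
      intro f; ext i; fin_cases i <;> rfl
    ext1
    · exact (congrArg b.equivFun.symm (h _)).trans (LinearEquiv.symm_apply_apply _ _)
    · exact (congrArg d.equivFun.symm (h _)).trans (LinearEquiv.symm_apply_apply _ _)

theorem pairCoordinates_fst_eq_zero (b d : Module.Basis (Fin 3) F E) (w : Fin 6 → F) :
    (pairCoordinates b d w).1 = 0 ↔ w 0 = 0 ∧ w 1 = 0 ∧ w 2 = 0 := by
  change b.equivFun.symm ![w 0, w 1, w 2] = 0 ↔ _
  rw [LinearEquiv.map_eq_zero_iff]
  constructor
  · intro h; exact ⟨congrFun h 0, congrFun h 1, congrFun h 2⟩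
  · rintro ⟨h0, h1, h2⟩; rw [h0, h1, h2]; ext i; fin_cases i <;> rfl

theorem pairCoordinates_snd_eq_zero (b d : Module.Basis (Fin 3) F E) (w : Fin 6 → F) :
    (pairCoordinates b d w).2 = 0 ↔ w 3 = 0 ∧ w 4 = 0 ∧ w 5 = 0 := by
  change d.equivFun.symm ![w 3, w 4, w 5] = 0 ↔ _
  rw [LinearEquiv.map_eq_zero_iff]
  constructor
  · intro h; exact ⟨congrFun h 0, congrFun h 1, congrFun h 2⟩
  · rintro ⟨h0, h1, h2⟩; rw [h0, h1, h2]; ext i; fin_cases i <;> rfl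

theorem isKlein_pairCoordinates (he : ∀ w, Q (e w) = traceQuadric F E w)
    {b d : Module.Basis (Fin 3) F E}
    (hbd : ∀ i j, Algebra.trace F E (b i * d j) = if i = j then 1 else 0) :
    IsKlein Q ((pairCoordinates b d).trans e) := by
  refine ⟨1, one_ne_zero, fun w => ?_⟩
  rw [LinearEquiv.trans_apply, he, traceQuadric_apply, one_mul]
  change Algebra.trace F E (b.equivFun.symm ![w 0, w 1, w 2] *
    d.equivFun.symm ![w 3, w 4, w 5]) = _
  simp only [Module.Basis.equivFun_symm_apply, Fin.sum_univ_three, Matrix.cons_val, add_mul,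
    mul_add, smul_mul_smul_comm, map_add, map_smul, hbd, smul_eq_mul]
  simp

theorem single_mem_line_iff (l : PG3Line F) : (Pi.single 0 1 : Fin 4 → F) ∈ l.1 ↔
    linePlucker l 3 = 0 ∧ linePlucker l 4 = 0 ∧ linePlucker l 5 = 0 := by
  rw [mem_line_iff]
  constructor
  · intro h
    have h1 := h 0 1 2
    have h3 := h 0 1 3
    have h4 := h 0 2 3
    simp [pluckerMatrix] at h1 h3 h4
    exact ⟨h4, h3, h1⟩
  · rintro ⟨h3, h4, h5⟩ i j k
    fin_cases i <;> fin_cases j <;> fin_cases k <;> simp [pluckerMatrix, h3, h4, h5]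

theorem line_le_ker_iff (l : PG3Line F) :
    l.1 ≤ LinearMap.ker (LinearMap.proj 0 : (Fin 4 → F) →ₗ[F] F) ↔
      linePlucker l 0 = 0 ∧ linePlucker l 1 = 0 ∧ linePlucker l 2 = 0 := by
  obtain ⟨x, y, h1, h2⟩ := linePlucker_eq l
  have hI := linearIndependent_of_plucker (plucker_ne_zero_of_line h1)
  rw [LinearIndependent.pair_iff] at hI
  rw [h1, h2, Submodule.span_le, Set.pair_subset_iff]
  simp only [SetLike.mem_coe, LinearMap.mem_ker, LinearMap.proj_apply, plucker, Matrix.cons_val]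
  constructor
  · rintro ⟨hx, hy⟩
    simp [hx, hy]
  · rintro ⟨e1, e2, e3⟩
    have h := hI (-y 0) (x 0) (by
      ext j
      simp only [Pi.add_apply, Pi.smul_apply, smul_eq_mul, Pi.zero_apply]
      fin_cases j
      · simp; ring
      · simp only [Fin.mk_one]; linear_combination e1
      · simp only [Fin.reduceFinMk]; linear_combination e2
      · simp only [Fin.reduceFinMk]; linear_combination e3)
    exact ⟨h.2, by simpa using h.1⟩

/-- The Klein correspondence built from a pair of dual bases. -/
theorem exists_klein_star_linesIn (hE : Module.finrank F E = 3)
    (he : ∀ w, Q (e w) = traceQuadric F E w) :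
    ∃ φ : (Fin 6 → F) ≃ₗ[F] V, IsKlein Q φ ∧
      ∃ (p : PG3Point F) (H : Submodule F (Fin 4 → F)),
        Module.finrank F H = 3 ∧ ¬ p.submodule ≤ H ∧
        kleinLines φ (pi1 e) = star p ∧ kleinLines φ (pi2 e) = linesIn H := by
  obtain ⟨b, d, hbd⟩ := exists_dual_bases (F := F) (E := E) hE
  have hs : (Pi.single 0 1 : Fin 4 → F) ≠ 0 := by simp
  refine ⟨(pairCoordinates b d).trans e, isKlein_pairCoordinates he hbd,
    -- A line contains the first coordinate point exactly when its last three Plücker coordinates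
    -- vanish, and lies in the plane x₀ = 0 exactly when the first three do. These are the equations
    -- of π₁ and π₂ in dual bases.
    Projectivization.mk F (Pi.single 0 1) hs,
    LinearMap.ker (LinearMap.proj 0 : (Fin 4 → F) →ₗ[F] F), ?_, ?_, ?_, ?_⟩
  · have h := Module.Dual.finrank_ker_add_one_of_ne_zero
      (f := (LinearMap.proj 0 : (Fin 4 → F) →ₗ[F] F)) (by
        intro h
        have := LinearMap.congr_fun h (Pi.single 0 1)
        simp at this)
    rw [Module.finrank_fin_fun] at h
    omega
  · rw [Projectivization.submodule_mk, Submodule.span_singleton_le_iff_mem]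
    simp
  · ext l
    rw [mem_kleinLines, mem_pi1, star, Set.mem_ofPred_eq, Projectivization.submodule_mk,
      Submodule.span_singleton_le_iff_mem, single_mem_line_iff]
    obtain ⟨c, hc, h⟩ := rep_kleinPoint (φ := (pairCoordinates b d).trans e) l
    rw [h, LinearEquiv.trans_apply, e.symm_apply_apply, pairCoordinates_snd_eq_zero]
    simp [hc]
  · ext l
    rw [mem_kleinLines, mem_pi2, linesIn, Set.mem_ofPred_eq, line_le_ker_iff]
    obtain ⟨c, hc, h⟩ := rep_kleinPoint (φ := (pairCoordinates b d).trans e) l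
    rw [h, LinearEquiv.trans_apply, e.symm_apply_apply, pairCoordinates_fst_eq_zero]
    simp [hc]

/-- A hyperbolic quadric is isometric to the trace model. -/
theorem nonempty_isometryEquiv (hE : Module.finrank F E = 3) (h2 : (2 : F) ≠ 0)
    (hQ : IsHyperbolicQuadric Q) : Nonempty ((traceQuadric F E).IsometryEquiv Q) := by
  have hfE := finiteDimensional_of_fintype (F := F) (E := E)
  have hfV : FiniteDimensional F V := Module.finite_of_finrank_pos (by rw [hQ.finrank_eq]; omega)
  obtain ⟨W, hW, hW3⟩ := hQ.exists_singular
  let i₀ : E ≃ₗ[F] W := LinearEquiv.ofFinrankEq _ _ (hE.trans hW3.symm)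
  let i : E →ₗ[F] V := W.subtype ∘ₗ (i₀ : E →ₗ[F] W)
  have hi : Function.Injective i := W.injective_subtype.comp i₀.injective
  have hiQ : ∀ u, Q (i u) = 0 := fun u => hW _ (i₀ u).2
  have hiB : ∀ u u', QuadraticMap.polar Q (i u) (i u') = 0 := by
    intro u u'
    rw [QuadraticMap.polar, ← map_add, hiQ, hiQ, hiQ]; simp
  have hBinj : Function.Injective Q.polarBilin := by
    rw [injective_iff_map_eq_zero]
    intro v hv
    exact hQ.nondegenerate v fun w => LinearMap.congr_fun hv w
  have hBsurj : Function.Surjective Q.polarBilin :=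
    (LinearMap.injective_iff_surjective_of_finrank_eq_finrank
      (Subspace.dual_finrank_eq (K := F) (V := V)).symm).1 hBinj
  have hΦ : Function.Surjective (i.dualMap ∘ₗ Q.polarBilin) :=
    (LinearMap.dualMap_surjective_of_injective hi).comp hBsurj
  obtain ⟨g, hg⟩ := LinearMap.exists_rightInverse_of_surjective _ (LinearMap.range_eq_top.2 hΦ)
  have hnd := traceForm_nondegenerate F E
  -- A copy of E paired with the singular subspace W by the trace form. It need not be singular yet.
  let j₀ : E →ₗ[F] V := g ∘ₗ Algebra.traceForm F E
  have hj₀ : ∀ v u, QuadraticMap.polar Q (j₀ v) (i u) = Algebra.trace F E (v * u) := by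
    intro v u
    exact LinearMap.congr_fun (LinearMap.congr_fun hg (Algebra.traceForm F E v)) u
  -- Subtracting the vector of W that represents half of the polar form restricted to the copy makes
  -- the copy singular; since W is singular the pairing with W does not change.
  let r : E →ₗ[F] E := ((Algebra.traceForm F E).toDual hnd).symm.toLinearMap ∘ₗ
    ((2 : F)⁻¹ • (j₀.dualMap ∘ₗ Q.polarBilin ∘ₗ j₀))
  have hr : ∀ v v', Algebra.trace F E (r v * v') =
      2⁻¹ * QuadraticMap.polar Q (j₀ v) (j₀ v') := by
    intro v v'
    exact LinearMap.BilinForm.apply_toDual_symm_apply (hB := hnd) _ _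
  let j : E →ₗ[F] V := j₀ - i ∘ₗ r
  have hj : ∀ v, j v = j₀ v - i (r v) := fun v => rfl
  have hjB : ∀ v u, QuadraticMap.polar Q (j v) (i u) = Algebra.trace F E (v * u) := by
    intro v u
    rw [hj, QuadraticMap.polar_sub_left, hiB, sub_zero, hj₀]
  have hjQ : ∀ v, Q (j v) = 0 := by
    intro v
    have h : 2 * Q (j v) = QuadraticMap.polar Q (j v) (j v) := by
      rw [QuadraticMap.polar_self, two_nsmul, two_mul]
    have h' : QuadraticMap.polar Q (j v) (j v) = 0 := by
      nth_rewrite 2 [hj]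
      rw [QuadraticMap.polar_sub_right, hjB, hj, QuadraticMap.polar_sub_left,
        QuadraticMap.polar_comm Q (i (r v)), hj₀, mul_comm v, hr]
      field_simp
      ring
    rw [h'] at h
    exact (mul_eq_zero.1 h).resolve_left h2
  let M : E × E →ₗ[F] V := i.coprod j
  have hM : ∀ w, M w = i w.1 + j w.2 := fun w => rfl
  have hMinj : Function.Injective M := by
    rw [injective_iff_map_eq_zero]
    rintro ⟨u, v⟩ h
    rw [hM] at h
    have hv : v = 0 := by
      by_contra hv
      refine traceMulRight_ne_zero (F := F) hv (LinearMap.ext fun x => ?_)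
      have h3 : QuadraticMap.polar Q (i u + j v) (i x) = 0 := by rw [h]; simp
      rw [QuadraticMap.polar_add_left, hiB, hjB, zero_add] at h3
      rw [traceMulRight_apply, mul_comm, h3]; rfl
    subst hv
    have hu : u = 0 := hi (by simpa using h)
    rw [hu]; rfl
  have hdim : Module.finrank F (E × E) = Module.finrank F V := by
    rw [Module.finrank_prod, hE, hQ.finrank_eq]
  refine ⟨⟨LinearMap.linearEquivOfInjective M hMinj hdim, fun w => ?_⟩⟩
  change Q (M w) = _
  rw [hM, QuadraticMap.map_add Q, hiQ, hjQ, QuadraticMap.polar_comm, hjB, traceQuadric_apply,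
    mul_comm]
  simp

end Model
end TightSets
end

noncomputable section

namespace TightSets

/-! ### Action of G and the exchange of the two sign classes -/

section Group

variable {F E V : Type*} [Field F] [Fintype F] [DecidableEq F] [Field E] [Fintype E]
  [DecidableEq E] [Algebra F E] [AddCommGroup V] [Module F V]
  {Q : QuadraticForm F V} {e : (E × E) ≃ₗ[F] V}

theorem diagConj_mul (s t s' t' : Eˣ) :
    diagConj e s t * diagConj e s' t' = diagConj e (s * s') (t * t') := by
  ext v
  obtain ⟨⟨x, y⟩, rfl⟩ := e.surjective v
  rw [LinearEquiv.mul_apply, diagConj_apply, diagConj_apply, diagConj_apply]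
  push_cast
  rw [mul_assoc, mul_assoc]

theorem diagConj_one : diagConj e 1 1 = (1 : V ≃ₗ[F] V) := by
  ext v
  obtain ⟨⟨x, y⟩, rfl⟩ := e.surjective v
  rw [diagConj_apply]
  simp

/-- Every element of `G` is diagonal, scales the first factor by a square, and multiplies the form
by a fourth power. -/
theorem exists_diagConj_of_mem_groupG (hE : Module.finrank F E = 3) (h2 : (2 : F) ≠ 0) (α : Eˣ)
    {g : V ≃ₗ[F] V} (hg : g ∈ groupG e α) :
    ∃ s t : Eˣ, g = diagConj e s t ∧ quadraticChar E s = 1 ∧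
      ∃ k : Fˣ, ((s * t : Eˣ) : E) = algebraMap F E ((k : F) ^ 4) := by
  induction hg using Subgroup.closure_induction with
  | mem g hg =>
    rcases hg with rfl | rfl
    · refine ⟨mu F α, (mu F α)⁻¹, rfl, ?_, 1, by simp⟩
      -- As q - 1 is even, μ = α^(q-1) is a square in E.
      have hodd : Odd (Nat.card F) := by
        rw [Nat.card_eq_fintype_card, ← Nat.not_even_iff_odd, Nat.even_iff,
          ← FiniteField.even_card_iff_char_two]
        exact ringChar_ne_two_of_two_ne_zero h2
      obtain ⟨m, hm⟩ := hodd
      rw [mu, hm, Nat.add_sub_cancel, mul_comm, pow_mul]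
      push_cast
      rw [quadraticChar_sq_one' (by simp)]
    -- The element ω is the norm of α, so it lies in F and ω⁴ is a fourth power of F.
    · refine ⟨1, omega F α ^ 4, rfl, by simp, Units.map (Algebra.norm F) α, ?_⟩
      have hn : algebraMap F E (Algebra.norm F (α : E)) = (omega F α : E) := by
        rw [FiniteField.algebraMap_norm_eq_pow_sum, hE, omega]
        push_cast
        congr 1
        simp only [Finset.sum_range_succ, Finset.sum_range_zero]
        ring
      rw [Units.coe_map, map_pow]
      push_cast
      rw [one_mul, ← hn]
  | one => exact ⟨1, 1, diagConj_one.symm, by simp, 1, by simp⟩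
  | mul g g' _ _ h h' =>
    obtain ⟨s, t, rfl, hs, k, hk⟩ := h
    obtain ⟨s', t', rfl, hs', k', hk'⟩ := h'
    refine ⟨s * s', t * t', diagConj_mul _ _ _ _, ?_, k * k', ?_⟩
    · push_cast; rw [map_mul, hs, hs', one_mul]
    · push_cast at hk hk' ⊢
      rw [mul_pow, ← hk, ← hk']
      ring
  | inv g _ h =>
    obtain ⟨s, t, rfl, hs, k, hk⟩ := h
    refine ⟨s⁻¹, t⁻¹, ?_, ?_, k⁻¹, ?_⟩
    · rw [inv_eq_iff_mul_eq_one, diagConj_mul, mul_inv_cancel, mul_inv_cancel, diagConj_one]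
    · rw [Units.val_inv_eq_inv_val, quadraticChar_inv, hs]
    · push_cast at hk ⊢
      rw [inv_pow, ← hk, mul_inv]

theorem isSimilarity_diagConj (he : ∀ w, Q (e w) = traceQuadric F E w) {s t : Eˣ} {k : F}
    (hk : k ≠ 0) (h : ((s * t : Eˣ) : E) = algebraMap F E k) :
    IsSimilarity Q (diagConj e s t) := by
  refine ⟨k, hk, fun v => ?_⟩
  obtain ⟨⟨x, y⟩, rfl⟩ := e.surjective v
  rw [diagConj_apply, he, he, traceQuadric_apply, traceQuadric_apply, ← trace_algebraMap_mul, ← h]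
  push_cast
  congr 1; ring

variable {η : F → ℤ} {θ ε : E → ℤ} {σ : ℤ}

theorem mk_mem_signPoints (hE : Module.finrank F E = 3) (h2 : (2 : F) ≠ 0)
    (hη : IsQuarticSign η) (hε : IsTraceSign η θ ε) {v : V} (hv : v ≠ 0) :
    Projectivization.mk F v hv ∈ signPoints e ε σ ↔ pairSign ε (e.symm v) = σ := by
  obtain ⟨a, ha⟩ := Projectivization.exists_smul_eq_mk_rep F v hv
  rw [signPoints, Set.mem_ofPred_eq, ← ha, Units.smul_def, map_smul,
    pairSign_smul hE h2 hη hε a.ne_zero]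

theorem smul_mem_signPoints (hE : Module.finrank F E = 3) (h2 : (2 : F) ≠ 0)
    (hη : IsQuarticSign η) (hε : IsTraceSign η θ ε) (f : V ≃ₗ[F] V) (p : ℙ F V) :
    f • p ∈ signPoints e ε σ ↔ pairSign ε (e.symm (f p.rep)) = σ := by
  conv_lhs => rw [← p.mk_rep]
  rw [Projectivization.smul_mk, mk_mem_signPoints hE h2 hη hε]
  rfl

/-- The product uv is multiplied by k², which changes ε by χ(k). For elements of G this k is itself
a square, the reason for the exponent 4 in z. -/
theorem pairSign_diagConj (hE : Module.finrank F E = 3) (h2 : (2 : F) ≠ 0)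
    (hη : IsQuarticSign η) (hε : IsTraceSign η θ ε) {s t : Eˣ} {k : F}
    (h : ((s * t : Eˣ) : E) = algebraMap F E (k ^ 2)) (v : V) :
    pairSign ε (e.symm (diagConj e s t v)) =
      quadraticChar E s * quadraticChar F k * pairSign ε (e.symm v) := by
  obtain ⟨⟨x, y⟩, rfl⟩ := e.surjective v
  rw [diagConj_apply, e.symm_apply_apply, e.symm_apply_apply]
  simp only [pairSign]
  have : (s : E) * x * (t * y) = k ^ 2 • (x * y) := by
    rw [Algebra.smul_def, ← h]; push_cast; ring
  rw [this, hε.mul_sq hE h2 hη, map_mul]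
  ring

theorem orbit_subset_signPoints (hE : Module.finrank F E = 3) (h2 : (2 : F) ≠ 0)
    (hη : IsQuarticSign η) (hε : IsTraceSign η θ ε) (α : Eˣ) (p : ℙ F V)
    (hp : p ∈ signPoints e ε σ) : MulAction.orbit (groupG e α) p ⊆ signPoints e ε σ := by
  rintro _ ⟨⟨g, hg⟩, rfl⟩
  obtain ⟨s, t, rfl, hs, k, hk⟩ := exists_diagConj_of_mem_groupG hE h2 α hg
  change diagConj e s t • p ∈ _
  rw [smul_mem_signPoints hE h2 hη hε,
    pairSign_diagConj hE h2 hη hε (k := (k : F) ^ 2) (by rw [hk, ← pow_mul]), hs,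
    quadraticChar_sq_one' k.ne_zero, one_mul, one_mul]
  exact hp

/-- The map fixes uv and multiplies u by the inverse of a nonsquare of F, which remains a nonsquare
in E. -/
theorem image_signPoints (hE : Module.finrank F E = 3) (h2 : (2 : F) ≠ 0)
    (hη : IsQuarticSign η) (hε : IsTraceSign η θ ε) {k : Fˣ} (hk : quadraticChar F k = -1) :
    (fun p : ℙ F V => diagConj e (Units.map (algebraMap F E) k)⁻¹
      (Units.map (algebraMap F E) k) • p) '' signPoints e ε σ = signPoints e ε (-σ) := by
  have hval : quadraticChar E ((Units.map (algebraMap F E : F →* E) k)⁻¹ : Eˣ) = -1 := by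
    rw [Units.val_inv_eq_inv_val, quadraticChar_inv, Units.coe_map]
    exact (quadraticChar_algebraMap hE _).trans hk
  have hmem : ∀ (p : ℙ F V) (τ : ℤ), diagConj e (Units.map (algebraMap F E) k)⁻¹
      (Units.map (algebraMap F E) k) • p ∈ signPoints e ε (-τ) ↔ p ∈ signPoints e ε τ := by
    intro p τ
    rw [smul_mem_signPoints hE h2 hη hε, pairSign_diagConj hE h2 hη hε (k := 1) (by simp), hval,
      map_one, signPoints, Set.mem_ofPred_eq]
    constructor <;> intro h <;> linarith
  ext p
  constructor
  · rintro ⟨p, hp, rfl⟩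
    exact (hmem p σ).2 hp
  · intro hp
    refine ⟨(diagConj e (Units.map (algebraMap F E) k)⁻¹ (Units.map (algebraMap F E) k))⁻¹ • p,
      ?_, smul_inv_smul _ p⟩
    rw [← hmem, smul_inv_smul]
    exact hp

theorem isGenerator_pi1 (hE : Module.finrank F E = 3) (hQ : IsHyperbolicQuadric Q)
    (he : ∀ w, Q (e w) = traceQuadric F E w) : IsGenerator Q (pi1 e) := by
  refine ⟨_, ?_, ?_, rfl⟩
  · rintro _ ⟨w, hw, rfl⟩
    have : w.2 = 0 := hw.2
    rw [LinearEquiv.coe_coe, he, traceQuadric_apply, this]; simp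
  · intro W' hW'
    rw [LinearEquiv.finrank_map_eq, ← Submodule.map_inl, Submodule.map_top,
      LinearMap.finrank_range_of_inj LinearMap.inl_injective, hE]
    exact hQ.finrank_le W' hW'

theorem isGenerator_pi2 (hE : Module.finrank F E = 3) (hQ : IsHyperbolicQuadric Q)
    (he : ∀ w, Q (e w) = traceQuadric F E w) : IsGenerator Q (pi2 e) := by
  have h := isGenerator_pi1 (Q := Q) (e := (LinearEquiv.prodComm F E E).trans e) hE hQ (by
    intro w
    rw [LinearEquiv.trans_apply, he, traceQuadric_apply, traceQuadric_apply]
    simp [mul_comm])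
  have h1 : pi1 ((LinearEquiv.prodComm F E E).trans e) = pi2 e := by
    ext p
    rw [mem_pi1, mem_pi2]
    rfl
  rwa [h1] at h

theorem groupG_commute (hE : Module.finrank F E = 3) (h2 : (2 : F) ≠ 0) (α : Eˣ)
    {g h : V ≃ₗ[F] V} (hg : g ∈ groupG e α) (hh : h ∈ groupG e α) : g * h = h * g := by
  obtain ⟨s, t, rfl, -⟩ := exists_diagConj_of_mem_groupG hE h2 α hg
  obtain ⟨s', t', rfl, -⟩ := exists_diagConj_of_mem_groupG hE h2 α hh
  rw [diagConj_mul, diagConj_mul, mul_comm s, mul_comm t]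

theorem union_eq_quadric (hE : Module.finrank F E = 3) (h2 : (2 : F) ≠ 0)
    (he : ∀ w, Q (e w) = traceQuadric F E w) (hη : IsQuarticSign η) (hθ : IsConicSign F θ)
    (hε : IsTraceSign η θ ε) :
    pi1 e ∪ pi2 e ∪ signPoints e ε 1 ∪ signPoints e ε (-1) = quadric Q := by
  ext p
  have hs := pairSign_sq hE h2 hη hθ hε (e.symm p.rep)
  simp only [Set.mem_union, mem_pi1, mem_pi2]
  rw [quadric, Set.mem_ofPred_eq, form_eq he]
  constructor
  · rintro (((h | h) | h) | h)
    · simp [h]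
    · simp [h]
    · exact (pairSign_ne_of_not hE h2 hη hθ hε (by norm_num) h).2
    · exact (pairSign_ne_of_not hE h2 hη hθ hε (by norm_num) h).2
  · intro h
    by_cases h1 : (e.symm p.rep).1 = 0
    · exact Or.inl (Or.inl (Or.inr h1))
    by_cases h3 : (e.symm p.rep).2 = 0
    · exact Or.inl (Or.inl (Or.inl h3))
    rw [if_pos ⟨⟨h1, h3⟩, h⟩] at hs
    rcases sq_eq_one_iff.1 hs with h4 | h4
    · exact Or.inl (Or.inr h4)
    · exact Or.inr h4

theorem pairwise_disjoint (hE : Module.finrank F E = 3) (h2 : (2 : F) ≠ 0)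
    (hη : IsQuarticSign η) (hθ : IsConicSign F θ) (hε : IsTraceSign η θ ε) :
    [pi1 e, pi2 e, signPoints e ε 1, signPoints e ε (-1)].Pairwise Disjoint := by
  have h1 : ∀ σ : ℤ, σ ^ 2 = 1 → Disjoint (pi1 e) (signPoints e ε σ) := fun σ hσ =>
    Set.disjoint_left.2 fun p hp hp' =>
      (pairSign_ne_of_not hE h2 hη hθ hε hσ hp').1.2 (mem_pi1.1 hp)
  have h3 : ∀ σ : ℤ, σ ^ 2 = 1 → Disjoint (pi2 e) (signPoints e ε σ) := fun σ hσ =>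
    Set.disjoint_left.2 fun p hp hp' =>
      (pairSign_ne_of_not hE h2 hη hθ hε hσ hp').1.1 (mem_pi2.1 hp)
  have h4 : Disjoint (pi1 e) (pi2 e) := Set.disjoint_left.2 fun p hp hp' =>
    rep_ne_zero_pair e p (Prod.ext (mem_pi2.1 hp') (mem_pi1.1 hp))
  have h5 : Disjoint (signPoints e ε 1) (signPoints e ε (-1)) :=
    Set.disjoint_left.2 fun p (hp : pairSign _ _ = 1) (hp' : pairSign _ _ = -1) => by omega
  simp only [List.pairwise_cons, List.mem_cons, List.not_mem_nil, or_false, forall_eq_or_imp,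
    forall_eq, IsEmpty.forall_iff, implies_true, List.Pairwise.nil, and_true]
  exact ⟨⟨h4, h1 1 (by norm_num), h1 (-1) (by norm_num)⟩,
    ⟨h3 1 (by norm_num), h3 (-1) (by norm_num)⟩, h5⟩

end Group
end TightSets
end
theorem mainTheorem1 {F E V : Type*} [Field F] [Finite F] [Field E] [Algebra F E]
    [AddCommGroup V] [Module F V]
    (hq : Nat.card F % 12 = 5 ∨ Nat.card F % 12 = 9)
    (hE : Module.finrank F E = 3)
    (α : Eˣ) (hα : ∀ x : Eˣ, x ∈ Subgroup.zpowers α)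
    (Q : QuadraticForm F V) (hQ : TightSets.IsHyperbolicQuadric Q) :
    Nonempty ((TightSets.traceQuadric F E).IsometryEquiv Q) ∧
    ∀ e : (E × E) ≃ₗ[F] V, (∀ w, Q (e w) = TightSets.traceQuadric F E w) →
      (∀ g ∈ TightSets.groupG e α, ∀ h ∈ TightSets.groupG e α, g * h = h * g) ∧
      (∀ g ∈ TightSets.groupG e α, TightSets.IsSimilarity Q g) ∧
      (∃ φ : (Fin 6 → F) ≃ₗ[F] V, TightSets.IsKlein Q φ ∧
        ∃ (p : TightSets.PG3Point F) (H : Submodule F (Fin 4 → F)),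
          Module.finrank F H = 3 ∧ ¬ p.submodule ≤ H ∧
          TightSets.kleinLines φ (TightSets.pi1 e) = TightSets.star p ∧
          TightSets.kleinLines φ (TightSets.pi2 e) = TightSets.linesIn H) ∧
      TightSets.IsGenerator Q (TightSets.pi1 e) ∧
      TightSets.IsGenerator Q (TightSets.pi2 e) ∧
      TightSets.IsTight Q 1 (TightSets.pi1 e) ∧
      TightSets.IsTight Q 1 (TightSets.pi2 e) ∧
      ∃ T₁ T₂ : Set (ℙ F V),
        [TightSets.pi1 e, TightSets.pi2 e, T₁, T₂].Pairwise Disjoint ∧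
        TightSets.pi1 e ∪ TightSets.pi2 e ∪ T₁ ∪ T₂ = TightSets.quadric Q ∧
        TightSets.IsTight Q ((Nat.card F ^ 2 - 1) / 2) T₁ ∧
        TightSets.IsTight Q ((Nat.card F ^ 2 - 1) / 2) T₂ ∧
        (∃ f : V ≃ₗ[F] V, TightSets.IsSimilarity Q f ∧
          (fun p : ℙ F V => f • p) '' T₁ = T₂) ∧
        (∀ p ∈ T₁, MulAction.orbit (TightSets.groupG e α) p ⊆ T₁) ∧
        (∀ p ∈ T₂, MulAction.orbit (TightSets.groupG e α) p ⊆ T₂) ∧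
        ∀ φ : (Fin 6 → F) ≃ₗ[F] V, TightSets.IsKlein Q φ →
          TightSets.IsCameronLiebler (TightSets.kleinLines φ T₁) ((Nat.card F ^ 2 - 1) / 2) ∧
          TightSets.IsCameronLiebler (TightSets.kleinLines φ T₂) ((Nat.card F ^ 2 - 1) / 2) ∧
          ∃ g : (Fin 4 → F) ≃ₗ[F] (Fin 4 → F),
            TightSets.mapLine g '' TightSets.kleinLines φ T₁ = TightSets.kleinLines φ T₂ := by
  classical
  have : Module.Finite F E := Module.finite_of_finrank_pos (by omega)
  have : Finite E := Module.finite_of_finite F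
  have := Fintype.ofFinite F
  have := Fintype.ofFinite E
  have hF : Fintype.card F % 4 = 1 := by rw [← Nat.card_eq_fintype_card]; omega
  have h2 := TightSets.two_ne_zero_of_card hF
  have hsq := TightSets.isSquare_neg_one_of_card hF
  refine ⟨TightSets.nonempty_isometryEquiv hE h2 hQ, fun e he => ?_⟩
  obtain ⟨η, hη⟩ := TightSets.exists_isQuarticSign h2 hsq
  obtain ⟨θ, hθ⟩ := TightSets.exists_isConicSign (E := E) hE h2
  obtain ⟨ε, hε⟩ := TightSets.exists_isTraceSign hE h2 hsq hη hθ
  -- A nonsquare k of F. The scaling (u,v) ↦ (k⁻¹u, kv) serves both as the similarity and, through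
  -- every Klein correspondence, as the source of the collineation.
  obtain ⟨k, hk⟩ := quadraticChar_exists_neg_one' (TightSets.ringChar_ne_two_of_two_ne_zero h2)
  have himage := TightSets.image_signPoints (e := e) (σ := 1) hE h2 hη hε hk
  have hσ : (1 : ℤ) ^ 2 = 1 := by norm_num
  have hσ' : (-1 : ℤ) ^ 2 = 1 := by norm_num
  have ht := TightSets.isTight_signPoints hE hF he hη hθ hε hσ
  have ht' := TightSets.isTight_signPoints hE hF he hη hθ hε hσ'
  refine ⟨fun g hg h hh => TightSets.groupG_commute hE h2 α hg hh, fun g hg => ?_,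
    TightSets.exists_klein_star_linesIn hE he, TightSets.isGenerator_pi1 hE hQ he,
    TightSets.isGenerator_pi2 hE hQ he, TightSets.isTight_pi1 hE he,
    TightSets.isTight_pi2 hE he, TightSets.signPoints e ε 1, TightSets.signPoints e ε (-1),
    TightSets.pairwise_disjoint hE h2 hη hθ hε, TightSets.union_eq_quadric hE h2 he hη hθ hε,
    ht, ht', ⟨_, ?_, himage⟩,
    fun p hp => TightSets.orbit_subset_signPoints hE h2 hη hε α p hp,
    fun p hp => TightSets.orbit_subset_signPoints hE h2 hη hε α p hp, fun φ hφ => ⟨?_, ?_, ?_⟩⟩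
  · obtain ⟨s, t, rfl, -, c, hc⟩ := TightSets.exists_diagConj_of_mem_groupG hE h2 α hg
    exact TightSets.isSimilarity_diagConj he (pow_ne_zero 4 c.ne_zero) hc
  · exact TightSets.isSimilarity_diagConj he (k := 1) one_ne_zero (by simp)
  · exact TightSets.isCameronLiebler_kleinLines hφ ht
      (TightSets.ncard_signPoints hE hF hη hθ hε hσ)
  · exact TightSets.isCameronLiebler_kleinLines hφ ht'
      (TightSets.ncard_signPoints hE hF hη hθ hε hσ')
  · obtain ⟨g, hg⟩ := TightSets.mapLine_image_kleinLines
      (TightSets.diagConj_isInduced hE he hφ k) (TightSets.signPoints e ε 1)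
    exact ⟨g, by rw [hg, himage]⟩
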